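/- Let $N\ge 3$, let $S$ be a subgroup of $O(N+1)$, let $\Gamma\subset\mathbb S^N\subset\mathbb R^{N+1}$ be a compact smooth embedded minimal hypersurface of the unit sphere, and let $C=\{r\theta: r>0,\ \theta\in\Gamma\}$ be the minimal cone over $\Gamma$, with a continuous unit normal $\nu_C(r\theta)=\nu_C(\theta)$. Let $\Sigma\subset\mathbb R^{N+1}$ be a smooth embedded minimal hypersurface with a continuous unit normal $\nu_\Sigma$. Assume: - (H1) $\Gamma$ is not contained in an $N$-dimensional linear subspace of $\mathbb R^{N+1}$, and $\rho(C)\subset C$ for all $\rho\in S$; - (H2) $\rho(\Sigma)\subset\Sigma$ for all $\rho\in S$; - (H3) there are $R>0$ and a bounded smooth function $w:(R,\infty)\times\Gamma\to\mathbb R$ with $\lim_{r\to\infty}\|w(r,\cdot)\|_{C^2(\Gamma)}=0$ such that $\Sigma_R:=\{r\theta+w(r,\theta)\nu_C(\theta):\theta\in\Gamma,\ r>R\}$ is contained in $\Sigma$ and $\Sigma\setminus\Sigma_R$ is compact; - (H4) every $\rho\in O(N+1)$ with $\rho(C)\subset C$ belongs to $S$. For $y\in\Sigma$ put $\zeta_0(y)=y\cdot\nu_\Sigma(y)$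 (dilations), $\zeta_j(y)=e_j\cdot\nu_\Sigma(y)$ for $1\le j\le N+1$ (translations), and $\zeta_M(y)=My\cdot\nu_\Sigma(y)$ for antisymmetric $M\in\mathbb R^{(N+1)\times(N+1)}$ (rotations), and let $G(\Sigma)$ be the linear span of all these functions (the geometric Jacobi fields). Let $$\bar\nu:=\inf\Big\{\nu\in\mathbb R:\ \limsup_{|y|\to\infty,\ y\in\Sigma}|y|^{-\nu}|\zeta_0(y)|=0\Big\}\in[-\infty,\infty],$$ and for $\nu\in\mathbb R$ let $$D_\nu(\Sigma):=\{\phi\in C^2(\Sigma):\ \Delta_\Sigma\phi+|A_\Sigma|^2\phi=0,\ \ \phi\,(1+|y|)^{-\nu}\in L^\infty(\Sigma)\}.$$ Then: 1. for every real $\nu<\bar\nu$, $G(\Sigma)\cap D_\nu(\Sigma)=\{0\}$; 2. if $\zeta\in\operatorname{span}\{\zeta_1,\dots,\zeta_{N+1}\}$ is not identically zero, then $\limsup_{|y|\to\infty,\ y\in\Sigma}|\zeta(y)|>0$; 3. for every antisymmetric $M$, either $\zeta_M\equiv 0$ on $\Sigma$, or $\zeta_M$ has linear growth: there are $c,K,t_0$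 with $c>0$ such that for all $t\ge t_0$ one has $|\zeta_M(y)|\le Kt$ for all $y\in\Sigma$ with $|y|=t$, and $|\zeta_M(y)|\ge ct$ for at least one such $y$; 4. $\zeta_0(y)\to0$ as $|y|\to\infty$, $y\in\Sigma$. -/

import Mathlib

open Set Filter Topology
open scoped ContDiff RealInnerProductSpace ENNReal

noncomputable section

/-- Euclidean space `ℝⁿ`. -/
abbrev Euc (n : ℕ) : Type := EuclideanSpace ℝ (Fin n)

/-- The `i`-th partial derivative of a map defined on (an open subset of) `ℝᵐ`. -/
def pderiv {m : ℕ} {F : Type*} [NormedAddCommGroup F] [NormedSpace ℝ F]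
    (i : Fin m) (f : Euc m → F) (u : Euc m) : F :=
  fderiv ℝ f u (EuclideanSpace.single i (1 : ℝ))

/-- A smooth `m`-dimensional patch of the set `M ⊆ ℝⁿ`: a smooth immersion of an open subset
of `ℝᵐ` into `ℝⁿ` whose image lies in `M`. -/
structure Patch (m : ℕ) {n : ℕ} (M : Set (Euc n)) where
  dom : Set (Euc m)
  map : Euc m → Euc n
  isOpen_dom : IsOpen dom
  smooth : ContDiffOn ℝ ∞ map dom
  immersive : ∀ u ∈ dom, Function.Injective (fderiv ℝ map u)
  mapsTo : MapsTo map dom M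

/-- `M` is a smooth embedded `m`-dimensional submanifold (without boundary) of `ℝⁿ`: around each
of its points there is a patch that is a homeomorphism onto a relatively open subset of `M`. -/
def IsEmbeddedSubmanifold (m : ℕ) {n : ℕ} (M : Set (Euc n)) : Prop :=
  ∀ y ∈ M, ∃ (P : Patch m M) (V : Set (Euc n)) (Q : Euc n → Euc m),
    IsOpen V ∧ y ∈ V ∧ P.map '' P.dom = M ∩ V ∧ ContinuousOn Q (M ∩ V) ∧ LeftInvOn Q P.map P.dom

namespace Patch

variable {m n : ℕ} {M : Set (Euc n)}

/-- The induced metric `g i j = ⟨∂ᵢX, ∂ⱼX⟩`. -/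
def metric (P : Patch m M) (u : Euc m) : Matrix (Fin m) (Fin m) ℝ :=
  Matrix.of fun i j => ⟪pderiv i P.map u, pderiv j P.map u⟫

/-- The second fundamental form `h i j = ⟨∂ᵢ∂ⱼX, ν⟩` with respect to the normal field `ν`. -/
def secondForm (P : Patch m M) (ν : Euc n → Euc n) (u : Euc m) : Matrix (Fin m) (Fin m) ℝ :=
  Matrix.of fun i j => ⟪pderiv i (pderiv j P.map) u, ν (P.map u)⟫

/-- The mean curvature `gⁱʲ hᵢⱼ`. -/
def meanCurvature (P : Patch m M) (ν : Euc n → Euc n) (u : Euc m) : ℝ :=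
  ((P.metric u)⁻¹ * P.secondForm ν u).trace

/-- `|A|² = gⁱᵏ gʲˡ hᵢⱼ hₖₗ`. -/
def normSqSecondForm (P : Patch m M) (ν : Euc n → Euc n) (u : Euc m) : ℝ :=
  ((P.metric u)⁻¹ * P.secondForm ν u * (P.metric u)⁻¹ * P.secondForm ν u).trace

/-- The Laplace–Beltrami operator `(det g)^(-1/2) ∂ᵢ ((det g)^(1/2) gⁱʲ ∂ⱼ f)` in the patch. -/
def laplaceBeltrami (P : Patch m M) (f : Euc m → ℝ) (u : Euc m) : ℝ :=
  (√(P.metric u).det)⁻¹ *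
    ∑ i, pderiv i (fun v => √(P.metric v).det * ∑ j, (P.metric v)⁻¹ i j * pderiv j f v) u

/-- The norm of the gradient, `(gⁱʲ ∂ᵢf ∂ⱼf)^(1/2)`. -/
def gradNorm (P : Patch m M) (f : Euc m → ℝ) (u : Euc m) : ℝ :=
  √(∑ i, ∑ j, (P.metric u)⁻¹ i j * pderiv i f u * pderiv j f u)

/-- The covariant Hessian `∂ᵢ∂ⱼf - Γˡᵢⱼ ∂ₗf`; for the induced metric the Christoffel symbols are
`Γˡᵢⱼ = ⟨∂ᵢ∂ⱼX, ∂ₖX⟩ gᵏˡ`. -/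
def hessian (P : Patch m M) (f : Euc m → ℝ) (u : Euc m) : Matrix (Fin m) (Fin m) ℝ :=
  Matrix.of fun i j => pderiv i (pderiv j f) u -
    ∑ k, ∑ l, ⟪pderiv i (pderiv j P.map) u, pderiv k P.map u⟫ * (P.metric u)⁻¹ k l * pderiv l f u

/-- The norm of the covariant Hessian. -/
def hessNorm (P : Patch m M) (f : Euc m → ℝ) (u : Euc m) : ℝ :=
  √((P.metric u)⁻¹ * P.hessian f u * (P.metric u)⁻¹ * P.hessian f u).trace

end Patch

/-- The `C²` norm of a function `f` on the submanifold `M`,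
`sup (|f| + |∇f| + |∇²f|)`, as an element of `[0, ∞]`. -/
def c2Norm (m : ℕ) {n : ℕ} (M : Set (Euc n)) (f : Euc n → ℝ) : ℝ≥0∞ :=
  ⨆ (P : Patch m M) (u : Euc m) (_ : u ∈ P.dom),
    ENNReal.ofReal (|f (P.map u)| + P.gradNorm (f ∘ P.map) u + P.hessNorm (f ∘ P.map) u)

/-- `ν` is a continuous field of unit normal vectors along the submanifold `M`. -/
def IsUnitNormal (m : ℕ) {n : ℕ} (M : Set (Euc n)) (ν : Euc n → Euc n) : Prop :=
  ContinuousOn ν M ∧ (∀ y ∈ M, ‖ν y‖ = 1) ∧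
    ∀ (P : Patch m M), ∀ u ∈ P.dom, ∀ v, ⟪fderiv ℝ P.map u v, ν (P.map u)⟫ = 0

/-- Vanishing of the mean curvature of `M` in the direction of `ν`. -/
def HasZeroMeanCurvature (m : ℕ) {n : ℕ} (M : Set (Euc n)) (ν : Euc n → Euc n) : Prop :=
  ∀ (P : Patch m M), ∀ u ∈ P.dom, P.meanCurvature ν u = 0

/-- `M` is a smooth embedded minimal hypersurface of `ℝᴺ⁺¹` with unit normal field `ν`. -/
def IsMinimalHypersurface (N : ℕ) (M : Set (Euc (N + 1))) (ν : Euc (N + 1) → Euc (N + 1)) : Prop :=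
  IsEmbeddedSubmanifold N M ∧ IsUnitNormal N M ν ∧ HasZeroMeanCurvature N M ν

/-- `Γ` is a compact smooth embedded minimal hypersurface of the unit sphere `𝕊ᴺ ⊆ ℝᴺ⁺¹`; here `ν`
is its unit normal field inside the sphere (so `ν θ ⊥ θ`), which is also the unit normal
`ν_C(rθ) = ν θ` of the cone over `Γ`. -/
def IsMinimalInSphere (N : ℕ) (Γ : Set (Euc (N + 1))) (ν : Euc (N + 1) → Euc (N + 1)) : Prop :=
  IsCompact Γ ∧ Γ ⊆ Metric.sphere 0 1 ∧ IsEmbeddedSubmanifold (N - 1) Γ ∧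
    IsUnitNormal (N - 1) Γ ν ∧ (∀ θ ∈ Γ, ⟪θ, ν θ⟫ = 0) ∧ HasZeroMeanCurvature (N - 1) Γ ν

/-- The cone `{rθ : r > 0, θ ∈ Γ}`. -/
def coneOver {n : ℕ} (Γ : Set (Euc n)) : Set (Euc n) :=
  {y | ∃ r : ℝ, 0 < r ∧ ∃ θ ∈ Γ, y = r • θ}

/-- The cone over `Γ ⊆ 𝕊ᴺ` is trivial if `Γ` lies in an `N`-dimensional linear subspace. -/
def IsTrivialCone (N : ℕ) (Γ : Set (Euc (N + 1))) : Prop :=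
  ∃ W : Submodule ℝ (Euc (N + 1)), Module.finrank ℝ W = N ∧ Γ ⊆ W

/-- `D` is invariant under the group `S` of orthogonal transformations. -/
def IsGroupInvariant {n : ℕ} (S : Subgroup (Euc n ≃ₗᵢ[ℝ] Euc n)) (D : Set (Euc n)) : Prop :=
  ∀ ρ ∈ S, ρ '' D ⊆ D

/-- The normal graph `{rθ + w(r,θ) ν_C(θ) : θ ∈ Γ, r > R}` over the end of a cone. -/
def normalGraph {n : ℕ} (Γ : Set (Euc n)) (ν : Euc n → Euc n) (w : ℝ → Euc n → ℝ) (R : ℝ) :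
    Set (Euc n) :=
  {y | ∃ θ ∈ Γ, ∃ r : ℝ, R < r ∧ y = r • θ + w r θ • ν θ}

/-- `M` is asymptotic to the cone over `Γ`: outside a compact set it is the normal graph of a
bounded smooth function `w` on `(R, ∞) × Γ` with `‖w(r,·)‖_{C²(Γ)} → 0`. As the `C²` norms tend to
zero, boundedness only concerns `r` near `R`. -/
def IsAsymptoticToCone (N : ℕ) (M Γ : Set (Euc (N + 1))) (νC : Euc (N + 1) → Euc (N + 1)) : Prop :=
  ∃ R : ℝ, 0 < R ∧ ∃ w : ℝ → Euc (N + 1) → ℝ,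
    (∀ P : Patch (N - 1) Γ,
      ContDiffOn ℝ ∞ (fun p : ℝ × Euc (N - 1) => w p.1 (P.map p.2)) (Ioi R ×ˢ P.dom)) ∧
    (∃ K : ℝ, ∀ r, R < r → ∀ θ ∈ Γ, |w r θ| ≤ K) ∧
    Tendsto (fun r => c2Norm (N - 1) Γ (w r)) atTop (𝓝 0) ∧
    normalGraph Γ νC w R ⊆ M ∧ IsCompact (M \ normalGraph Γ νC w R)

section JacobiFields

variable {N : ℕ}

/-- The filter `|y| → ∞`, `y ∈ M`. -/
def atInfinity (M : Set (Euc (N + 1))) : Filter M :=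
  comap (fun y : M => ‖(y : Euc (N + 1))‖) atTop

/-- The field `b · ν` generated by the translations in the direction `b`. -/
def translationField (M : Set (Euc (N + 1))) (ν : Euc (N + 1) → Euc (N + 1))
    (b : Euc (N + 1)) : M → ℝ := fun y => ⟪b, ν y⟫

/-- The field `ζ₀(y) = y · ν(y)` generated by the dilations. -/
def dilationField (M : Set (Euc (N + 1))) (ν : Euc (N + 1) → Euc (N + 1)) : M → ℝ :=
  fun y => ⟪(y : Euc (N + 1)), ν y⟫

/-- The field `ζ_B(y) = By · ν(y)` generated by the rotations with generator `B`. -/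
def rotationField (M : Set (Euc (N + 1))) (ν : Euc (N + 1) → Euc (N + 1))
    (B : Matrix (Fin (N + 1)) (Fin (N + 1)) ℝ) : M → ℝ :=
  fun y => ⟪Matrix.toEuclideanLin B (y : Euc (N + 1)), ν y⟫

/-- The space `G(M)` of geometric Jacobi fields. -/
def geometricFields (M : Set (Euc (N + 1))) (ν : Euc (N + 1) → Euc (N + 1)) :
    Submodule ℝ (M → ℝ) :=
  Submodule.span ℝ
    ({dilationField M ν} ∪
      (range fun j : Fin (N + 1) => translationField M ν (EuclideanSpace.single j (1 : ℝ))) ∪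
      {ζ | ∃ B : Matrix (Fin (N + 1)) (Fin (N + 1)) ℝ,
        B = -B.transpose ∧ ζ = rotationField M ν B})

/-- The coordinate expression `φ ∘ X` of a function on `M` in a patch (only its values on the domain
of the patch matter). -/
def Patch.pullback {m n : ℕ} {M : Set (Euc n)} (P : Patch m M) (φ : M → ℝ) : Euc m → ℝ :=
  fun u => Function.extend ((↑) : M → Euc n) φ 0 (P.map u)

/-- `φ ∈ C²(M)`. -/
def IsC2On (M : Set (Euc (N + 1))) (φ : M → ℝ) : Prop :=
  ∀ P : Patch N M, ContDiffOn ℝ 2 (P.pullback φ) P.dom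

/-- The Jacobi equation `Δφ + |A|² φ = 0` on `M`. -/
def SolvesJacobi (M : Set (Euc (N + 1))) (ν : Euc (N + 1) → Euc (N + 1)) (φ : M → ℝ) : Prop :=
  ∀ P : Patch N M, ∀ u ∈ P.dom,
    P.laplaceBeltrami (P.pullback φ) u + P.normSqSecondForm ν u * P.pullback φ u = 0

/-- The space `D_μ(M)` of `C²` Jacobi fields `φ` such that `φ (1 + |y|)^(-μ)` is bounded. -/
def decayingFields (M : Set (Euc (N + 1))) (ν : Euc (N + 1) → Euc (N + 1)) (μ : ℝ) :
    Set (M → ℝ) :=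
  {φ | IsC2On M φ ∧ SolvesJacobi M ν φ ∧
    ∃ K : ℝ, ∀ y : M, |φ y * (1 + ‖(y : Euc (N + 1))‖) ^ (-μ)| ≤ K}

/-- The rate `inf {μ ∈ ℝ : limsup |y|^(-μ) |ζ₀(y)| = 0}`, an extended real number. -/
def dilationRate (M : Set (Euc (N + 1))) (ν : Euc (N + 1) → Euc (N + 1)) : EReal :=
  sInf ((fun μ : ℝ => (μ : EReal)) '' {μ : ℝ |
    limsup (fun y : M => ENNReal.ofReal (‖(y : Euc (N + 1))‖ ^ (-μ) * |dilationField M ν y|))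
      (atInfinity M) = 0})

/-- `ζ` has linear growth at infinity: the maximum of `|ζ|` over `M ∩ {|y| = t}` lies between two
positive multiples of `t`, for all large `t`. -/
def HasLinearGrowth (M : Set (Euc (N + 1))) (ζ : M → ℝ) : Prop :=
  ∃ c K t₀ : ℝ, 0 < c ∧ ∀ t ≥ t₀,
    (∃ y : M, ‖(y : Euc (N + 1))‖ = t ∧ c * t ≤ |ζ y|) ∧
    ∀ y : M, ‖(y : Euc (N + 1))‖ = t → |ζ y| ≤ K * t

end JacobiFields

end

/-!
Far out, `M` is the graph of `w` over the cone, with unit normal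
`ν = a (n - ∂ᵣw θ + t)` over `rθ`, where `|a| ≤ 1` and `t` is tangent to the link and of size
`O(|∇w| / r)` (`IsMinimalGraphEnd.exists_normal_eq`). The hypothesis only controls derivatives of
`w` along the link, whereas `y · ν(y) = a (w - r ∂ᵣw)` involves the radial derivative. The analytic
core is therefore that minimality forces `r ∂ᵣw → 0` uniformly
(`IsMinimalGraphEnd.tendsto_mul_radialDeriv`), by a maximum principle for first derivatives in the
manner of Bernstein. With `λ` a large constant, maximise `± (r arctan (∂ᵣw) - λ w)` minus a small
multiple of the penalty `(r / ρ)² + ρ / r`. At an interior maximum the angular first order condition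
makes the angular gradient of `∂ᵣw` a multiple of that of `w`; with this the equation of vanishing
mean curvature, in which the part of order zero in `w` cancels because the link is minimal, bounds
`r² ∂ᵣ²w / (1 + (∂ᵣw)²)` by a multiple of `ε + r |∂ᵣw|`, where `ε` bounds the `C²` norm on the link
(`IsMinimalGraphEnd.exists_pderiv_zero_zero_bound`). The radial first order condition then gives
`λ r |∂ᵣw| ≤ C (ε + r |∂ᵣw|)` up to the penalty, and `C r |∂ᵣw|` is absorbed when `λ` is large. The
arctangent makes the function grow at most linearly in `r` with no a priori bound on `∂ᵣw`, so that
the quadratic penalty keeps the maximum away from infinity; it also absorbs the factor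
`1 + (∂ᵣw)²` in the mean curvature equation.

It follows that `y · ν(y) → 0` and that `ν` converges, up to sign, to the normal of the cone
(`IsMinimalGraphEnd.exists_normal_close`). The remaining assertions are read off the cone.

* If `b ≠ 0` were tangent to the cone everywhere, the link would contain `e = b / |b|` or its
  antipode and consist of arcs of great circles through it, so that it would lie in a hyperplane
  (`exists_inner_normal_ne_zero`). Hence `b · ν` does not tend to zero.
* If `Bθ · n(θ) ≠ 0` for some `θ`, then `By · ν(y)` grows linearly along the ray of `θ`. Otherwise
  `exp (tB)` preserves the link (`exp_smul_mem_of_tangent`, by differentiating the distance to the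
  link along the flow), hence belongs to the symmetry group and preserves `M`, so that `By` is tangent to `M`.
* A geometric Jacobi field that decays at infinity has, by the two previous points, neither rotation
  nor translation part, and a multiple of `y · ν(y)` cannot decay faster than its own rate.
-/

noncomputable section

/-! ### Hypersurfaces: tangent spaces and patches -/

/-- A point of the unit sphere, an `m`-dimensional space orthogonal to it, and a unit vector
orthogonal to both span `ℝᵐ⁺²`. -/
lemma exists_frame_decomposition {m : ℕ} (L : Euc m →L[ℝ] Euc (m + 2))
    (hL : Function.Injective L) {x n : Euc (m + 2)} (hx : ‖x‖ = 1) (hn : ‖n‖ = 1)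
    (hxn : ⟪x, n⟫ = 0) (hLx : ∀ v, ⟪L v, x⟫ = 0) (hLn : ∀ v, ⟪L v, n⟫ = 0) (z : Euc (m + 2)) :
    ∃ v, z = ⟪x, z⟫ • x + L v + ⟪n, z⟫ • n := by
  have hxL : ∀ v, ⟪x, L v⟫ = 0 := fun v => by rw [real_inner_comm]; exact hLx v
  have hnL : ∀ v, ⟪n, L v⟫ = 0 := fun v => by rw [real_inner_comm]; exact hLn v
  have hnx : ⟪n, x⟫ = 0 := by rw [real_inner_comm]; exact hxn
  let T : (ℝ × Euc m × ℝ) →ₗ[ℝ] Euc (m + 2) :=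
    { toFun := fun q => q.1 • x + L q.2.1 + q.2.2 • n
      map_add' := fun q q' => by simp only [Prod.fst_add, Prod.snd_add, map_add]; module
      map_smul' := fun c q => by
        simp only [Prod.smul_fst, Prod.smul_snd, map_smul, RingHom.id_apply, smul_eq_mul]; module }
  have hTx : ∀ q, ⟪x, T q⟫ = q.1 := fun q => by
    simp [T, inner_add_right, inner_smul_right, hx, hxL, hxn]
  have hTn : ∀ q, ⟪n, T q⟫ = q.2.2 := fun q => by
    simp [T, inner_add_right, inner_smul_right, hn, hnL, hnx]
  have hinj : Function.Injective T := by
    rw [← LinearMap.ker_eq_bot, LinearMap.ker_eq_bot']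
    intro q hq
    have h1 : q.1 = 0 := by rw [← hTx, hq, inner_zero_right]
    have h2 : q.2.2 = 0 := by rw [← hTn, hq, inner_zero_right]
    have h3 : L q.2.1 = 0 := by simpa [T, h1, h2] using hq
    have h4 : q.2.1 = 0 := hL (by simpa using h3)
    exact Prod.ext h1 (Prod.ext h4 h2)
  have hsurj : Function.Surjective T := by
    refine (LinearMap.injective_iff_surjective_of_finrank_eq_finrank ?_).1 hinj
    simp; ring
  obtain ⟨q, rfl⟩ := hsurj z
  exact ⟨q.2.1, by rw [hTx, hTn]; rfl⟩

namespace Patch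

variable {m n : ℕ} {M : Set (Euc n)}

lemma contDiffAt (P : Patch m M) {u : Euc m} (hu : u ∈ P.dom) : ContDiffAt ℝ ∞ P.map u :=
  P.smooth.contDiffAt (P.isOpen_dom.mem_nhds hu)

lemma differentiableAt (P : Patch m M) {u : Euc m} (hu : u ∈ P.dom) :
    DifferentiableAt ℝ P.map u :=
  (P.contDiffAt hu).differentiableAt (by simp)

/-- The position vector of a submanifold of the unit sphere is orthogonal to its tangent spaces. -/
lemma inner_fderiv_self (P : Patch m M) (hM : M ⊆ Metric.sphere 0 1) {u : Euc m} (hu : u ∈ P.dom)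
    (v : Euc m) : ⟪fderiv ℝ P.map u v, P.map u⟫ = 0 := by
  have h1 : HasFDerivAt P.map (fderiv ℝ P.map u) u := (P.differentiableAt hu).hasFDerivAt
  have h2 := h1.inner ℝ h1
  have h3 : (fun u => ⟪P.map u, P.map u⟫) =ᶠ[𝓝 u] fun _ => (1 : ℝ) := by
    filter_upwards [P.isOpen_dom.mem_nhds hu] with z hz
    have := hM (P.mapsTo hz)
    rw [mem_sphere_zero_iff_norm] at this
    rw [real_inner_self_eq_norm_sq, this]; norm_num
  have h4 := h2.unique ((hasFDerivAt_const (1 : ℝ) u).congr_of_eventuallyEq h3)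
  have h5 := congrArg (fun A => A v) h4
  simp only [ContinuousLinearMap.comp_apply, ContinuousLinearMap.prod_apply,
    fderivInnerCLM_apply, zero_apply] at h5
  rw [real_inner_comm] at h5
  linarith

end Patch

/-- A vector normal to `M` at `y` is orthogonal to first order to the chords of `M` at `y`. -/
lemma IsEmbeddedSubmanifold.inner_sub_isLittleO {m n : ℕ} {M : Set (Euc n)}
    (hM : IsEmbeddedSubmanifold m M) {y a : Euc n} (hy : y ∈ M)
    (ha : ∀ P : Patch m M, ∀ u ∈ P.dom, P.map u = y → ∀ v, ⟪fderiv ℝ P.map u v, a⟫ = 0) :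
    (fun z => ⟪a, z - y⟫) =o[𝓝[M] y] fun z => z - y := by
  obtain ⟨P, V, Q, hV, hyV, himg, hQ, hleft⟩ := hM y hy
  obtain ⟨u, hu, huy⟩ : y ∈ P.map '' P.dom := himg ▸ ⟨hy, hyV⟩
  have hQy : Q y = u := by rw [← huy]; exact hleft hu
  have hder : HasFDerivAt P.map (fderiv ℝ P.map u) u := (P.differentiableAt hu).hasFDerivAt
  obtain ⟨K, -, hK⟩ := LinearMap.exists_antilipschitzWith (fderiv ℝ P.map u : Euc m →ₗ[ℝ] Euc n)
    (LinearMap.ker_eq_bot.2 (P.immersive u hu))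
  have hO : (fun x => x - u) =O[𝓝 u] fun x => P.map x - P.map u :=
    (hder.isTheta_sub
      (hK.isUniformInducing (fderiv ℝ P.map u).uniformContinuous).isInducing).isBigO_symm
  have ho : (fun x => ⟪a, P.map x - P.map u⟫) =o[𝓝 u] fun x => P.map x - P.map u := by
    refine Asymptotics.IsLittleO.trans_isBigO ?_ hO
    have h1 : (fun x => P.map x - P.map u - fderiv ℝ P.map u (x - u)) =o[𝓝 u] fun x => x - u :=
      hder.isLittleO
    refine Asymptotics.IsBigO.trans_isLittleO (g := fun x =>
      P.map x - P.map u - fderiv ℝ P.map u (x - u)) ?_ h1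
    refine Asymptotics.IsBigO.of_bound ‖a‖ (Eventually.of_forall fun x => ?_)
    have : ⟪a, P.map x - P.map u⟫ = ⟪a, P.map x - P.map u - fderiv ℝ P.map u (x - u)⟫ := by
      rw [inner_sub_right _ _ (fderiv ℝ P.map u (x - u)),
        real_inner_comm (fderiv ℝ P.map u (x - u)) a, ha P u hu huy, sub_zero]
    rw [this]
    exact norm_inner_le_norm _ _
  have hnhds : 𝓝[M ∩ V] y = 𝓝[M] y := nhdsWithin_inter_of_mem' (mem_nhdsWithin_of_mem_nhds
    (hV.mem_nhds hyV))
  have hT : Tendsto Q (𝓝[M] y) (𝓝 u) := by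
    rw [← hnhds, ← hQy]; exact hQ y ⟨hy, hyV⟩
  have := ho.comp_tendsto hT
  refine this.congr' ?_ ?_ <;>
  · rw [← hnhds]
    filter_upwards [self_mem_nhdsWithin] with z hz
    obtain ⟨x, hx, rfl⟩ : z ∈ P.map '' P.dom := himg ▸ hz
    simp only [Function.comp, hleft hx, huy]

/-- A continuous unit normal field of a hypersurface of the sphere is smooth along patches: near a
point `u₀` it is a positive multiple of the solution `z` of the linear system
`⟪θ, z⟫ = 0`, `z ⟂ ∂ᵢθ`, `⟪n (u₀), z⟫ = 1`. -/
lemma Patch.contDiffOn_normal {m : ℕ} {Γ : Set (Euc (m + 2))} (P : Patch m Γ)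
    {n : Euc (m + 2) → Euc (m + 2)} (hs : Γ ⊆ Metric.sphere 0 1) (hn : IsUnitNormal m Γ n)
    (hθ : ∀ θ ∈ Γ, ⟪θ, n θ⟫ = 0) : ContDiffOn ℝ ∞ (n ∘ P.map) P.dom := by
  intro u₀ hu₀
  refine ContDiffAt.contDiffWithinAt ?_
  obtain ⟨hcont, hunit, horth⟩ := hn
  set n₀ := n (P.map u₀)
  let L : Euc m → (Euc (m + 2) →L[ℝ] ℝ × Euc m × ℝ) := fun u =>
    (innerSL ℝ (P.map u)).prod
      ((ContinuousLinearMap.adjoint (fderiv ℝ P.map u)).prod (innerSL ℝ n₀))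
  have hLn : ∀ u ∈ P.dom, L u (n (P.map u)) = (0, 0, ⟪n₀, n (P.map u)⟫) := by
    intro u hu
    refine Prod.ext ?_ (Prod.ext ?_ ?_)
    · exact hθ _ (P.mapsTo hu)
    · refine ext_inner_left ℝ fun v => ?_
      change ⟪v, ContinuousLinearMap.adjoint (fderiv ℝ P.map u) (n (P.map u))⟫ = ⟪v, 0⟫
      rw [ContinuousLinearMap.adjoint_inner_right, horth P u hu, inner_zero_right]
    · rfl
  have hLsmooth : ContDiffAt ℝ ∞ L u₀ := by
    have h1 : ContDiffAt ℝ ∞ (fun u => innerSL ℝ (P.map u)) u₀ :=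
      (innerSL ℝ).contDiff.contDiffAt.comp u₀ (P.contDiffAt hu₀)
    have h2 : ContDiffAt ℝ ∞ (fun u => ContinuousLinearMap.adjoint (fderiv ℝ P.map u)) u₀ :=
      (ContinuousLinearMap.adjoint (𝕜 := ℝ) (E := Euc m)
        (F := Euc (m + 2))).toContinuousLinearEquiv.contDiff.contDiffAt.comp u₀
          ((P.contDiffAt hu₀).fderiv_right (by simp))
    have h3 : ContDiffAt ℝ ∞ (fun _ : Euc m => innerSL ℝ n₀) u₀ := contDiffAt_const
    exact ((ContinuousLinearMap.prodₗᵢ ℝ).toContinuousLinearEquiv.contDiff.contDiffAt.comp u₀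
      (h1.prodMk ((ContinuousLinearMap.prodₗᵢ ℝ).toContinuousLinearEquiv.contDiff.contDiffAt.comp u₀
        (h2.prodMk h3)) :))
  have hinj : Function.Injective (L u₀) := by
    rw [injective_iff_map_eq_zero]
    intro z hz
    have hz1 : ⟪P.map u₀, z⟫ = 0 := congrArg Prod.fst hz
    have hz2 : ContinuousLinearMap.adjoint (fderiv ℝ P.map u₀) z = 0 :=
      congrArg (fun q => q.2.1) hz
    have hz3 : ⟪n₀, z⟫ = 0 := congrArg (fun q => q.2.2) hz
    obtain ⟨v, hv⟩ := exists_frame_decomposition (fderiv ℝ P.map u₀) (P.immersive u₀ hu₀)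
      (mem_sphere_zero_iff_norm.1 (hs (P.mapsTo hu₀))) (hunit _ (P.mapsTo hu₀))
      (hθ _ (P.mapsTo hu₀)) (P.inner_fderiv_self hs hu₀) (horth P u₀ hu₀) z
    rw [hz1, hz3, zero_smul, zero_smul, zero_add, add_zero] at hv
    have : ⟪z, z⟫ = 0 := by
      nth_rw 1 [hv]
      rw [← ContinuousLinearMap.adjoint_inner_right, hz2, inner_zero_right]
    exact inner_self_eq_zero.1 this
  let e : Euc (m + 2) ≃L[ℝ] ℝ × Euc m × ℝ :=
    (LinearEquiv.ofInjectiveOfFinrankEq (L u₀ : Euc (m + 2) →ₗ[ℝ] ℝ × Euc m × ℝ) hinj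
      (by simp; ring)).toContinuousLinearEquiv
  have he : (e : Euc (m + 2) →L[ℝ] ℝ × Euc m × ℝ) = L u₀ := by ext z <;> rfl
  have hinv : ContDiffAt ℝ ∞ (fun u => (L u).inverse) u₀ := by
    have := contDiffAt_map_inverse (n := ∞) e
    rw [he] at this
    exact this.comp u₀ hLsmooth
  let z : Euc m → Euc (m + 2) := fun u => (L u).inverse (0, 0, 1)
  have hz : ContDiffAt ℝ ∞ z u₀ := hinv.clm_apply contDiffAt_const
  have hev : ∀ᶠ u in 𝓝 u₀, u ∈ P.dom ∧ n (P.map u) = ⟪n₀, n (P.map u)⟫ • z u := by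
    have h1 : ∀ᶠ u in 𝓝 u₀, L u ∈ range ((↑) : (Euc (m + 2) ≃L[ℝ] ℝ × Euc m × ℝ) →
        (Euc (m + 2) →L[ℝ] ℝ × Euc m × ℝ)) := by
      refine hLsmooth.continuousAt.eventually ?_
      rw [← he]
      exact ContinuousLinearEquiv.nhds e
    filter_upwards [h1, P.isOpen_dom.mem_nhds hu₀] with u ⟨f, hf⟩ hu
    refine ⟨hu, ?_⟩
    have h2 : (L u).inverse (L u (n (P.map u))) = n (P.map u) := by
      rw [← hf, ContinuousLinearMap.inverse_equiv]; simp
    rw [hLn u hu] at h2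
    simp only [z]
    rw [← map_smul]
    refine h2.symm.trans ?_
    simp
  have hpos : ∀ᶠ u in 𝓝 u₀, 0 < ⟪n₀, n (P.map u)⟫ := by
    have h0 : ContinuousAt (n ∘ P.map) u₀ := by
      refine ContinuousWithinAt.continuousAt ?_ (P.isOpen_dom.mem_nhds hu₀)
      exact (hcont _ (P.mapsTo hu₀)).comp (P.smooth.continuousOn u₀ hu₀) P.mapsTo
    have h1 : ContinuousAt (fun u => ⟪n₀, n (P.map u)⟫) u₀ := continuousAt_const.inner h0
    refine h1.eventually (lt_mem_nhds ?_)
    change 0 < ⟪n₀, n₀⟫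
    rw [real_inner_self_eq_norm_sq, hunit _ (P.mapsTo hu₀)]; norm_num
  have hz0 : z u₀ ≠ 0 := by
    intro h
    have := (hev.self_of_nhds).2
    rw [h, smul_zero] at this
    have h1 := hunit _ (P.mapsTo hu₀)
    rw [this, norm_zero] at h1
    norm_num at h1
  have : ContDiffAt ℝ ∞ (fun u => ‖z u‖⁻¹ • z u) u₀ :=
    ((hz.norm ℝ hz0).inv (norm_ne_zero_iff.2 hz0)).smul hz
  refine this.congr_of_eventuallyEq ?_
  filter_upwards [hev, hpos] with u ⟨hu, h1⟩ h2
  have h3 := hunit _ (P.mapsTo hu)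
  have h4 : ⟪n₀, n (P.map u)⟫ * ‖z u‖ = 1 := by
    rw [← h3, ← Real.norm_of_nonneg h2.le, ← norm_smul, ← h1]
  change n (P.map u) = _
  nth_rw 1 [h1]
  congr 1
  exact eq_inv_of_mul_eq_one_left h4

/-- Reparametrization of a patch by an affine isomorphism. -/
def Patch.reparam {m n : ℕ} {M : Set (Euc n)} (P : Patch m M) (u₀ : Euc m)
    (A : Euc m ≃L[ℝ] Euc m) : Patch m M where
  dom := (fun v => u₀ + A v) ⁻¹' P.dom
  map := fun v => P.map (u₀ + A v)
  isOpen_dom := P.isOpen_dom.preimage (by fun_prop)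
  smooth := P.smooth.comp (by fun_prop) fun _ hv => hv
  immersive := fun v hv => by
    have h1 : HasFDerivAt (fun v => u₀ + A v) (A : Euc m →L[ℝ] Euc m) v :=
      A.hasFDerivAt.const_add u₀
    have h2 := (P.differentiableAt hv).hasFDerivAt.comp v h1
    have h3 : fderiv ℝ (fun v => P.map (u₀ + A v)) v = _ := h2.fderiv
    rw [h3]
    exact (P.immersive _ hv).comp A.injective
  mapsTo := fun _ hv => P.mapsTo hv

section Affine

variable {m : ℕ} {F : Type*} [NormedAddCommGroup F] [NormedSpace ℝ F]

lemma pderiv_comp_affine {f : Euc m → F} {u₀ v : Euc m} (A : Euc m ≃L[ℝ] Euc m)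
    (hf : DifferentiableAt ℝ f (u₀ + A v)) (i : Fin m) :
    pderiv i (fun v => f (u₀ + A v)) v
      = fderiv ℝ f (u₀ + A v) (A (EuclideanSpace.single i (1 : ℝ))) := by
  have h1 : HasFDerivAt (fun v => u₀ + A v) (A : Euc m →L[ℝ] Euc m) v :=
    A.hasFDerivAt.const_add u₀
  have h2 : fderiv ℝ (fun v => f (u₀ + A v)) v = _ := (hf.hasFDerivAt.comp v h1).fderiv
  rw [pderiv, h2]; rfl

lemma pderiv_pderiv_comp_affine {f : Euc m → F} {u₀ : Euc m} (A : Euc m ≃L[ℝ] Euc m)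
    (hf : ContDiffAt ℝ ∞ f u₀) (i j : Fin m) :
    pderiv i (pderiv j fun v => f (u₀ + A v)) 0
      = fderiv ℝ (fderiv ℝ f) u₀ (A (EuclideanSpace.single i (1 : ℝ)))
          (A (EuclideanSpace.single j (1 : ℝ))) := by
  have hev : ∀ᶠ v in 𝓝 (0 : Euc m), DifferentiableAt ℝ f (u₀ + A v) := by
    have h1 : ∀ᶠ u in 𝓝 u₀, DifferentiableAt ℝ f u := by
      filter_upwards [(hf.of_le (m := 1) (by norm_cast)).eventually (by simp)] with u hu
      exact hu.differentiableAt (by simp)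
    have h2 : Tendsto (fun v => u₀ + A v) (𝓝 0) (𝓝 u₀) := by
      have : Continuous fun v => u₀ + A v := by fun_prop
      simpa using this.tendsto 0
    exact h2.eventually h1
  have h3 : (pderiv j fun v => f (u₀ + A v)) =ᶠ[𝓝 0]
      fun v => fderiv ℝ f (u₀ + A v) (A (EuclideanSpace.single j (1 : ℝ))) := by
    filter_upwards [hev] with v hv using pderiv_comp_affine A hv j
  have h4 : DifferentiableAt ℝ (fderiv ℝ f) (u₀ + A 0) := by
    rw [map_zero, add_zero]
    exact (hf.fderiv_right (m := 1) (by norm_cast)).differentiableAt (by simp)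
  have h5 : DifferentiableAt ℝ (fun u => fderiv ℝ f u (A (EuclideanSpace.single j (1 : ℝ))))
      (u₀ + A 0) := h4.clm_apply (differentiableAt_const _)
  have h6 : pderiv i (pderiv j fun v => f (u₀ + A v)) 0 =
      pderiv i (fun v => fderiv ℝ f (u₀ + A v) (A (EuclideanSpace.single j (1 : ℝ)))) 0 := by
    rw [pderiv, h3.fderiv_eq, pderiv]
  rw [h6,
    pderiv_comp_affine (f := fun u => fderiv ℝ f u (A (EuclideanSpace.single j (1 : ℝ)))) A h5]
  rw [fderiv_clm_apply h4 (differentiableAt_const _)]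
  simp

end Affine

/-- An injective linear map becomes an isometric embedding after a change of coordinates. -/
lemma exists_isometric_reparam {m k : ℕ} (L : Euc m →L[ℝ] Euc k) (hL : Function.Injective L) :
    ∃ A : Euc m ≃L[ℝ] Euc m, ∀ v, ‖L (A v)‖ = ‖v‖ := by
  let E := LinearEquiv.ofInjective (L : Euc m →ₗ[ℝ] Euc k) hL
  have hr : Module.finrank ℝ (LinearMap.range (L : Euc m →ₗ[ℝ] Euc k)) = m := by
    rw [← E.finrank_eq]; simp
  let b := (stdOrthonormalBasis ℝ (LinearMap.range (L : Euc m →ₗ[ℝ] Euc k))).reindex (finCongr hr)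
  refine ⟨(b.repr.symm.toLinearEquiv.trans E.symm).toContinuousLinearEquiv, fun v => ?_⟩
  have h1 : L (E.symm (b.repr.symm v)) = (b.repr.symm v : Euc k) :=
    congrArg Subtype.val (E.apply_symm_apply (b.repr.symm v))
  change ‖L (E.symm (b.repr.symm v))‖ = ‖v‖
  rw [h1]
  exact b.repr.symm.norm_map v

lemma ContinuousAt.eventually_norm_lt {X G : Type*} [TopologicalSpace X] [NormedAddCommGroup G]
    {g : X → G} {x : X} (hg : ContinuousAt g x) {b : ℝ} (hb : ‖g x‖ < b) : ∀ᶠ y in 𝓝 x, ‖g y‖ < b :=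
  hg.norm.eventually (gt_mem_nhds hb)

/-- Around `θ` there are coordinates, centred at `0`, in which the metric at `0` is the identity and
the second derivatives of the embedding and the first two derivatives of the normal are bounded by
`D` at `0`. -/
def HasAdaptedPatch {m : ℕ} (Γ : Set (Euc (m + 2))) (n : Euc (m + 2) → Euc (m + 2)) (D : ℝ)
    (θ : Euc (m + 2)) : Prop :=
  ∃ P : Patch m Γ, 0 ∈ P.dom ∧ P.map 0 = θ ∧
    (∀ i j, ⟪pderiv i P.map 0, pderiv j P.map 0⟫ = (1 : Matrix (Fin m) (Fin m) ℝ) i j) ∧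
    (∀ i j, ‖pderiv i (pderiv j P.map) 0‖ ≤ D) ∧
    (∀ i, ‖pderiv i (n ∘ P.map) 0‖ ≤ D) ∧ ∀ i j, ‖pderiv i (pderiv j (n ∘ P.map)) 0‖ ≤ D

lemma HasAdaptedPatch.mono {m : ℕ} {Γ : Set (Euc (m + 2))} {n : Euc (m + 2) → Euc (m + 2)}
    {D D' : ℝ} (hD : D ≤ D') {θ : Euc (m + 2)} (h : HasAdaptedPatch Γ n D θ) :
    HasAdaptedPatch Γ n D' θ := by
  obtain ⟨P, h0, hθ, hg, h1, h2, h3⟩ := h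
  exact ⟨P, h0, hθ, hg, fun i j => (h1 i j).trans hD, fun i => (h2 i).trans hD,
    fun i j => (h3 i j).trans hD⟩

set_option maxHeartbeats 2000000 in
/-- The bounds in adapted coordinates are locally uniform. -/
lemma eventually_hasAdaptedPatch {m : ℕ} {Γ : Set (Euc (m + 2))} {n : Euc (m + 2) → Euc (m + 2)}
    (hs : Γ ⊆ Metric.sphere 0 1) (hemb : IsEmbeddedSubmanifold m Γ) (hn : IsUnitNormal m Γ n)
    (hθn : ∀ θ ∈ Γ, ⟪θ, n θ⟫ = 0) {θ₀ : Euc (m + 2)} (hθ₀ : θ₀ ∈ Γ) :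
    ∃ D : ℝ, ∀ᶠ θ in 𝓝[Γ] θ₀, HasAdaptedPatch Γ n D θ := by
  obtain ⟨P, V, Q, hV, hyV, himg, hQ, hleft⟩ := hemb θ₀ hθ₀
  obtain ⟨u₀, hu₀, huθ⟩ : θ₀ ∈ P.map '' P.dom := himg ▸ ⟨hθ₀, hyV⟩
  have hQθ : Q θ₀ = u₀ := by rw [← huθ]; exact hleft hu₀
  have hsm1 : ∀ u ∈ P.dom, ContDiffAt ℝ ∞ P.map u := fun u hu => P.contDiffAt hu
  have hsm2 : ∀ u ∈ P.dom, ContDiffAt ℝ ∞ (n ∘ P.map) u := fun u hu =>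
    (P.contDiffOn_normal hs hn hθn).contDiffAt (P.isOpen_dom.mem_nhds hu)
  have hd : ∀ f : Euc m → Euc (m + 2), ContDiffAt ℝ ∞ f u₀ →
      ContDiffAt ℝ ∞ (fderiv ℝ f) u₀ ∧ ContDiffAt ℝ ∞ (fderiv ℝ (fderiv ℝ f)) u₀ := fun f hf =>
    ⟨hf.fderiv_right (by simp), (hf.fderiv_right (m := ∞) (by simp)).fderiv_right (by simp)⟩
  have hc0 : ContinuousAt (fderiv ℝ P.map) u₀ := (hd _ (hsm1 u₀ hu₀)).1.continuousAt
  have hc1 : ContinuousAt (fderiv ℝ (fderiv ℝ P.map)) u₀ := (hd _ (hsm1 u₀ hu₀)).2.continuousAt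
  have hc2 : ContinuousAt (fderiv ℝ (n ∘ P.map)) u₀ := (hd _ (hsm2 u₀ hu₀)).1.continuousAt
  have hc3 : ContinuousAt (fderiv ℝ (fderiv ℝ (n ∘ P.map))) u₀ :=
    (hd _ (hsm2 u₀ hu₀)).2.continuousAt
  obtain ⟨K, hK0, hK⟩ := LinearMap.exists_antilipschitzWith
    (fderiv ℝ P.map u₀ : Euc m →ₗ[ℝ] Euc (m + 2)) (LinearMap.ker_eq_bot.2 (P.immersive u₀ hu₀))
  have hK' : ∀ v, ‖v‖ ≤ K * ‖fderiv ℝ P.map u₀ v‖ := fun v => by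
    have := hK.le_mul_dist v 0
    simpa using this
  have hKpos : (0 : ℝ) < K := hK0
  set b : ℝ := ‖fderiv ℝ (fderiv ℝ P.map) u₀‖ + ‖fderiv ℝ (n ∘ P.map) u₀‖ +
    ‖fderiv ℝ (fderiv ℝ (n ∘ P.map)) u₀‖ + 1 with hb
  have hnn1 := norm_nonneg (fderiv ℝ (fderiv ℝ P.map) u₀)
  have hnn2 := norm_nonneg (fderiv ℝ (n ∘ P.map) u₀)
  have hnn3 := norm_nonneg (fderiv ℝ (fderiv ℝ (n ∘ P.map)) u₀)
  have hb0 : 0 ≤ b := by positivity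
  have hev : ∀ᶠ u in 𝓝 u₀, u ∈ P.dom ∧ ‖fderiv ℝ P.map u - fderiv ℝ P.map u₀‖ < 1 / (2 * K) ∧
      ‖fderiv ℝ (fderiv ℝ P.map) u‖ < b ∧ ‖fderiv ℝ (n ∘ P.map) u‖ < b ∧
      ‖fderiv ℝ (fderiv ℝ (n ∘ P.map)) u‖ < b := by
    have h0 : ∀ᶠ u in 𝓝 u₀, ‖fderiv ℝ P.map u - fderiv ℝ P.map u₀‖ < 1 / (2 * K) := by
      refine (hc0.sub continuousAt_const).eventually_norm_lt ?_
      rw [Pi.sub_apply, sub_self, norm_zero]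
      positivity
    have hb1 : ‖fderiv ℝ (fderiv ℝ P.map) u₀‖ < b := by linarith
    have hv1 := ContinuousAt.eventually_norm_lt (G := Euc m →L[ℝ] Euc m →L[ℝ] Euc (m + 2))
      (g := fderiv ℝ (fderiv ℝ P.map)) hc1 hb1
    have hb2 : ‖fderiv ℝ (n ∘ P.map) u₀‖ < b := by linarith
    have hv2 := ContinuousAt.eventually_norm_lt (G := Euc m →L[ℝ] Euc (m + 2))
      (g := fderiv ℝ (n ∘ P.map)) hc2 hb2
    have hb3 : ‖fderiv ℝ (fderiv ℝ (n ∘ P.map)) u₀‖ < b := by linarith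
    have hv3 := ContinuousAt.eventually_norm_lt (G := Euc m →L[ℝ] Euc m →L[ℝ] Euc (m + 2))
      (g := fderiv ℝ (fderiv ℝ (n ∘ P.map))) hc3 hb3
    filter_upwards [P.isOpen_dom.mem_nhds hu₀, h0, hv1, hv2, hv3] with u h1 h2 h3 h4 h5
    exact ⟨h1, h2, h3, h4, h5⟩
  have hnhds : 𝓝[Γ ∩ V] θ₀ = 𝓝[Γ] θ₀ := nhdsWithin_inter_of_mem' (mem_nhdsWithin_of_mem_nhds
    (hV.mem_nhds hyV))
  have hT : Tendsto Q (𝓝[Γ ∩ V] θ₀) (𝓝 u₀) := by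
    rw [← hQθ]; exact hQ θ₀ ⟨hθ₀, hyV⟩
  set c : ℝ := 2 * K
  refine ⟨b * c * c + b * c, ?_⟩
  rw [← hnhds]
  filter_upwards [hT.eventually hev, self_mem_nhdsWithin] with θ ⟨hu, hL, hb1, hb2, hb3⟩ hθ
  set u := Q θ
  have hPu : P.map u = θ := by
    obtain ⟨x, hx, rfl⟩ : θ ∈ P.map '' P.dom := himg ▸ hθ
    simp only [u, hleft hx]
  obtain ⟨A, hA⟩ := exists_isometric_reparam (fderiv ℝ P.map u) (P.immersive u hu)
  -- `c` bounds the inverse of the differential near `u₀`, hence the change of coordinates `A`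
  have hco : ∀ v, ‖v‖ ≤ c * ‖fderiv ℝ P.map u v‖ := fun v => by
    have h1 := hK' v
    have h2 : ‖fderiv ℝ P.map u₀ v‖ ≤ ‖fderiv ℝ P.map u v‖ + 1 / (2 * K) * ‖v‖ := by
      have h3 := (fderiv ℝ P.map u - fderiv ℝ P.map u₀).le_of_opNorm_le hL.le v
      have h4 : fderiv ℝ P.map u₀ v = fderiv ℝ P.map u v -
        (fderiv ℝ P.map u - fderiv ℝ P.map u₀) v := by simp
      rw [h4]
      exact (norm_sub_le _ _).trans (by gcongr)
    have h5 : ‖v‖ ≤ K * (‖fderiv ℝ P.map u v‖ + 1 / (2 * K) * ‖v‖) :=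
      h1.trans (mul_le_mul_of_nonneg_left h2 hKpos.le)
    have h6 : (K : ℝ) * (‖fderiv ℝ P.map u v‖ + 1 / (2 * K) * ‖v‖)
      = K * ‖fderiv ℝ P.map u v‖ + ‖v‖ / 2 := by field_simp
    simp only [c]; linarith
  have hAe : ∀ i, ‖A (EuclideanSpace.single i (1 : ℝ))‖ ≤ c := fun i => by
    have := hco (A (EuclideanSpace.single i (1 : ℝ)))
    rw [hA] at this
    simpa using this
  have hc0' : 0 ≤ c := by positivity
  have hfst : ∀ f : Euc m → Euc (m + 2), DifferentiableAt ℝ f u → ∀ i,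
      pderiv i (fun v => f (u + A v)) 0 = fderiv ℝ f u (A (EuclideanSpace.single i (1 : ℝ))) :=
    fun f hf i => by
      rw [pderiv_comp_affine A (by simpa using hf), map_zero, add_zero]
  have hsnd : ∀ f : Euc m → Euc (m + 2), ContDiffAt ℝ ∞ f u → ‖fderiv ℝ (fderiv ℝ f) u‖ ≤ b →
      ∀ i j, ‖pderiv i (pderiv j (fun v => f (u + A v))) 0‖ ≤ b * c * c := fun f hf hfb i j => by
    rw [pderiv_pderiv_comp_affine A hf]
    refine ((fderiv ℝ (fderiv ℝ f) u).le_opNorm₂ _ _).trans ?_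
    gcongr <;> exact hAe _
  have hbc : 0 ≤ b * c := by positivity
  have hbcc : 0 ≤ b * c * c := by positivity
  refine ⟨P.reparam u A, ?_, ?_, fun i j => ?_, fun i j => ?_, fun i => ?_, fun i j => ?_⟩
  · simpa [Patch.reparam] using hu
  · simpa [Patch.reparam] using hPu
  · have h1 : ∀ i, pderiv i (P.reparam u A).map 0 = _ :=
      hfst _ ((hsm1 u hu).differentiableAt (by simp))
    rw [h1, h1]
    let I : Euc m →ₗᵢ[ℝ] Euc (m + 2) :=
      ⟨((fderiv ℝ P.map u).comp (A : Euc m →L[ℝ] Euc m) : Euc m →ₗ[ℝ] Euc (m + 2)), hA⟩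
    have h2 := I.inner_map_map (EuclideanSpace.single i (1 : ℝ)) (EuclideanSpace.single j (1 : ℝ))
    refine h2.trans ?_
    simp [Matrix.one_apply, EuclideanSpace.inner_single_left]
  · exact (hsnd _ (hsm1 u hu) hb1.le i j).trans (by linarith)
  · have h1 : pderiv i (n ∘ (P.reparam u A).map) 0 = _ :=
      hfst (n ∘ P.map) ((hsm2 u hu).differentiableAt (by simp)) i
    rw [h1]
    refine ((fderiv ℝ (n ∘ P.map) u).le_opNorm _).trans ?_
    refine (mul_le_mul hb2.le (hAe i) (norm_nonneg _) hb0).trans (by linarith)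
  · exact (hsnd (n ∘ P.map) (hsm2 u hu) hb3.le i j).trans (by linarith)

/-- The bounds in adapted coordinates are uniform over a compact hypersurface of the sphere. -/
lemma exists_hasAdaptedPatch {m : ℕ} {Γ : Set (Euc (m + 2))} {n : Euc (m + 2) → Euc (m + 2)}
    (hc : IsCompact Γ) (hs : Γ ⊆ Metric.sphere 0 1) (hemb : IsEmbeddedSubmanifold m Γ)
    (hn : IsUnitNormal m Γ n) (hθn : ∀ θ ∈ Γ, ⟪θ, n θ⟫ = 0) :
    ∃ D : ℝ, 1 ≤ D ∧ ∀ θ ∈ Γ, HasAdaptedPatch Γ n D θ := by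
  suffices h : ∃ D : ℝ, ∀ θ ∈ Γ, HasAdaptedPatch Γ n D θ by
    obtain ⟨D, hD⟩ := h
    exact ⟨max D 1, le_max_right _ _, fun θ hθ => (hD θ hθ).mono (le_max_left _ _)⟩
  refine hc.induction_on (p := fun s => ∃ D : ℝ, ∀ θ ∈ s, HasAdaptedPatch Γ n D θ) ?_ ?_ ?_ ?_
  · exact ⟨0, fun θ hθ => hθ.elim⟩
  · rintro s t hst ⟨D, hD⟩
    exact ⟨D, fun θ hθ => hD θ (hst hθ)⟩
  · rintro s t ⟨D, hD⟩ ⟨D', hD'⟩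
    refine ⟨max D D', fun θ hθ => ?_⟩
    rcases hθ with hθ | hθ
    · exact (hD θ hθ).mono (le_max_left _ _)
    · exact (hD' θ hθ).mono (le_max_right _ _)
  · intro θ₀ hθ₀
    obtain ⟨D, hD⟩ := eventually_hasAdaptedPatch hs hemb hn hθn hθ₀
    exact ⟨_, hD, D, fun θ hθ => hθ⟩

/-! ### Cones invariant under translations or rotations -/

section Sphere

variable {m : ℕ} {Γ : Set (Euc (m + 2))} {n : Euc (m + 2) → Euc (m + 2)}

/-- At a maximum over `Γ`, the derivative vanishes in all directions orthogonal to `θ` and to the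
normal `n θ`. -/
lemma fderiv_eq_zero_of_isMaxOn (hs : Γ ⊆ Metric.sphere 0 1) (hemb : IsEmbeddedSubmanifold m Γ)
    (hn : IsUnitNormal m Γ n) (hθn : ∀ θ ∈ Γ, ⟪θ, n θ⟫ = 0) {f : Euc (m + 2) → ℝ}
    {f' : Euc (m + 2) →L[ℝ] ℝ} {θ τ : Euc (m + 2)} (hθ : θ ∈ Γ) (hf : HasFDerivAt f f' θ)
    (hmax : IsMaxOn f Γ θ) (h1 : ⟪θ, τ⟫ = 0) (h2 : ⟪n θ, τ⟫ = 0) : f' τ = 0 := by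
  obtain ⟨P, V, Q, hV, hyV, himg, hQ, hleft⟩ := hemb θ hθ
  obtain ⟨u, hu, rfl⟩ : θ ∈ P.map '' P.dom := himg ▸ ⟨hθ, hyV⟩
  obtain ⟨v, hv⟩ := exists_frame_decomposition (fderiv ℝ P.map u) (P.immersive u hu)
    (mem_sphere_zero_iff_norm.1 (hs (P.mapsTo hu))) (hn.2.1 _ (P.mapsTo hu))
    (hθn _ (P.mapsTo hu)) (P.inner_fderiv_self hs hu) (hn.2.2 P u hu) τ
  rw [h1, h2, zero_smul, zero_smul, zero_add, add_zero] at hv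
  have h3 : HasFDerivAt (f ∘ P.map) (f'.comp (fderiv ℝ P.map u)) u :=
    hf.comp u (P.differentiableAt hu).hasFDerivAt
  have h4 : IsLocalMax (f ∘ P.map) u := by
    filter_upwards [P.isOpen_dom.mem_nhds hu] with z hz using hmax (P.mapsTo hz)
  have h5 := h4.hasFDerivAt_eq_zero h3
  rw [hv]
  exact congrArg (fun A => A v) h5

/-- Only the trivial cone is invariant under a translation. If `b ≠ 0` is tangent to the cone along
`Γ`, then `e = ± b / |b|` lies on `Γ`, and `Γ` is a union of arcs of great circles issuing from `e`,
whose initial directions are tangent to `Γ` at `e`; so `Γ` lies in the hyperplane normal to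
`a = n e`. To see this without integrating the field `b`, note that
`⟪a, θ⟫² (1 + ⟪e, θ⟫) / (1 - ⟪e, θ⟫)` is strictly monotone along the arcs where it is positive, and
tends to zero at `e`; so its maximum over `Γ` is zero. -/
lemma exists_inner_normal_ne_zero (hc : IsCompact Γ) (hs : Γ ⊆ Metric.sphere 0 1)
    (hemb : IsEmbeddedSubmanifold m Γ) (hn : IsUnitNormal m Γ n) (hθn : ∀ θ ∈ Γ, ⟪θ, n θ⟫ = 0)
    (hne : Γ.Nonempty) (htriv : ¬ IsTrivialCone (m + 1) Γ) {b : Euc (m + 2)} (hb : b ≠ 0) :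
    ∃ θ ∈ Γ, ⟪b, n θ⟫ ≠ 0 := by
  by_contra! hbn
  have hnorm : ∀ θ ∈ Γ, ‖θ‖ = 1 := fun θ hθ => mem_sphere_zero_iff_norm.1 (hs hθ)
  have hself : ∀ θ ∈ Γ, ⟪θ, θ⟫ = 1 := fun θ hθ => by
    rw [real_inner_self_eq_norm_sq, hnorm θ hθ]; norm_num
  have hnθ : ∀ θ ∈ Γ, ⟪n θ, θ⟫ = 0 := fun θ hθ => by rw [real_inner_comm]; exact hθn θ hθ
  -- The critical points of `⟪b, ·⟫` are parallel to `b`.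
  obtain ⟨e, he, hbe⟩ : ∃ e ∈ Γ, b = ⟪b, e⟫ • e := by
    obtain ⟨e, he, hmax⟩ := hc.exists_isMaxOn hne
      (f := fun θ => ⟪b, θ⟫) (continuous_const.inner continuous_id).continuousOn
    refine ⟨e, he, ?_⟩
    have h1 : ⟪e, b - ⟪b, e⟫ • e⟫ = 0 := by
      rw [inner_sub_right, inner_smul_right, hself e he, real_inner_comm]; ring
    have h2 : ⟪n e, b - ⟪b, e⟫ • e⟫ = 0 := by
      rw [inner_sub_right, inner_smul_right, real_inner_comm, hbn e he, hnθ e he]; ring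
    have h3 : ⟪b, b - ⟪b, e⟫ • e⟫ = 0 :=
      fderiv_eq_zero_of_isMaxOn hs hemb hn hθn he (f' := innerSL ℝ b)
        (innerSL ℝ b).hasFDerivAt hmax h1 h2
    have h4 : ⟪b - ⟪b, e⟫ • e, b - ⟪b, e⟫ • e⟫ = 0 := by
      rw [inner_sub_left, h3, inner_smul_left, h1]; simp
    exact sub_eq_zero.1 (inner_self_eq_zero.1 h4)
  have hen : ∀ θ ∈ Γ, ⟪e, n θ⟫ = 0 := fun θ hθ => by
    have h1 := hbn θ hθ
    rw [hbe, inner_smul_left] at h1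
    refine (mul_eq_zero.1 h1).resolve_left fun h => hb ?_
    rw [hbe, show ⟪b, e⟫ = 0 from h, zero_smul]
  set a := n e with ha
  have hae : ⟪a, e⟫ = 0 := by rw [real_inner_comm]; exact hθn e he
  have hlt : ∀ θ ∈ Γ, θ ≠ e → ⟪e, θ⟫ < 1 := fun θ hθ h => by
    refine lt_of_le_of_ne ?_ fun h' => h ?_
    · have := real_inner_le_norm e θ
      rwa [hnorm e he, hnorm θ hθ, one_mul] at this
    · exact ((inner_eq_one_iff_of_norm_eq_one (hnorm e he) (hnorm θ hθ)).1 h').symm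
  have hge : ∀ θ ∈ Γ, -1 ≤ ⟪e, θ⟫ := fun θ hθ => by
    have := neg_le_of_abs_le (abs_real_inner_le_norm e θ)
    rwa [hnorm e he, hnorm θ hθ, one_mul] at this
  let G : Euc (m + 2) → ℝ := fun θ => ⟪a, θ⟫ ^ 2 * (1 + ⟪e, θ⟫) / (1 - ⟪e, θ⟫)
  have hGe : G e = 0 := by simp [G, hae]
  have hcont : ContinuousOn G Γ := by
    intro θ hθ
    by_cases hθe : θ = e
    · rw [hθe]
      have hlo : (fun z => ⟪a, z - e⟫) =o[𝓝[Γ] e] fun z => z - e :=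
        hemb.inner_sub_isLittleO he fun P u hu hPu v => by
          rw [ha, ← hPu]; exact hn.2.2 P u hu v
      have hT : Tendsto G (𝓝[Γ] e) (𝓝 0) := by
        rw [Metric.tendsto_nhds]
        intro ε hε
        have h1 := hlo.def (show 0 < √(ε / 8) by positivity)
        filter_upwards [h1, self_mem_nhdsWithin] with z hz hzΓ
        rw [Real.dist_eq, sub_zero]
        by_cases hze : z = e
        · rw [hze, hGe]; simpa using hε
        have h2 := hlt z hzΓ hze
        have h2' := hge z hzΓ
        rw [inner_sub_right, hae, sub_zero, Real.norm_eq_abs] at hz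
        have h3 : ⟪a, z⟫ ^ 2 ≤ ε / 8 * (2 * (1 - ⟪e, z⟫)) := by
          have h4 : ‖z - e‖ ^ 2 = 2 * (1 - ⟪e, z⟫) := by
            rw [norm_sub_sq_real, hnorm z hzΓ, hnorm e he, real_inner_comm]; ring
          have h5 := pow_le_pow_left₀ (abs_nonneg _) hz 2
          rwa [sq_abs, mul_pow, Real.sq_sqrt (by positivity), h4] at h5
        have h6 : 0 < 1 - ⟪e, z⟫ := by linarith
        rw [abs_of_nonneg (by
          refine div_nonneg (mul_nonneg (sq_nonneg _) (by linarith)) h6.le), div_lt_iff₀ h6]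
        nlinarith
      have := hT
      rw [← hGe] at this
      exact this
    · refine ContinuousAt.continuousWithinAt ?_
      refine ContinuousAt.div ?_ ?_ ?_
      · fun_prop
      · fun_prop
      · have := hlt θ hθ hθe; exact (by linarith : (0 : ℝ) < 1 - ⟪e, θ⟫).ne'
  obtain ⟨θ₁, hθ₁, hmax⟩ := hc.exists_isMaxOn hne hcont
  -- At a positive maximum the derivative in the direction of `e - ⟪e, θ⟫ θ` would be positive.
  have hle : G θ₁ ≤ 0 := by
    by_contra! hpos
    have hne1 : θ₁ ≠ e := fun h => by rw [h, hGe] at hpos; exact lt_irrefl _ hpos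
    have h1 := hlt θ₁ hθ₁ hne1
    have h2 : HasFDerivAt (fun θ => ⟪a, θ⟫) (innerSL ℝ a) θ₁ := (innerSL ℝ a).hasFDerivAt
    have h3 : HasFDerivAt (fun θ => ⟪e, θ⟫) (innerSL ℝ e) θ₁ := (innerSL ℝ e).hasFDerivAt
    have hc1 : (1 : ℝ) - ⟪e, θ₁⟫ ≠ 0 := by linarith [h1] |> fun h : (0 : ℝ) < 1 - ⟪e, θ₁⟫ => h.ne'
    have h4 := ((h2.pow 2).mul (h3.const_add 1)).mul (((hasDerivAt_inv hc1).comp_hasFDerivAt θ₁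
      (h3.const_sub 1)))
    have hG : G = _ := funext fun θ => div_eq_mul_inv (⟪a, θ⟫ ^ 2 * (1 + ⟪e, θ⟫)) (1 - ⟪e, θ⟫)
    rw [hG] at hmax hpos
    have h5 := fderiv_eq_zero_of_isMaxOn hs hemb hn hθn hθ₁ (τ := e - ⟪e, θ₁⟫ • θ₁) h4 hmax
      (by rw [inner_sub_right, inner_smul_right, hself θ₁ hθ₁, real_inner_comm]; ring)
      (by rw [inner_sub_right, inner_smul_right, real_inner_comm, hen θ₁ hθ₁, hnθ θ₁ hθ₁]; ring)
    have h6 : ⟪e, e - ⟪e, θ₁⟫ • θ₁⟫ = 1 - ⟪e, θ₁⟫ ^ 2 := by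
      rw [inner_sub_right, inner_smul_right, hself e he]; ring
    have h7 : ⟪a, e - ⟪e, θ₁⟫ • θ₁⟫ = - (⟪e, θ₁⟫ * ⟪a, θ₁⟫) := by
      rw [inner_sub_right, inner_smul_right, hae]; ring
    simp only [add_apply, smul_apply,
      neg_apply, innerSL_apply_apply, h6, h7, smul_eq_mul, nsmul_eq_mul] at h5
    have hge1 := hge θ₁ hθ₁
    have hx : 0 < ⟪a, θ₁⟫ ^ 2 * (1 + ⟪e, θ₁⟫) :=
      pos_of_mul_pos_left hpos (inv_nonneg.2 (by linarith))
    simp only [Pi.mul_apply, Function.comp_apply] at h5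
    generalize ⟪a, θ₁⟫ = x at *
    generalize ⟪e, θ₁⟫ = c at *
    have h8 : x ^ 2 * (1 + c) * (-((1 - c) ^ 2)⁻¹ * -(1 - c ^ 2)) +
        (1 - c)⁻¹ * (x ^ 2 * (1 - c ^ 2) + (1 + c) * (((2 : ℕ) : ℝ) * x ^ (2 - 1) * -(c * x)))
        = 2 * (x ^ 2 * (1 + c)) := by
      push_cast
      field_simp
      ring
    rw [h8] at h5
    linarith
  have hzero : ∀ θ ∈ Γ, ⟪a, θ⟫ = 0 := by
    intro θ hθ
    by_cases hθe : θ = e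
    · rw [hθe, hae]
    by_cases hθe' : ⟪e, θ⟫ = -1
    · have : θ = -e := by
        have h1 : ⟪-e, θ⟫ = 1 := by rw [inner_neg_left, hθe', neg_neg]
        exact ((inner_eq_one_iff_of_norm_eq_one (by rw [norm_neg, hnorm e he]) (hnorm θ hθ)).1
          h1).symm
      rw [this, inner_neg_right, hae, neg_zero]
    have h1 := hlt θ hθ hθe
    have h2 : -1 < ⟪e, θ⟫ := lt_of_le_of_ne (hge θ hθ) (Ne.symm hθe')
    have h3 : G θ ≤ 0 := (hmax hθ).trans hle
    by_contra h
    have h4 : 0 < G θ := by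
      refine div_pos (mul_pos (by positivity) (by linarith)) (by linarith)
    linarith
  have ha0 : a ≠ 0 := fun h => by
    have := hn.2.1 e he
    rw [← ha, h, norm_zero] at this
    norm_num at this
  have : Fact (Module.finrank ℝ (Euc (m + 2)) = (m + 1) + 1) := ⟨by simp⟩
  exact htriv ⟨(ℝ ∙ a)ᗮ, Submodule.finrank_orthogonal_span_singleton ha0, fun θ hθ =>
    Submodule.mem_orthogonal_singleton_iff_inner_right.2 (hzero θ hθ)⟩

/-- A one-parameter group of rotations whose generator is tangent to `Γ` preserves `Γ`: at a nearest
point `x ∈ Γ` of `y` the vector `y - x` is normal to `Γ`, so that `⟪y - x, A y⟫ = ⟪y - x, A x⟫ = 0`,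
and the squared distance to `Γ` does not increase along the orbits. -/
lemma exp_smul_mem_of_tangent (hc : IsCompact Γ) (hs : Γ ⊆ Metric.sphere 0 1)
    (hemb : IsEmbeddedSubmanifold m Γ) (hn : IsUnitNormal m Γ n) (hθn : ∀ θ ∈ Γ, ⟪θ, n θ⟫ = 0)
    {A : Euc (m + 2) →L[ℝ] Euc (m + 2)} (hA : ∀ x, ⟪A x, x⟫ = 0)
    (hAn : ∀ θ ∈ Γ, ⟪A θ, n θ⟫ = 0) {θ : Euc (m + 2)} (hθ : θ ∈ Γ) {t : ℝ} (ht : 0 ≤ t) :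
    NormedSpace.exp (t • A) θ ∈ Γ := by
  have hne : Γ.Nonempty := ⟨θ, hθ⟩
  have hder : ∀ t : ℝ, HasDerivAt (fun s : ℝ => NormedSpace.exp (s • A) θ)
      (A (NormedSpace.exp (t • A) θ)) t := fun t =>
    (hasDerivAt_exp_smul_const' A t).clm_apply (hasDerivAt_const t θ) |>.congr_deriv (by simp)
  set Y : ℝ → Euc (m + 2) := fun s : ℝ => NormedSpace.exp (s • A) θ with hY
  have hYc : Continuous Y := continuous_iff_continuousAt.2 fun t => (hder t).continuousAt
  have hfc : Continuous fun s => Metric.infDist (Y s) Γ ^ 2 :=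
    ((Metric.continuous_infDist_pt Γ).comp hYc).pow 2
  have key := image_le_of_liminf_slope_right_le_deriv_boundary (a := 0) (b := t)
    (f := fun s => Metric.infDist (Y s) Γ ^ 2) (B := fun _ => 0) (B' := fun _ => 0)
    hfc.continuousOn (by
      have h0 : (0 : ℝ) • A = 0 := zero_smul ℝ A
      have h1 : Y 0 = θ := by
        change NormedSpace.exp ((0 : ℝ) • A) θ = θ
        rw [h0, NormedSpace.exp_zero]; rfl
      change Metric.infDist (Y 0) Γ ^ 2 ≤ 0
      rw [h1, Metric.infDist_zero_of_mem hθ]; norm_num) continuousOn_const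
    (fun x _ => hasDerivWithinAt_const _ _ _) (by
      intro s _ r hr
      obtain ⟨x, hx, hdist⟩ := hc.exists_infDist_eq_dist hne (Y s)
      have hmax : IsMaxOn (fun z => -‖Y s - z‖ ^ 2) Γ x := fun z hz => by
        change -‖Y s - z‖ ^ 2 ≤ -‖Y s - x‖ ^ 2
        rw [neg_le_neg_iff, ← dist_eq_norm, ← dist_eq_norm, ← hdist]
        exact pow_le_pow_left₀ Metric.infDist_nonneg (Metric.infDist_le_dist_of_mem hz) 2
      have hd1 : HasFDerivAt (fun z => -‖Y s - z‖ ^ 2) _ x :=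
        (((hasFDerivAt_id x).const_sub (Y s)).norm_sq).neg
      have h1 := fderiv_eq_zero_of_isMaxOn hs hemb hn hθn hx (τ := A x) hd1 hmax
        (by rw [real_inner_comm]; exact hA x) (by rw [real_inner_comm]; exact hAn x hx)
      have h2 : ⟪Y s - x, A x⟫ = 0 := by
        rw [inner_sub_left, ← neg_eq_zero, neg_sub]; simpa using h1
      have hd2 : HasDerivAt (fun z => ‖Y z - x‖ ^ 2) (2 * ⟪Y s - x, A (Y s)⟫) s :=
        ((hder s).sub_const x).norm_sq
      have h3 : ⟪Y s - x, A (Y s)⟫ = 0 := by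
        have h4 := hA (Y s - x)
        rw [map_sub, inner_sub_left, real_inner_comm, real_inner_comm (Y s - x) (A x), h2] at h4
        linarith
      rw [h3, mul_zero] at hd2
      have h5 := (hd2.hasDerivWithinAt (s := Ioi s)).limsup_slope_le hr
      rw [Set.sdiff_singleton_eq_self (by simp)] at h5
      refine Eventually.frequently ?_
      filter_upwards [h5, self_mem_nhdsWithin] with z hz hzs
      refine lt_of_le_of_lt ?_ hz
      rw [slope_def_field, slope_def_field]
      have h6 : 0 < z - s := sub_pos.2 hzs
      refine div_le_div_of_nonneg_right ?_ h6.le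
      rw [hdist, ← dist_eq_norm, ← dist_eq_norm]
      gcongr
      · exact Metric.infDist_nonneg
      · exact Metric.infDist_le_dist_of_mem hx)
  have h0 : Metric.infDist (Y t) Γ ^ 2 ≤ 0 := key ⟨ht, le_rfl⟩
  have h1 : Metric.infDist (Y t) Γ = 0 := by
    have := sq_nonneg (Metric.infDist (Y t) Γ)
    exact pow_eq_zero_iff (two_ne_zero) |>.1 (le_antisymm h0 this)
  exact (hc.isClosed.mem_iff_infDist_zero hne).2 h1

end Sphere

/-! ### Linear algebra for the mean curvature of a graph over a cone -/

section LinearAlgebra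

open Matrix

variable {m : ℕ}

/-- The trace `tr (G⁻¹ B)` in terms of the inverse `K` of the lower right block of `G`. -/
lemma trace_inv_mul_eq (G B : Matrix (Fin (m + 1)) (Fin (m + 1)) ℝ) (K : Matrix (Fin m) (Fin m) ℝ)
    (c : Fin m → ℝ) (σ : ℝ) (hGs : ∀ i : Fin m, G 0 i.succ = G i.succ 0)
    (hKs : ∀ i j, K i j = K j i)
    (hK : ∀ i j, ∑ k : Fin m, G i.succ k.succ * K k j = (1 : Matrix (Fin m) (Fin m) ℝ) i j)
    (hc : ∀ i, c i = ∑ j : Fin m, K i j * G j.succ 0)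
    (hσ : σ = G 0 0 - ∑ i : Fin m, c i * G 0 i.succ) (hσ0 : σ ≠ 0) :
    (G⁻¹ * B).trace = σ⁻¹ * (B 0 0 - ∑ i : Fin m, c i * B 0 i.succ - ∑ i : Fin m, c i * B i.succ 0 +
      ∑ i : Fin m, ∑ j : Fin m, c i * c j * B j.succ i.succ) +
        ∑ i : Fin m, ∑ j : Fin m, K i j * B j.succ i.succ := by
  have hGc : ∀ i : Fin m, ∑ k : Fin m, G i.succ k.succ * c k = G i.succ 0 := fun i => by
    calc ∑ k : Fin m, G i.succ k.succ * c k
        = ∑ k : Fin m, ∑ j : Fin m, G i.succ k.succ * K k j * G j.succ 0 := by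
          refine Finset.sum_congr rfl fun k _ => ?_
          rw [hc, Finset.mul_sum]
          exact Finset.sum_congr rfl fun j _ => by ring
      _ = ∑ j : Fin m, (∑ k : Fin m, G i.succ k.succ * K k j) * G j.succ 0 := by
          rw [Finset.sum_comm]
          exact Finset.sum_congr rfl fun j _ => by rw [Finset.sum_mul]
      _ = G i.succ 0 := by simp [hK, Matrix.one_apply]
  let J : Matrix (Fin (m + 1)) (Fin (m + 1)) ℝ := Matrix.of fun a b =>
    Fin.cases (Fin.cases σ⁻¹ (fun j => -(σ⁻¹ * c j)) b)
      (fun i => Fin.cases (-(σ⁻¹ * c i)) (fun j => K i j + σ⁻¹ * (c i * c j)) b) a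
  have hJ : G * J = 1 := by
    ext a b
    rw [Matrix.mul_apply, Fin.sum_univ_succ]
    refine Fin.cases ?_ (fun i => ?_) a <;> refine Fin.cases ?_ (fun j => ?_) b
    · simp only [J, Matrix.of_apply, Fin.cases_zero, Fin.cases_succ, Matrix.one_apply_eq]
      have : ∑ i : Fin m, G 0 i.succ * -(σ⁻¹ * c i) = -(σ⁻¹ * ∑ i : Fin m, c i * G 0 i.succ) := by
        rw [Finset.mul_sum, ← Finset.sum_neg_distrib]
        exact Finset.sum_congr rfl fun i _ => by ring
      rw [this]
      have h2 : G 0 0 * σ⁻¹ + -(σ⁻¹ * ∑ i : Fin m, c i * G 0 i.succ) = σ⁻¹ * σ := by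
        rw [hσ]; ring
      rw [h2, inv_mul_cancel₀ hσ0]
    · simp only [J, Matrix.of_apply, Fin.cases_zero, Fin.cases_succ]
      have h1 : ∑ k : Fin m, G 0 k.succ * (K k j + σ⁻¹ * (c k * c j)) =
          c j + σ⁻¹ * c j * ∑ i : Fin m, c i * G 0 i.succ := by
        rw [hc j, Finset.mul_sum, ← Finset.sum_add_distrib, ← hc j]
        exact Finset.sum_congr rfl fun k _ => by rw [hKs k j, hGs]; ring
      rw [h1, Matrix.one_apply_ne (Fin.succ_ne_zero j).symm]
      have h2 : G 0 0 * -(σ⁻¹ * c j) + (c j + σ⁻¹ * c j * ∑ i : Fin m, c i * G 0 i.succ) =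
          c j - (σ⁻¹ * σ) * c j := by
        rw [hσ]; ring
      rw [h2, inv_mul_cancel₀ hσ0]; ring
    · simp only [J, Matrix.of_apply, Fin.cases_zero, Fin.cases_succ]
      have h1 : ∑ k : Fin m, G i.succ k.succ * -(σ⁻¹ * c k) = -(σ⁻¹ * G i.succ 0) := by
        rw [← hGc, Finset.mul_sum, ← Finset.sum_neg_distrib]
        exact Finset.sum_congr rfl fun k _ => by ring
      rw [h1, Matrix.one_apply_ne (Fin.succ_ne_zero i)]; ring
    · simp only [J, Matrix.of_apply, Fin.cases_zero, Fin.cases_succ]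
      have h1 : ∑ k : Fin m, G i.succ k.succ * (K k j + σ⁻¹ * (c k * c j)) =
          (1 : Matrix (Fin m) (Fin m) ℝ) i j + σ⁻¹ * c j * G i.succ 0 := by
        rw [← hGc, ← hK, Finset.mul_sum, ← Finset.sum_add_distrib]
        exact Finset.sum_congr rfl fun k _ => by ring
      rw [h1]
      simp only [Matrix.one_apply, Fin.succ_inj]; ring
  rw [Matrix.inv_eq_right_inv hJ, Matrix.trace, Fin.sum_univ_succ]
  simp only [Matrix.diag_apply, Matrix.mul_apply, Fin.sum_univ_succ (n := m)]
  simp only [J, Matrix.of_apply, Fin.cases_zero, Fin.cases_succ]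
  simp only [mul_add, mul_sub, add_mul, Finset.sum_add_distrib, Finset.mul_sum, neg_mul,
    Finset.sum_neg_distrib, mul_assoc]
  ring

lemma abs_sum_mul_le {a b : Fin m → ℝ} {A B : ℝ} (ha : ∀ i, |a i| ≤ A) (hb : ∀ i, |b i| ≤ B) :
    |∑ i, a i * b i| ≤ m * (A * B) := by
  refine (Finset.abs_sum_le_sum_abs _ _).trans ?_
  refine (Finset.sum_le_card_nsmul _ _ (A * B) fun i _ => ?_).trans (by simp)
  rw [abs_mul]
  exact mul_le_mul (ha i) (hb i) (abs_nonneg _) ((abs_nonneg _).trans (ha i))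

lemma abs_sum_sum_mul_le {a b : Fin m → Fin m → ℝ} {A B : ℝ} (ha : ∀ i j, |a i j| ≤ A)
    (hb : ∀ i j, |b i j| ≤ B) : |∑ i, ∑ j, a i j * b i j| ≤ (m : ℝ) ^ 2 * (A * B) := by
  refine (Finset.abs_sum_le_sum_abs _ _).trans ?_
  refine (Finset.sum_le_card_nsmul _ _ (m * (A * B)) fun i _ =>
    abs_sum_mul_le (ha i) (hb i)).trans ?_
  simp; linarith

/-- The inverse of a small perturbation of the identity matrix, estimated entrywise. -/
lemma exists_inverse_one_add (E : Matrix (Fin m) (Fin m) ℝ) {e : ℝ} (he : ∀ i j, |E i j| ≤ e)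
    (he0 : 0 ≤ e) (hme : 2 * (m * e) ≤ 1) :
    ∃ K : Matrix (Fin m) (Fin m) ℝ, (1 + E) * K = 1 ∧ K * (1 + E) = 1 ∧
      (∀ i j, |K i j| ≤ 2) ∧
        ∀ i j, |K i j - (1 : Matrix (Fin m) (Fin m) ℝ) i j| ≤ 2 * m * e := by
  have hdet : (1 + E).det ≠ 0 := by
    refine det_ne_zero_of_sum_row_lt_diag fun i => ?_
    have h1 : ∑ j ∈ Finset.univ.erase i, ‖(1 + E) i j‖ ≤ (m - 1) * e := by
      have hm1 : 1 ≤ m := by have := i.2; omega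
      refine (Finset.sum_le_card_nsmul _ _ e fun j hj => ?_).trans ?_
      · rw [Matrix.add_apply, Matrix.one_apply_ne (Finset.ne_of_mem_erase hj).symm, zero_add]
        exact he i j
      · rw [Finset.card_erase_of_mem (Finset.mem_univ _), Finset.card_univ, Fintype.card_fin,
          nsmul_eq_mul, Nat.cast_sub hm1, Nat.cast_one]
    have h2 : 1 - e ≤ ‖(1 + E) i i‖ := by
      rw [Matrix.add_apply, Matrix.one_apply_eq, Real.norm_eq_abs]
      have := neg_le_of_abs_le (he i i)
      exact (by linarith : 1 - e ≤ 1 + E i i).trans (le_abs_self _)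
    nlinarith
  have hu : IsUnit (1 + E).det := isUnit_iff_ne_zero.2 hdet
  set K := (1 + E)⁻¹ with hKdef
  have h1 : (1 + E) * K = 1 := Matrix.mul_nonsing_inv _ hu
  have hK : ∀ i j, K i j - (1 : Matrix (Fin m) (Fin m) ℝ) i j = -∑ k, E i k * K k j := fun i j => by
    have := congrFun (congrFun h1 i) j
    rw [Matrix.add_mul, Matrix.one_mul, Matrix.add_apply, Matrix.mul_apply] at this
    linarith
  set k : ℝ := ‖(fun i j => K i j : Fin m → Fin m → ℝ)‖
  have hk : ∀ i j, |K i j| ≤ k := fun i j =>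
    (norm_le_pi_norm (fun j => K i j) j).trans (norm_le_pi_norm (fun i j => K i j) i)
  have hk0 : 0 ≤ k := norm_nonneg _
  have hd : ∀ i j, |K i j - (1 : Matrix (Fin m) (Fin m) ℝ) i j| ≤ m * (e * k) := fun i j => by
    rw [hK, abs_neg]
    exact abs_sum_mul_le (fun l => he i l) fun l => hk l j
  have hk2 : k ≤ 2 := by
    have h3 : k ≤ 1 + m * (e * k) := by
      have h4 : 0 ≤ 1 + m * (e * k) := by positivity
      refine (pi_norm_le_iff_of_nonneg h4).2 fun i => (pi_norm_le_iff_of_nonneg h4).2 fun j => ?_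
      have h5 : |(1 : Matrix (Fin m) (Fin m) ℝ) i j| ≤ 1 := by
        rw [Matrix.one_apply]; split_ifs <;> simp
      have h6 := abs_add_le (K i j - (1 : Matrix (Fin m) (Fin m) ℝ) i j)
        ((1 : Matrix (Fin m) (Fin m) ℝ) i j)
      rw [sub_add_cancel] at h6
      rw [Real.norm_eq_abs]
      linarith [hd i j]
    nlinarith
  refine ⟨K, h1, Matrix.nonsing_inv_mul _ hu, fun i j => (hk i j).trans hk2, fun i j =>
    (hd i j).trans ?_⟩
  have : (m : ℝ) * e * k ≤ m * e * 2 := by gcongr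
  linarith

set_option maxHeartbeats 1000000 in
/-- The radial second derivative `q` of a function on the end of a cone whose graph is minimal, at a
point where the angular gradients `pᵢ`, `wᵢ` of `p = ∂ᵣw` and `w` are parallel. The hypotheses list
the first and second fundamental forms of the graph in coordinates adapted to the cone. -/
lemma abs_radial_hessian_le (m : ℕ) (D : ℝ) (hD : 1 ≤ D) :
    ∃ C : ℝ, 0 < C ∧ ∀ (r ε p q τ : ℝ) (w e : Fin m → ℝ) (E h F : Matrix (Fin m) (Fin m) ℝ)
      (G B : Matrix (Fin (m + 1)) (Fin (m + 1)) ℝ),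
      1 ≤ r → 2 * m * D ≤ r → 0 ≤ ε → ε ≤ 1 → (∀ i, |w i| ≤ ε) →
      (∀ i j, E i j = E j i) → (∀ i j, |E i j| ≤ D * ε / r) →
      (∀ i, |e i| ≤ D * (1 + |p|) * ε / r) → (∀ i j, |h i j| ≤ D) → h.trace = 0 →
      (∀ i j, |F i j| ≤ D * ε * (1 + |p|)) →
      G 0 0 = 1 + p ^ 2 → (∀ i : Fin m, G 0 i.succ = p * w i) →
      (∀ i : Fin m, G i.succ 0 = p * w i) →
      (∀ i j : Fin m, G i.succ j.succ = r ^ 2 * ((1 : Matrix (Fin m) (Fin m) ℝ) i j + E i j)) →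
      B 0 0 = q → (∀ i : Fin m, B 0 i.succ = τ * w i + e i) →
      (∀ i : Fin m, B i.succ 0 = τ * w i + e i) →
      (∀ i j : Fin m, B i.succ j.succ =
        r * h i j + r * p * (1 : Matrix (Fin m) (Fin m) ℝ) i j + F i j) →
      (G⁻¹ * B).trace = 0 →
      |r ^ 2 * q| ≤ C * ((1 + p ^ 2) * (ε + r * |p|) + |p| * |τ| * ε ^ 2) := by
  set μ : ℝ := (m : ℝ) with hμ
  have hμ0 : 0 ≤ μ := Nat.cast_nonneg m
  refine ⟨4 * μ ^ 2 + 8 * μ ^ 2 * D + 8 * μ ^ 4 * D + 2 * (μ + μ * D + 4 * μ ^ 3 * D ^ 2) + 1,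
    by positivity, ?_⟩
  intro r ε p q τ w e E h F G B hr hrD hε hε1 hw hEs hE he hh htr hF hG00 hG0 hG1 hG hB00 hB0 hB1 hB
    htrace
  have hr0 : 0 < r := by linarith
  have hp0 := abs_nonneg p
  have hrμ : 2 * μ ≤ r := (le_mul_of_one_le_right (by positivity) hD).trans hrD
  obtain ⟨K, hK1, hK2, hK3, hK4⟩ := exists_inverse_one_add E hE (by positivity) (by
    rw [← hμ]
    have h1 : 2 * (μ * (D * ε / r)) = (2 * μ * D) * ε / r := by ring
    rw [h1, div_le_one hr0]
    exact (mul_le_of_le_one_right (by positivity) hε1).trans hrD)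
  have hKs : ∀ i j, K i j = K j i := by
    have h1 : (1 + E)ᵀ = 1 + E := by
      ext i j; rw [Matrix.transpose_apply, Matrix.add_apply, Matrix.add_apply, hEs j i]
      rw [Matrix.one_apply, Matrix.one_apply]; simp [eq_comm]
    have h2 : Kᵀ * (1 + E) = 1 := by
      rw [← h1, ← Matrix.transpose_mul, hK1, Matrix.transpose_one]
    have h3 : Kᵀ = K := by
      calc Kᵀ = Kᵀ * ((1 + E) * K) := by rw [hK1, Matrix.mul_one]
        _ = K := by rw [← Matrix.mul_assoc, h2, Matrix.one_mul]
    intro i j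
    exact congrFun (congrFun h3 j) i |>.symm ▸ rfl
  obtain ⟨s, hs⟩ : ∃ s : Fin m → ℝ, ∀ i, s i = ∑ j, K i j * w j := ⟨_, fun _ => rfl⟩
  have hs1 : ∀ i, |s i| ≤ μ * (2 * ε) := fun i => by
    rw [hs]; exact abs_sum_mul_le (hK3 i) hw
  obtain ⟨σ, hσ⟩ : ∃ σ : ℝ, σ = 1 + p ^ 2 - ∑ i, (p * s i / r ^ 2) * (p * w i) := ⟨_, rfl⟩
  have hσb : |∑ i, (p * s i / r ^ 2) * (p * w i)| ≤ p ^ 2 / 2 := by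
    have h1 : ∑ i, (p * s i / r ^ 2) * (p * w i) = p ^ 2 / r ^ 2 * ∑ i, s i * w i := by
      rw [Finset.mul_sum]; exact Finset.sum_congr rfl fun i _ => by ring
    have h2 : |∑ i, s i * w i| ≤ μ * (μ * (2 * ε) * ε) := abs_sum_mul_le hs1 hw
    rw [h1, abs_mul, abs_of_nonneg (by positivity)]
    have h3 : μ * (μ * (2 * ε) * ε) ≤ r ^ 2 / 2 := by
      have h4 : ε * ε ≤ 1 := mul_le_one₀ hε1 hε hε1
      have h5 : μ * (μ * (2 * ε) * ε) = 2 * μ ^ 2 * (ε * ε) := by ring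
      have h6 : 2 * μ ^ 2 * (ε * ε) ≤ 2 * μ ^ 2 := mul_le_of_le_one_right (by positivity) h4
      have h7 : (2 * μ) ^ 2 ≤ r ^ 2 := pow_le_pow_left₀ (by positivity) hrμ 2
      linarith
    calc p ^ 2 / r ^ 2 * |∑ i, s i * w i| ≤ p ^ 2 / r ^ 2 * (r ^ 2 / 2) := by
          gcongr; exact h2.trans h3
      _ = p ^ 2 / 2 := by field_simp
  obtain ⟨hσb1, hσb2⟩ := abs_le.1 hσb
  have hσpos : 0 < σ := by linarith [sq_nonneg p]
  have hσle : σ ≤ 2 * (1 + p ^ 2) := by linarith [sq_nonneg p]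
  have hform := trace_inv_mul_eq G B (fun i j => K i j / r ^ 2) (fun i => p * s i / r ^ 2) σ
    (fun i => by rw [hG0, hG1]) (fun i j => by rw [hKs]) (fun i j => by
      have h1 := congrFun (congrFun hK1 i) j
      rw [Matrix.mul_apply] at h1
      rw [← h1]
      refine Finset.sum_congr rfl fun k _ => ?_
      rw [hG, Matrix.add_apply]; field_simp)
    (fun i => by
      rw [hs, Finset.mul_sum, Finset.sum_div]
      exact Finset.sum_congr rfl fun j _ => by rw [hG1]; ring)
    (by rw [hσ, hG00]; congr 1; exact Finset.sum_congr rfl fun i _ => by rw [hG0]) hσpos.ne'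
  rw [htrace] at hform
  obtain ⟨T1, hT1⟩ : ∃ T : ℝ, T = ∑ i, s i * (τ * w i + e i) := ⟨_, rfl⟩
  obtain ⟨T2, hT2⟩ : ∃ T : ℝ, T = ∑ i : Fin m, ∑ j : Fin m, (s i * s j) * B j.succ i.succ :=
    ⟨_, rfl⟩
  obtain ⟨T3, hT3⟩ : ∃ T : ℝ, T = ∑ i : Fin m, ∑ j : Fin m, K i j * B j.succ i.succ := ⟨_, rfl⟩
  have e1 : ∑ i : Fin m, p * s i / r ^ 2 * B 0 i.succ = p / r ^ 2 * T1 := by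
    rw [hT1, Finset.mul_sum]
    exact Finset.sum_congr rfl fun i _ => by rw [hB0]; ring
  have e2 : ∑ i : Fin m, p * s i / r ^ 2 * B i.succ 0 = p / r ^ 2 * T1 := by
    rw [hT1, Finset.mul_sum]
    exact Finset.sum_congr rfl fun i _ => by rw [hB1]; ring
  have e3 : ∑ i : Fin m, ∑ j : Fin m, p * s i / r ^ 2 * (p * s j / r ^ 2) * B j.succ i.succ =
      p ^ 2 / r ^ 4 * T2 := by
    rw [hT2, Finset.mul_sum]
    refine Finset.sum_congr rfl fun i _ => ?_
    rw [Finset.mul_sum]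
    exact Finset.sum_congr rfl fun j _ => by ring
  have e4 : ∑ i : Fin m, ∑ j : Fin m, K i j / r ^ 2 * B j.succ i.succ = T3 / r ^ 2 := by
    rw [hT3, Finset.sum_div]
    refine Finset.sum_congr rfl fun i _ => ?_
    rw [Finset.sum_div]
    exact Finset.sum_congr rfl fun j _ => by ring
  rw [e1, e2, e3, e4, hB00] at hform
  have hq : r ^ 2 * q = 2 * (p * T1) - p ^ 2 / r ^ 2 * T2 - σ * T3 := by
    have h1 : σ⁻¹ * (q - p / r ^ 2 * T1 - p / r ^ 2 * T1 + p ^ 2 / r ^ 4 * T2) + T3 / r ^ 2 = 0 :=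
      hform.symm
    field_simp at h1
    field_simp
    linarith
  -- Estimates of the three terms.
  have hpp : |p| * (1 + |p|) ≤ 2 * (1 + p ^ 2) := by
    linarith [sq_abs p, sq_nonneg (|p| - 1)]
  have hb1 : |p * T1| ≤ 2 * μ ^ 2 * (|p| * |τ| * ε ^ 2) + 4 * μ ^ 2 * D * ((1 + p ^ 2) * ε) := by
    have h1 : |T1| ≤ μ * (μ * (2 * ε) * (|τ| * ε + D * (1 + |p|) * ε / r)) := by
      rw [hT1]
      refine abs_sum_mul_le hs1 fun i => (abs_add_le _ _).trans ?_
      rw [abs_mul]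
      gcongr
      · exact hw i
      · exact he i
    have h2 : D * (1 + |p|) * ε / r ≤ D * (1 + |p|) := by
      rw [div_le_iff₀ hr0]
      exact mul_le_mul_of_nonneg_left (hε1.trans hr) (by positivity)
    have h3 : |T1| ≤ μ * (μ * (2 * ε) * (|τ| * ε + D * (1 + |p|))) := h1.trans (by gcongr)
    rw [abs_mul]
    calc |p| * |T1| ≤ |p| * (μ * (μ * (2 * ε) * (|τ| * ε + D * (1 + |p|)))) := by gcongr
      _ = 2 * μ ^ 2 * (|p| * |τ| * ε ^ 2) + 2 * μ ^ 2 * D * ε * (|p| * (1 + |p|)) := by ring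
      _ ≤ 2 * μ ^ 2 * (|p| * |τ| * ε ^ 2) + 2 * μ ^ 2 * D * ε * (2 * (1 + p ^ 2)) := by gcongr
      _ = _ := by ring
  have hBb : ∀ i j : Fin m, |B i.succ j.succ| ≤ 2 * r * D * (1 + |p|) := fun i j => by
    rw [hB]
    have h1 : |r * h i j| ≤ r * D := by
      rw [abs_mul, abs_of_pos hr0]; exact mul_le_mul_of_nonneg_left (hh i j) hr0.le
    have h2 : |r * p * (1 : Matrix (Fin m) (Fin m) ℝ) i j| ≤ r * |p| := by
      rw [abs_mul, abs_mul, abs_of_pos hr0, Matrix.one_apply]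
      split_ifs <;> simp; positivity
    have h3 := hF i j
    have h4 : D * ε * (1 + |p|) ≤ r * D * (1 + |p|) := by
      have h6 : D * ε ≤ r * D := by
        rw [mul_comm r D]; exact mul_le_mul_of_nonneg_left (hε1.trans hr) (by linarith)
      exact mul_le_mul_of_nonneg_right h6 (by positivity)
    have h5 : r * |p| ≤ r * D * |p| := by
      rw [mul_right_comm]
      exact le_mul_of_one_le_right (by positivity) hD
    refine (abs_add_three _ _ _).trans ?_
    linarith
  have hb2 : |p ^ 2 / r ^ 2 * T2| ≤ 8 * μ ^ 4 * D * ((1 + p ^ 2) * (ε + r * |p|)) := by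
    have h1 : |T2| ≤ μ ^ 2 * ((μ * (2 * ε)) * (μ * (2 * ε)) * (2 * r * D * (1 + |p|))) := by
      rw [hT2]
      refine abs_sum_sum_mul_le (fun i j => ?_) fun i j => hBb j i
      rw [abs_mul]
      exact mul_le_mul (hs1 i) (hs1 j) (abs_nonneg _) (by positivity)
    have h2 : ε ^ 2 * (1 + |p|) ≤ r * (ε + r * |p|) := by
      have h3 : ε ^ 2 ≤ r * ε := by
        rw [sq]; exact mul_le_mul_of_nonneg_right (hε1.trans hr) hε
      have h4 : ε ^ 2 ≤ r * r := by
        rw [sq]; exact mul_le_mul (hε1.trans hr) (hε1.trans hr) hε hr0.le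
      have h5 : ε ^ 2 * |p| ≤ r * r * |p| := mul_le_mul_of_nonneg_right h4 hp0
      linarith
    rw [abs_mul, abs_of_nonneg (by positivity)]
    calc p ^ 2 / r ^ 2 * |T2|
        ≤ p ^ 2 / r ^ 2 * (μ ^ 2 * ((μ * (2 * ε)) * (μ * (2 * ε)) * (2 * r * D * (1 + |p|)))) := by
          gcongr
      _ = 8 * μ ^ 4 * D * (p ^ 2 / r * (ε ^ 2 * (1 + |p|))) := by field_simp; ring
      _ ≤ 8 * μ ^ 4 * D * (p ^ 2 / r * (r * (ε + r * |p|))) := by gcongr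
      _ = 8 * μ ^ 4 * D * (p ^ 2 * (ε + r * |p|)) := by field_simp
      _ ≤ _ := by gcongr; linarith
  have hb3 : |T3| ≤ (μ + μ * D + 4 * μ ^ 3 * D ^ 2) * (ε + r * |p|) := by
    have h1 : T3 = ∑ i : Fin m, B i.succ i.succ +
        ∑ i : Fin m, ∑ j : Fin m, (K i j - (1 : Matrix (Fin m) (Fin m) ℝ) i j) *
          B j.succ i.succ := by
      rw [hT3, ← Finset.sum_add_distrib]
      refine Finset.sum_congr rfl fun i _ => ?_
      simp [sub_mul, Finset.sum_sub_distrib, Matrix.one_apply]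
    have h2 : ∑ i : Fin m, B i.succ i.succ = μ * (r * p) + ∑ i, F i i := by
      have h3 : ∑ i, h i i = 0 := htr
      simp only [hB, Finset.sum_add_distrib, ← Finset.mul_sum, h3, Matrix.one_apply_eq]
      simp [hμ]; ring
    have h3 : |∑ i, F i i| ≤ μ * (D * ε * (1 + |p|)) := by
      refine (Finset.abs_sum_le_sum_abs _ _).trans ?_
      refine (Finset.sum_le_card_nsmul _ _ _ fun i _ => hF i i).trans (by simp [hμ])
    have h4 : |∑ i : Fin m, ∑ j : Fin m, (K i j - (1 : Matrix (Fin m) (Fin m) ℝ) i j) *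
          B j.succ i.succ| ≤ μ ^ 2 * (2 * μ * (D * ε / r) * (2 * r * D * (1 + |p|))) :=
      abs_sum_sum_mul_le hK4 fun i j => hBb j i
    have h5 : μ ^ 2 * (2 * μ * (D * ε / r) * (2 * r * D * (1 + |p|))) =
        4 * μ ^ 3 * D ^ 2 * (ε * (1 + |p|)) := by field_simp; ring
    have h6 : ε * (1 + |p|) ≤ ε + r * |p| := by
      have := mul_le_mul_of_nonneg_right (hε1.trans hr) hp0
      linarith
    rw [h1, h2]
    have h7 : |μ * (r * p)| ≤ μ * (ε + r * |p|) := by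
      rw [abs_mul, abs_mul, abs_of_nonneg hμ0, abs_of_pos hr0]
      gcongr; linarith
    have h8 : μ * (D * ε * (1 + |p|)) ≤ μ * D * (ε + r * |p|) := by
      rw [mul_assoc, mul_assoc]; gcongr
    have h9 : 4 * μ ^ 3 * D ^ 2 * (ε * (1 + |p|)) ≤ 4 * μ ^ 3 * D ^ 2 * (ε + r * |p|) := by
      gcongr
    refine (abs_add_le _ _).trans ((add_le_add (abs_add_le _ _) le_rfl).trans ?_)
    linarith
  have hb4 : |σ * T3| ≤ 2 * (μ + μ * D + 4 * μ ^ 3 * D ^ 2) * ((1 + p ^ 2) * (ε + r * |p|)) := by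
    rw [abs_mul, abs_of_pos hσpos]
    calc σ * |T3| ≤ (2 * (1 + p ^ 2)) * ((μ + μ * D + 4 * μ ^ 3 * D ^ 2) * (ε + r * |p|)) := by
          gcongr
      _ = _ := by ring
  have hX : (1 + p ^ 2) * ε ≤ (1 + p ^ 2) * (ε + r * |p|) := by
    gcongr; have : 0 ≤ r * |p| := by positivity
    linarith
  set X := (1 + p ^ 2) * (ε + r * |p|)
  set Y := |p| * |τ| * ε ^ 2
  have hX0 : 0 ≤ X := by positivity
  have hY0 : 0 ≤ Y := by positivity
  rw [hq]
  have h1 : |2 * (p * T1) - p ^ 2 / r ^ 2 * T2 - σ * T3| ≤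
      2 * |p * T1| + |p ^ 2 / r ^ 2 * T2| + |σ * T3| := by
    refine (abs_sub _ _).trans (add_le_add ((abs_sub _ _).trans (add_le_add ?_ le_rfl)) le_rfl)
    rw [abs_mul]; simp
  have h2 : 4 * μ ^ 2 * D * ((1 + p ^ 2) * ε) ≤ 4 * μ ^ 2 * D * X := by gcongr
  refine h1.trans ?_
  have h3 : 0 ≤ (8 * μ ^ 2 * D + 8 * μ ^ 4 * D + 2 * (μ + μ * D + 4 * μ ^ 3 * D ^ 2) + 1) * Y := by
    positivity
  have h4 : 0 ≤ (4 * μ ^ 2 + 1) * X := by positivity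
  linarith

end LinearAlgebra

/-! ### The normal and the minimal surface equation of a graph over a cone -/

/-- The position `θ`, the normal `N`, and their first and second derivatives in coordinates of a
minimal hypersurface of the sphere that are adapted to a point, with bound `D`. -/
structure IsAdaptedFrame {m : ℕ} (D : ℝ) (θ N : Euc (m + 2)) (θ₁ N₁ : Fin m → Euc (m + 2))
    (θ₂ N₂ : Fin m → Fin m → Euc (m + 2)) : Prop where
  norm_pos : ‖θ‖ = 1
  norm_normal : ‖N‖ = 1
  inner_pos_normal : ⟪θ, N⟫ = 0
  inner_tangent_pos : ∀ i, ⟪θ₁ i, θ⟫ = 0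
  inner_tangent_normal : ∀ i, ⟪θ₁ i, N⟫ = 0
  inner_tangent : ∀ i j, ⟪θ₁ i, θ₁ j⟫ = (1 : Matrix (Fin m) (Fin m) ℝ) i j
  inner_shape_pos : ∀ i, ⟪N₁ i, θ⟫ = 0
  inner_shape_normal : ∀ i, ⟪N₁ i, N⟫ = 0
  inner_second_pos : ∀ i j, ⟪θ₂ i j, θ⟫ = -(1 : Matrix (Fin m) (Fin m) ℝ) i j
  trace_second : ∑ i, ⟪θ₂ i i, N⟫ = 0
  norm_second_le : ∀ i j, ‖θ₂ i j‖ ≤ D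
  norm_shape_le : ∀ i, ‖N₁ i‖ ≤ D
  norm_shape_deriv_le : ∀ i j, ‖N₂ i j‖ ≤ D

namespace IsAdaptedFrame

variable {m : ℕ} {D : ℝ} {θ N : Euc (m + 2)} {θ₁ N₁ : Fin m → Euc (m + 2)}
  {θ₂ N₂ : Fin m → Fin m → Euc (m + 2)}

lemma exists_decomposition (hF : IsAdaptedFrame D θ N θ₁ N₁ θ₂ N₂) (z : Euc (m + 2)) :
    ∃ s : Fin m → ℝ, z = ⟪θ, z⟫ • θ + ∑ i, s i • θ₁ i + ⟪N, z⟫ • N := by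
  let L : Euc m →L[ℝ] Euc (m + 2) := LinearMap.toContinuousLinearMap
    { toFun := fun v => ∑ i, v i • θ₁ i
      map_add' := fun v v' => by
        simp only [PiLp.add_apply, add_smul, Finset.sum_add_distrib]
      map_smul' := fun c v => by
        simp only [PiLp.smul_apply, smul_eq_mul, mul_smul, Finset.smul_sum, RingHom.id_apply] }
  have hL : ∀ v, L v = ∑ i, v i • θ₁ i := fun v => rfl
  have hco : ∀ v j, ⟪L v, θ₁ j⟫ = v j := fun v j => by
    simp only [hL, sum_inner, inner_smul_left, hF.inner_tangent, Matrix.one_apply]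
    simp
  have hinj : Function.Injective L := fun v v' h => by
    ext j
    rw [← hco v j, ← hco v' j, h]
  obtain ⟨v, hv⟩ := exists_frame_decomposition L hinj hF.norm_pos hF.norm_normal
    hF.inner_pos_normal
    (fun v => by simp only [hL, sum_inner, inner_smul_left, hF.inner_tangent_pos]; simp)
    (fun v => by simp only [hL, sum_inner, inner_smul_left, hF.inner_tangent_normal]; simp) z
  exact ⟨fun i => v i, hv⟩

lemma norm_tangent (hF : IsAdaptedFrame D θ N θ₁ N₁ θ₂ N₂) (i : Fin m) : ‖θ₁ i‖ = 1 := by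
  have h := hF.inner_tangent i i
  rw [real_inner_self_eq_norm_sq, Matrix.one_apply_eq] at h
  exact (pow_eq_one_iff_of_nonneg (norm_nonneg _) two_ne_zero).1 h

/-- The tangential part of a vector normal to the graph, in terms of its component along the normal
of the cone. -/
lemma normal_tangential_le (hF : IsAdaptedFrame D θ N θ₁ N₁ θ₂ N₂) {r w ε : ℝ} {w₁ : Fin m → ℝ}
    (hr : 1 ≤ r) (hrD : 2 * m * D ≤ r) (hD : 1 ≤ D) (hε1 : ε ≤ 1) (hw : |w| ≤ ε)
    (hw₁ : ∀ i, |w₁ i| ≤ ε) {ν : Euc (m + 2)} {s : Fin m → ℝ}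
    (hs : ν = ⟪θ, ν⟫ • θ + ∑ i, s i • θ₁ i + ⟪N, ν⟫ • N)
    (hν : ∀ i, ⟪r • θ₁ i + w • N₁ i + w₁ i • N, ν⟫ = 0) (i : Fin m) :
    |s i| ≤ 2 * ε * |⟪N, ν⟫| / r := by
  have hr0 : 0 < r := by linarith
  have hε0 : 0 ≤ ε := (abs_nonneg _).trans hw
  have hNs : ∀ i, ⟪N₁ i, ν⟫ = ∑ k, s k * ⟪N₁ i, θ₁ k⟫ := fun i => by
    rw [hs, inner_add_right, inner_add_right, inner_smul_right, inner_smul_right,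
      hF.inner_shape_pos, hF.inner_shape_normal, inner_sum]
    simp [inner_smul_right]
  have hθs : ∀ i, ⟪θ₁ i, ν⟫ = s i := fun i => by
    rw [hs, inner_add_right, inner_add_right, inner_smul_right, inner_smul_right,
      hF.inner_tangent_pos, hF.inner_tangent_normal, inner_sum]
    simp [inner_smul_right, hF.inner_tangent, Matrix.one_apply]
  set t : ℝ := ‖s‖
  have ht : ∀ i, |s i| ≤ t := fun i => norm_le_pi_norm s i
  have ht0 : 0 ≤ t := norm_nonneg _
  have hb : ∀ i, r * |s i| ≤ ε * (m * (t * D)) + ε * |⟪N, ν⟫| := fun i => by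
    have h1 := hν i
    rw [inner_add_left, inner_add_left, inner_smul_left, inner_smul_left, inner_smul_left, hNs,
      hθs] at h1
    simp only [conj_trivial] at h1
    have h2 : |∑ k, s k * ⟪N₁ i, θ₁ k⟫| ≤ m * (t * D) := by
      refine abs_sum_mul_le ht fun k => ?_
      have := abs_real_inner_le_norm (N₁ i) (θ₁ k)
      rw [hF.norm_tangent, mul_one] at this
      exact this.trans (hF.norm_shape_le i)
    have h3 : r * s i = -(w * ∑ k, s k * ⟪N₁ i, θ₁ k⟫ + w₁ i * ⟪N, ν⟫) := by linarith
    have h4 : r * |s i| = |r * s i| := by rw [abs_mul, abs_of_pos hr0]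
    rw [h4, h3, abs_neg]
    refine (abs_add_le _ _).trans ?_
    rw [abs_mul, abs_mul]
    gcongr
    exact hw₁ i
  have htb : t ≤ (ε * (m * (t * D)) + ε * |⟪N, ν⟫|) / r := by
    refine (pi_norm_le_iff_of_nonneg (by positivity)).2 fun i => ?_
    rw [Real.norm_eq_abs, le_div_iff₀ hr0, mul_comm]
    exact hb i
  have h1 : ε * (m * (t * D)) ≤ r * t / 2 := by
    have h2 : ε * (m * (t * D)) ≤ 1 * (m * (t * D)) := by gcongr
    have h3 := mul_le_mul_of_nonneg_right hrD ht0
    linarith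
  rw [le_div_iff₀ hr0] at htb ⊢
  have := mul_le_mul_of_nonneg_right (ht i) hr0.le
  linarith

/-- A unit normal `ν` of the graph is a multiple of `N - p θ + T`, with `p = ∂ᵣw` and a small
tangential part `T`. -/
lemma exists_normal_eq (hF : IsAdaptedFrame D θ N θ₁ N₁ θ₂ N₂) {r w p ε : ℝ} {w₁ : Fin m → ℝ}
    (hr : 1 ≤ r) (hrD : 2 * m * D ≤ r) (hD : 1 ≤ D) (hε1 : ε ≤ 1) (hw : |w| ≤ ε)
    (hw₁ : ∀ i, |w₁ i| ≤ ε) {ν : Euc (m + 2)} (hν1 : ‖ν‖ = 1) (hν0 : ⟪θ + p • N, ν⟫ = 0)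
    (hν : ∀ i, ⟪r • θ₁ i + w • N₁ i + w₁ i • N, ν⟫ = 0) :
    ∃ (a : ℝ) (T : Fin m → ℝ), a = ⟪N, ν⟫ ∧ a ≠ 0 ∧ (∀ i, |T i| ≤ 2 * ε / r) ∧
      ν = a • (N - p • θ + ∑ i, T i • θ₁ i) := by
  obtain ⟨s, hs⟩ := hF.exists_decomposition ν
  have hsb := hF.normal_tangential_le hr hrD hD hε1 hw hw₁ hs hν
  have hb : ⟪θ, ν⟫ = -(p * ⟪N, ν⟫) := by
    rw [inner_add_left, inner_smul_left] at hν0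
    simp only [conj_trivial] at hν0
    linarith
  have ha : ⟪N, ν⟫ ≠ 0 := fun h => by
    rw [h] at hsb hb
    have hs0 : ∀ i, s i = 0 := fun i => by
      have := hsb i
      rw [abs_zero, mul_zero, zero_div] at this
      exact abs_eq_zero.1 (le_antisymm this (abs_nonneg _))
    rw [hb, h] at hs
    simp only [hs0] at hs
    rw [hs] at hν1
    simp at hν1
  refine ⟨⟪N, ν⟫, fun i => s i / ⟪N, ν⟫, rfl, ha, fun i => ?_, ?_⟩
  · rw [abs_div, div_le_iff₀ (abs_pos.2 ha)]
    refine (hsb i).trans (le_of_eq (by ring))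
  · nth_rw 1 [hs]
    rw [hb, smul_add, Finset.smul_sum, smul_sub, smul_smul]
    have : ∀ i, ⟪N, ν⟫ • (s i / ⟪N, ν⟫) • θ₁ i = s i • θ₁ i := fun i => by
      rw [smul_smul, mul_div_cancel₀ _ ha]
    simp only [this]
    module

lemma norm_tangential_le (hF : IsAdaptedFrame D θ N θ₁ N₁ θ₂ N₂) {T : Fin m → ℝ} {t : ℝ}
    (hT : ∀ i, |T i| ≤ t) : ‖∑ i, T i • θ₁ i‖ ≤ m * t := by
  refine (norm_sum_le _ _).trans ?_
  refine (Finset.sum_le_card_nsmul _ _ t fun i _ => ?_).trans (by simp)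
  rw [norm_smul, hF.norm_tangent, mul_one]
  exact hT i

set_option maxHeartbeats 1000000 in
/-- The minimal surface equation for a graph over a cone bounds the second radial derivative `q` of
`w` at the points where the angular gradient of `p = ∂ᵣw` is `τ` times that of `w`. -/
lemma exists_radial_hessian_bound (m : ℕ) (D : ℝ) (hD : 1 ≤ D) :
    ∃ C r₀ : ℝ, 0 < C ∧ 1 ≤ r₀ ∧ ∀ {θ N : Euc (m + 2)} {θ₁ N₁ : Fin m → Euc (m + 2)}
      {θ₂ N₂ : Fin m → Fin m → Euc (m + 2)}, IsAdaptedFrame D θ N θ₁ N₁ θ₂ N₂ →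
      ∀ (r w p q τ ε : ℝ) (w₁ : Fin m → ℝ) (w₂ : Fin m → Fin m → ℝ) (ν : Euc (m + 2))
      (X₁ : Fin (m + 1) → Euc (m + 2)) (X₂ : Fin (m + 1) → Fin (m + 1) → Euc (m + 2)),
      r₀ ≤ r → ε ≤ 1 → |w| ≤ ε → (∀ i, |w₁ i| ≤ ε) → (∀ i j, |w₂ i j| ≤ (1 + m * D) * ε) →
      ‖ν‖ = 1 → (∀ i, ⟪X₁ i, ν⟫ = 0) → X₁ 0 = θ + p • N →
      (∀ i : Fin m, X₁ i.succ = r • θ₁ i + w • N₁ i + w₁ i • N) →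
      X₂ 0 0 = q • N → (∀ i : Fin m, X₂ 0 i.succ = θ₁ i + p • N₁ i + (τ * w₁ i) • N) →
      (∀ i : Fin m, X₂ i.succ 0 = θ₁ i + p • N₁ i + (τ * w₁ i) • N) →
      (∀ i j : Fin m, X₂ i.succ j.succ =
        r • θ₂ i j + w₁ i • N₁ j + w • N₂ i j + w₂ i j • N + w₁ j • N₁ i) →
      ((Matrix.of fun i j => ⟪X₁ i, X₁ j⟫)⁻¹ * Matrix.of fun i j => ⟪X₂ i j, ν⟫).trace = 0 →
      |r ^ 2 * q| ≤ C * ((1 + p ^ 2) * (ε + r * |p|) + |p| * |τ| * ε ^ 2) := by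
  set D' : ℝ := 20 * (m + 1) * D ^ 2 with hD'
  have hm0 : (0 : ℝ) ≤ m := Nat.cast_nonneg m
  have hDD : D ≤ D ^ 2 := by nlinarith
  have hmD : 0 ≤ (m : ℝ) * D := by positivity
  have hmDD : (m : ℝ) * D ≤ m * D ^ 2 := by gcongr
  have hD'eq : D' = 20 * (m * D ^ 2) + 20 * D ^ 2 := by rw [hD']; ring
  have hD'1 : 1 ≤ D' := by linarith [mul_nonneg hm0 (sq_nonneg D)]
  obtain ⟨C, hC0, hC⟩ := abs_radial_hessian_le m D' hD'1
  refine ⟨C, 1 + 2 * m * D', hC0, by nlinarith, ?_⟩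
  intro θ N θ₁ N₁ θ₂ N₂ hF r w p q τ ε w₁ w₂ ν X₁ X₂ hr hε1 hw hw₁ hw₂ hν1 hν hX0 hX1 hX00 hX01 hX10
    hX11 htr
  have hmD' : 0 ≤ 2 * (m : ℝ) * D' := by positivity
  have hr1 : 1 ≤ r := by linarith
  have hr0 : 0 < r := by linarith
  have hε0 : 0 ≤ ε := (abs_nonneg _).trans hw
  have hεr : ε / r ≤ ε := div_le_self hε0 hr1
  have hrD : 2 * m * D ≤ r := by
    have : 2 * m * D ≤ 2 * m * D' := by gcongr; linarith [mul_nonneg hm0 (sq_nonneg D)]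
    linarith
  have hp0 := abs_nonneg p
  have hNN : ⟪N, N⟫ = 1 := by rw [real_inner_self_eq_norm_sq, hF.norm_normal]; norm_num
  have hθθ : ⟪θ, θ⟫ = 1 := by rw [real_inner_self_eq_norm_sq, hF.norm_pos]; norm_num
  have hNθ : ⟪N, θ⟫ = 0 := by rw [real_inner_comm]; exact hF.inner_pos_normal
  have hθi : ∀ i, ⟪θ, θ₁ i⟫ = 0 := fun i => by rw [real_inner_comm]; exact hF.inner_tangent_pos i
  have hNi : ∀ i, ⟪N, θ₁ i⟫ = 0 := fun i => by rw [real_inner_comm]; exact hF.inner_tangent_normal i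
  have hθn : ∀ i, ⟪θ, N₁ i⟫ = 0 := fun i => by rw [real_inner_comm]; exact hF.inner_shape_pos i
  have hNn : ∀ i, ⟪N, N₁ i⟫ = 0 := fun i => by rw [real_inner_comm]; exact hF.inner_shape_normal i
  obtain ⟨a, T, -, ha, hT, hνV⟩ := hF.exists_normal_eq (p := p) hr1 hrD hD hε1 hw hw₁ hν1
    (by rw [← hX0]; exact hν 0) (fun i => by rw [← hX1]; exact hν i.succ)
  obtain ⟨V, hV⟩ : ∃ V, V = N - p • θ + ∑ i, T i • θ₁ i := ⟨_, rfl⟩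
  rw [← hV] at hνV
  have hTb : ‖∑ i, T i • θ₁ i‖ ≤ m * (2 * ε / r) := hF.norm_tangential_le hT
  have hVnorm : ‖V‖ ≤ 1 + |p| + 2 * m := by
    rw [hV]
    refine (norm_add_le _ _).trans ((add_le_add (norm_sub_le _ _) hTb).trans ?_)
    rw [norm_smul, hF.norm_normal, hF.norm_pos, Real.norm_eq_abs]
    have : (m : ℝ) * (2 * ε / r) ≤ m * 2 := by
      gcongr; rw [mul_div_assoc]; linarith
    linarith
  have hTV : ∀ z, ⟪z, V⟫ = ⟪z, N⟫ - p * ⟪z, θ⟫ + ∑ k, T k * ⟪z, θ₁ k⟫ := fun z => by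
    rw [hV, inner_add_right, inner_sub_right, inner_smul_right, inner_sum]
    simp only [inner_smul_right]
  have hθT : ∀ i, ⟪θ₁ i, V⟫ = T i := fun i => by
    rw [hTV, hF.inner_tangent_pos, hF.inner_tangent_normal]
    simp [hF.inner_tangent, Matrix.one_apply]
  have hNV : ⟪N, V⟫ = 1 := by rw [hTV, hNN, hNθ]; simp [hNi]
  have hnV : ∀ i, ⟪N₁ i, V⟫ = ∑ k, T k * ⟪N₁ i, θ₁ k⟫ := fun i => by
    rw [hTV, hF.inner_shape_normal, hF.inner_shape_pos]; ring
  have hnT : ∀ i, |⟪N₁ i, V⟫| ≤ m * (2 * ε / r * D) := fun i => by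
    rw [hnV]
    refine abs_sum_mul_le hT fun k => ?_
    have := abs_real_inner_le_norm (N₁ i) (θ₁ k)
    rw [hF.norm_tangent, mul_one] at this
    exact this.trans (hF.norm_shape_le i)
  have hnθ : ∀ i j, |⟪N₁ i, θ₁ j⟫| ≤ D := fun i j => by
    have := abs_real_inner_le_norm (N₁ i) (θ₁ j)
    rw [hF.norm_tangent, mul_one] at this
    exact this.trans (hF.norm_shape_le i)
  have hnn : ∀ i j, |⟪N₁ i, N₁ j⟫| ≤ D * D := fun i j =>
    (abs_real_inner_le_norm _ _).trans (mul_le_mul (hF.norm_shape_le i) (hF.norm_shape_le j)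
      (norm_nonneg _) (by linarith))
  have htV : ((Matrix.of fun i j => ⟪X₁ i, X₁ j⟫)⁻¹ * Matrix.of fun i j => ⟪X₂ i j, V⟫).trace =
      0 := by
    have h1 : (Matrix.of fun i j => ⟪X₂ i j, ν⟫) = a • Matrix.of fun i j => ⟪X₂ i j, V⟫ := by
      ext i j
      simp only [Matrix.of_apply, Matrix.smul_apply, hνV, inner_smul_right, smul_eq_mul]
    rw [h1, Matrix.mul_smul, Matrix.trace_smul, smul_eq_mul] at htr
    exact (mul_eq_zero.1 htr).resolve_left ha
  refine hC r ε p q τ w₁ (fun i => T i + p * ⟪N₁ i, V⟫)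
    (fun i j =>
      (r * w * (⟪N₁ j, θ₁ i⟫ + ⟪N₁ i, θ₁ j⟫) + w ^ 2 * ⟪N₁ i, N₁ j⟫ + w₁ i * w₁ j) / r ^ 2)
    (Matrix.of fun i j => ⟪θ₂ i j, N⟫)
    (fun i j => r * ∑ k, T k * ⟪θ₂ i j, θ₁ k⟫ + w₁ i * ⟪N₁ j, V⟫ + w * ⟪N₂ i j, V⟫ + w₂ i j +
      w₁ j * ⟪N₁ i, V⟫)
    _ _ hr1 (by linarith) hε0 hε1 hw₁ (fun i j => ?_) (fun i j => ?_) (fun i => ?_)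
    (fun i j => ?_) ?_ (fun i j => ?_) ?_ (fun i => ?_) (fun i => ?_) (fun i j => ?_) ?_
    (fun i => ?_) (fun i => ?_) (fun i j => ?_) htV
  · rw [real_inner_comm (N₁ j) (N₁ i)]; ring
  · rw [abs_div, abs_of_pos (show 0 < r ^ 2 by positivity), div_le_iff₀ (by positivity)]
    have h1 : |r * w * (⟪N₁ j, θ₁ i⟫ + ⟪N₁ i, θ₁ j⟫)| ≤ r * ε * (D + D) := by
      rw [abs_mul, abs_mul, abs_of_pos hr0]
      have := (abs_add_le ⟪N₁ j, θ₁ i⟫ ⟪N₁ i, θ₁ j⟫).trans (add_le_add (hnθ j i) (hnθ i j))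
      gcongr
    have hww : ε * ε ≤ r * ε := mul_le_mul_of_nonneg_right (hε1.trans hr1) hε0
    have h2 : |w ^ 2 * ⟪N₁ i, N₁ j⟫| ≤ r * ε * (D * D) := by
      rw [abs_mul, abs_pow, sq]
      exact mul_le_mul ((mul_le_mul hw hw (abs_nonneg _) hε0).trans hww) (hnn i j)
        (abs_nonneg _) (by positivity)
    have h3 : |w₁ i * w₁ j| ≤ r * ε := by
      rw [abs_mul]
      exact (mul_le_mul (hw₁ i) (hw₁ j) (abs_nonneg _) hε0).trans hww
    have h4 : D' * ε / r * r ^ 2 = r * ε * D' := by field_simp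
    rw [h4]
    refine (abs_add_three _ _ _).trans ((add_le_add (add_le_add h1 h2) h3).trans ?_)
    have h5 : r * ε * (D + D) + r * ε * (D * D) + r * ε = r * ε * (D + D + D * D + 1) := by ring
    rw [h5]
    refine mul_le_mul_of_nonneg_left ?_ (by positivity)
    linarith [mul_nonneg hm0 (sq_nonneg D)]
  · have h1 : |T i + p * ⟪N₁ i, V⟫| ≤ 2 * ε / r + |p| * (m * (2 * ε / r * D)) := by
      refine (abs_add_le _ _).trans (add_le_add (hT i) ?_)
      rw [abs_mul]; gcongr; exact hnT i
    have h2 : 2 * ε / r + |p| * (m * (2 * ε / r * D)) = (2 + |p| * (2 * (m * D))) * (ε / r) := by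
      ring
    rw [h2] at h1
    refine h1.trans ?_
    rw [mul_div_assoc]
    refine mul_le_mul_of_nonneg_right ?_ (by positivity)
    have h3 : |p| * (2 * (m * D)) ≤ |p| * D' := by
      gcongr; linarith [mul_nonneg hm0 (sq_nonneg D)]
    linarith [mul_nonneg hm0 (sq_nonneg D)]
  · have := abs_real_inner_le_norm (θ₂ i j) N
    rw [hF.norm_normal, mul_one] at this
    refine this.trans ((hF.norm_second_le i j).trans ?_)
    linarith [mul_nonneg hm0 (sq_nonneg D)]
  · exact hF.trace_second
  · have h1 : |r * ∑ k, T k * ⟪θ₂ i j, θ₁ k⟫| ≤ 2 * (m * D) * ε := by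
      have h2 : |∑ k, T k * ⟪θ₂ i j, θ₁ k⟫| ≤ m * (2 * ε / r * D) := by
        refine abs_sum_mul_le hT fun k => ?_
        have := abs_real_inner_le_norm (θ₂ i j) (θ₁ k)
        rw [hF.norm_tangent, mul_one] at this
        exact this.trans (hF.norm_second_le i j)
      rw [abs_mul, abs_of_pos hr0]
      refine (mul_le_mul_of_nonneg_left h2 hr0.le).trans (le_of_eq ?_)
      field_simp
    have h3 : ∀ i j, |w₁ i * ⟪N₁ j, V⟫| ≤ 2 * (m * D) * ε := fun i j => by
      rw [abs_mul]
      refine (mul_le_mul (hw₁ i) (hnT j) (abs_nonneg _) hε0).trans ?_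
      have h4 : ε * (m * (2 * ε / r * D)) = 2 * (m * D) * (ε * (ε / r)) := by ring
      rw [h4]
      have h5 : ε * (ε / r) ≤ 1 * ε := mul_le_mul hε1 hεr (by positivity) zero_le_one
      rw [one_mul] at h5
      gcongr
    have h4 : |w * ⟪N₂ i j, V⟫| ≤ (D * (1 + |p|) + 2 * (m * D)) * ε := by
      rw [abs_mul]
      have h5 : |⟪N₂ i j, V⟫| ≤ D * (1 + |p| + 2 * m) :=
        (abs_real_inner_le_norm _ _).trans (mul_le_mul (hF.norm_shape_deriv_le i j) hVnorm
          (norm_nonneg _) (by linarith))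
      refine (mul_le_mul hw h5 (abs_nonneg _) hε0).trans (le_of_eq (by ring))
    have h6 := hw₂ i j
    have h7 : |r * ∑ k, T k * ⟪θ₂ i j, θ₁ k⟫ + w₁ i * ⟪N₁ j, V⟫ + w * ⟪N₂ i j, V⟫ + w₂ i j +
        w₁ j * ⟪N₁ i, V⟫| ≤ 2 * (m * D) * ε + 2 * (m * D) * ε + (D * (1 + |p|) + 2 * (m * D)) * ε +
          (1 + m * D) * ε + 2 * (m * D) * ε :=
      (abs_add_le _ _).trans (add_le_add ((abs_add_le _ _).trans (add_le_add
        ((abs_add_three _ _ _).trans (add_le_add (add_le_add h1 (h3 i j)) h4)) h6)) (h3 j i))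
    refine h7.trans ?_
    have h8 : 2 * (m * D) * ε + 2 * (m * D) * ε + (D * (1 + |p|) + 2 * (m * D)) * ε +
          (1 + m * D) * ε + 2 * (m * D) * ε = (D * (1 + |p|) + 9 * (m * D) + 1) * ε := by ring
    rw [h8, mul_right_comm]
    refine mul_le_mul_of_nonneg_right ?_ hε0
    have h9 : D' ≤ D' * (1 + |p|) := le_mul_of_one_le_right (by linarith) (by linarith)
    have h10 : D * (1 + |p|) + 9 * (m * D) + 1 ≤ (D + 9 * (m * D) + 1) * (1 + |p|) := by
      have : 0 ≤ (9 * (m * D) + 1) * |p| := by positivity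
      linarith
    refine h10.trans ?_
    gcongr
    linarith [mul_nonneg hm0 (sq_nonneg D)]
  · rw [Matrix.of_apply, hX0]
    simp only [inner_add_left, inner_add_right, inner_smul_left, inner_smul_right, hθθ, hNN, hNθ,
      hF.inner_pos_normal, conj_trivial]
    ring
  · rw [Matrix.of_apply, hX0, hX1]
    simp only [inner_add_left, inner_add_right, inner_smul_left, inner_smul_right, hθi, hNi, hθn,
      hNn, hNN, hF.inner_pos_normal, conj_trivial]
    ring
  · rw [Matrix.of_apply, hX0, hX1]
    simp only [inner_add_left, inner_add_right, inner_smul_left, inner_smul_right,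
      hF.inner_tangent_pos, hF.inner_tangent_normal, hF.inner_shape_pos, hF.inner_shape_normal,
      hNN, hNθ, conj_trivial]
    ring
  · rw [Matrix.of_apply, hX1, hX1]
    simp only [inner_add_left, inner_add_right, inner_smul_left, inner_smul_right, hNi, hNn,
      hF.inner_tangent_normal, hF.inner_shape_normal, hF.inner_tangent, hNN, conj_trivial]
    rw [real_inner_comm (N₁ j) (θ₁ i)]
    field_simp
    ring
  · rw [Matrix.of_apply, hX00, inner_smul_left, hNV]; simp
  · rw [Matrix.of_apply, hX01]
    simp only [inner_add_left, inner_smul_left, hθT, hNV, conj_trivial]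
    ring
  · rw [Matrix.of_apply, hX10]
    simp only [inner_add_left, inner_smul_left, hθT, hNV, conj_trivial]
    ring
  · rw [Matrix.of_apply, hX11]
    simp only [inner_add_left, inner_smul_left, hNV, conj_trivial]
    rw [hTV (θ₂ i j), hF.inner_second_pos, Matrix.of_apply]
    ring

end IsAdaptedFrame

/-! ### Partial derivatives in polar coordinates -/

section Calculus

variable {m : ℕ} {F : Type*} [NormedAddCommGroup F] [NormedSpace ℝ F]

/-- The angular part `(v₁, …, vₘ)` of the polar coordinates `(v₀, v₁, …, vₘ)`. -/
def angularPart (m : ℕ) : Euc (m + 1) →L[ℝ] Euc m :=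
  LinearMap.toContinuousLinearMap
    { toFun := fun v => WithLp.toLp 2 fun i => v i.succ
      map_add' := fun _ _ => rfl
      map_smul' := fun _ _ => rfl }

/-- The inclusion of the angular coordinates into the polar coordinates. -/
def angularInclusion (m : ℕ) : Euc m →L[ℝ] Euc (m + 1) :=
  LinearMap.toContinuousLinearMap
    { toFun := fun u => WithLp.toLp 2 (Fin.cons 0 fun i => u i)
      map_add' := fun u v => by
        ext i; refine Fin.cases ?_ (fun j => ?_) i <;> simp
      map_smul' := fun c u => by
        ext i; refine Fin.cases ?_ (fun j => ?_) i <;> simp }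

/-- The point with polar coordinates `(r, u)`. -/
def polarPoint (r : ℝ) (u : Euc m) : Euc (m + 1) :=
  r • EuclideanSpace.single 0 1 + angularInclusion m u

@[simp] lemma angularPart_apply (v : Euc (m + 1)) (i : Fin m) : angularPart m v i = v i.succ := rfl

@[simp] lemma angularInclusion_zero_apply (u : Euc m) : angularInclusion m u 0 = 0 := rfl

@[simp] lemma angularInclusion_succ_apply (u : Euc m) (i : Fin m) :
    angularInclusion m u i.succ = u i := rfl

@[simp] lemma angularPart_single_zero (a : ℝ) :
    angularPart m (EuclideanSpace.single 0 a) = 0 := by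
  ext i; simp [Fin.succ_ne_zero]

@[simp] lemma angularPart_single_succ (i : Fin m) (a : ℝ) :
    angularPart m (EuclideanSpace.single i.succ a) = EuclideanSpace.single i a := by
  ext j; simp

@[simp] lemma angularInclusion_single (i : Fin m) (a : ℝ) :
    angularInclusion m (EuclideanSpace.single i a) = EuclideanSpace.single i.succ a := by
  ext j
  refine Fin.cases ?_ (fun k => ?_) j
  · simp [(Fin.succ_ne_zero i).symm]
  · simp

@[simp] lemma angularPart_angularInclusion (u : Euc m) :
    angularPart m (angularInclusion m u) = u := by
  ext i; rfl

@[simp] lemma polarPoint_zero_apply (r : ℝ) (u : Euc m) : polarPoint r u 0 = r := by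
  simp [polarPoint]

@[simp] lemma angularPart_polarPoint (r : ℝ) (u : Euc m) : angularPart m (polarPoint r u) = u := by
  simp [polarPoint]

lemma polarPoint_self (v : Euc (m + 1)) : polarPoint (v 0) (angularPart m v) = v := by
  ext i
  refine Fin.cases ?_ (fun j => ?_) i
  · simp
  · simp [polarPoint, Fin.succ_ne_zero]

lemma pderiv_comp_angularPart_zero {f : Euc m → F} {v : Euc (m + 1)}
    (hf : DifferentiableAt ℝ f (angularPart m v)) :
    pderiv 0 (fun v => f (angularPart m v)) v = 0 := by
  have h : HasFDerivAt (fun v => f (angularPart m v)) _ v :=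
    hf.hasFDerivAt.comp v (angularPart m).hasFDerivAt
  rw [pderiv, h.fderiv]
  simp

lemma pderiv_comp_angularPart_succ {f : Euc m → F} {v : Euc (m + 1)}
    (hf : DifferentiableAt ℝ f (angularPart m v)) (i : Fin m) :
    pderiv i.succ (fun v => f (angularPart m v)) v = pderiv i f (angularPart m v) := by
  have h : HasFDerivAt (fun v => f (angularPart m v)) _ v :=
    hf.hasFDerivAt.comp v (angularPart m).hasFDerivAt
  rw [pderiv, h.fderiv]
  simp [pderiv]

lemma hasFDerivAt_polarPoint (r : ℝ) (u : Euc m) :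
    HasFDerivAt (fun u => polarPoint r u) (angularInclusion m) u :=
  (angularInclusion m).hasFDerivAt.const_add _

lemma pderiv_comp_polarPoint {f : Euc (m + 1) → F} {r : ℝ} {u : Euc m}
    (hf : DifferentiableAt ℝ f (polarPoint r u)) (i : Fin m) :
    pderiv i (fun u => f (polarPoint r u)) u = pderiv i.succ f (polarPoint r u) := by
  have h : HasFDerivAt (fun u => f (polarPoint r u)) _ u :=
    hf.hasFDerivAt.comp u (hasFDerivAt_polarPoint r u)
  rw [pderiv, h.fderiv]
  simp [pderiv]

lemma deriv_comp_polarPoint {f : Euc (m + 1) → F} {r : ℝ} {u : Euc m}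
    (hf : DifferentiableAt ℝ f (polarPoint r u)) :
    HasDerivAt (fun s => f (polarPoint s u)) (pderiv 0 f (polarPoint r u)) r := by
  have h1 : HasDerivAt (fun s : ℝ => polarPoint s u) (EuclideanSpace.single 0 (1 : ℝ)) r := by
    have := ((hasDerivAt_id r).smul_const
      (EuclideanSpace.single (0 : Fin (m + 1)) (1 : ℝ))).add_const
      (angularInclusion m u)
    rwa [one_smul] at this
  exact hf.hasFDerivAt.comp_hasDerivAt r h1

lemma pderiv_coord_zero (v : Euc (m + 1)) : pderiv 0 (fun v : Euc (m + 1) => v 0) v = 1 := by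
  have h : HasFDerivAt (fun v : Euc (m + 1) => v 0) (EuclideanSpace.proj (𝕜 := ℝ) 0) v :=
    (EuclideanSpace.proj (𝕜 := ℝ) (0 : Fin (m + 1))).hasFDerivAt
  rw [pderiv, h.fderiv]; simp

lemma pderiv_coord_succ (v : Euc (m + 1)) (i : Fin m) :
    pderiv i.succ (fun v : Euc (m + 1) => v 0) v = 0 := by
  have h : HasFDerivAt (fun v : Euc (m + 1) => v 0) (EuclideanSpace.proj (𝕜 := ℝ) 0) v :=
    (EuclideanSpace.proj (𝕜 := ℝ) (0 : Fin (m + 1))).hasFDerivAt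
  rw [pderiv, h.fderiv]; simp [(Fin.succ_ne_zero i).symm]

lemma pderiv_smul {k : ℕ} {f : Euc k → ℝ} {g : Euc k → F} {v : Euc k}
    (hf : DifferentiableAt ℝ f v) (hg : DifferentiableAt ℝ g v) (i : Fin k) :
    pderiv i (f • g) v = f v • pderiv i g v + pderiv i f v • g v := by
  have h : HasFDerivAt (f • g) _ v := hf.hasFDerivAt.smul hg.hasFDerivAt
  rw [pderiv, h.fderiv]; simp [pderiv]

lemma pderiv_add {k : ℕ} {f g : Euc k → F} {v : Euc k}
    (hf : DifferentiableAt ℝ f v) (hg : DifferentiableAt ℝ g v) (i : Fin k) :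
    pderiv i (f + g) v = pderiv i f v + pderiv i g v := by
  have h : HasFDerivAt (f + g) _ v := hf.hasFDerivAt.add hg.hasFDerivAt
  rw [pderiv, h.fderiv]; simp [pderiv]

lemma Filter.EventuallyEq.pderiv_eq {k : ℕ} {f g : Euc k → F} {v : Euc k} (h : f =ᶠ[𝓝 v] g)
    (i : Fin k) : pderiv i f v = pderiv i g v := by
  rw [pderiv, pderiv, h.fderiv_eq]

lemma ContDiffAt.pderiv {k : ℕ} {f : Euc k → F} {v : Euc k} (hf : ContDiffAt ℝ ∞ f v) (i : Fin k) :
    ContDiffAt ℝ ∞ (pderiv i f) v :=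
  (hf.fderiv_right (m := ∞) (by simp)).clm_apply contDiffAt_const

lemma ContDiffAt.eventually_differentiableAt {k : ℕ} {f : Euc k → F} {v : Euc k}
    (hf : ContDiffAt ℝ ∞ f v) : ∀ᶠ x in 𝓝 v, DifferentiableAt ℝ f x := by
  filter_upwards [(hf.of_le (m := 1) (by norm_cast)).eventually (by simp)] with x hx
  exact hx.differentiableAt (by simp)

lemma pderiv_comm {k : ℕ} {f : Euc k → F} {v : Euc k} (hf : ContDiffAt ℝ ∞ f v) (i j : Fin k) :
    pderiv i (pderiv j f) v = pderiv j (pderiv i f) v := by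
  have h1 : DifferentiableAt ℝ (fderiv ℝ f) v :=
    (hf.fderiv_right (m := 1) (by norm_cast)).differentiableAt (by simp)
  have h2 : ∀ i j, pderiv i (pderiv j f) v =
      fderiv ℝ (fderiv ℝ f) v (EuclideanSpace.single i (1 : ℝ)) (EuclideanSpace.single j (1 : ℝ)) :=
    fun i j => by
      have : pderiv i (pderiv j f) v =
        fderiv ℝ (fun u => fderiv ℝ f u (EuclideanSpace.single j (1 : ℝ))) v
          (EuclideanSpace.single i (1 : ℝ)) := rfl
      rw [this, fderiv_clm_apply h1 (differentiableAt_const _)]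
      simp
  have h3 : IsSymmSndFDerivAt ℝ f v := hf.isSymmSndFDerivAt (by simp; norm_cast)
  rw [h2, h2]
  exact h3 _ _

/-- Leibniz rule for a constant inner product. -/
lemma inner_pderiv_add_eq_zero {k l : ℕ} {f g : Euc k → Euc l} {v : Euc k} {c : ℝ}
    (hf : DifferentiableAt ℝ f v) (hg : DifferentiableAt ℝ g v)
    (h : ∀ᶠ x in 𝓝 v, ⟪f x, g x⟫ = c) (i : Fin k) :
    ⟪pderiv i f v, g v⟫ + ⟪f v, pderiv i g v⟫ = 0 := by
  have h2 := hf.hasFDerivAt.inner ℝ hg.hasFDerivAt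
  have h4 := h2.unique ((hasFDerivAt_const c v).congr_of_eventuallyEq h)
  have h5 := congrArg (fun A => A (EuclideanSpace.single i (1 : ℝ))) h4
  simp only [ContinuousLinearMap.comp_apply, ContinuousLinearMap.prod_apply,
    fderivInnerCLM_apply, zero_apply] at h5
  rw [add_comm]
  exact h5

/-- The graph `(r, u) ↦ r θ (u) + W (r, u) N (u)` in polar coordinates. -/
def graphMap {k : ℕ} (θ N : Euc m → Euc k) (W : Euc (m + 1) → ℝ) (v : Euc (m + 1)) : Euc k :=
  v 0 • θ (angularPart m v) + W v • N (angularPart m v)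

section Graph

variable {k : ℕ} {θ N : Euc m → Euc k} {W : Euc (m + 1) → ℝ} {v : Euc (m + 1)}

lemma contDiffAt_graphMap (hθ : ContDiffAt ℝ ∞ θ (angularPart m v))
    (hN : ContDiffAt ℝ ∞ N (angularPart m v)) (hW : ContDiffAt ℝ ∞ W v) :
    ContDiffAt ℝ ∞ (graphMap θ N W) v := by
  have h0 : ContDiffAt ℝ ∞ (fun v : Euc (m + 1) => v 0) v := by fun_prop
  have h1 : ContDiffAt ℝ ∞ (fun v => θ (angularPart m v)) v :=
    hθ.comp v (angularPart m).contDiff.contDiffAt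
  have h2 : ContDiffAt ℝ ∞ (fun v => N (angularPart m v)) v :=
    hN.comp v (angularPart m).contDiff.contDiffAt
  exact (h0.smul h1).add (hW.smul h2)

lemma differentiableAt_coord (v : Euc (m + 1)) :
    DifferentiableAt ℝ (fun v : Euc (m + 1) => v 0) v := by fun_prop

lemma differentiableAt_comp_angularPart {f : Euc m → F}
    (hf : DifferentiableAt ℝ f (angularPart m v)) :
    DifferentiableAt ℝ (fun v => f (angularPart m v)) v :=
  hf.comp v (angularPart m).differentiableAt

lemma pderiv_zero_graphMap (hθ : DifferentiableAt ℝ θ (angularPart m v))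
    (hN : DifferentiableAt ℝ N (angularPart m v)) (hW : DifferentiableAt ℝ W v) :
    pderiv 0 (graphMap θ N W) v = θ (angularPart m v) + pderiv 0 W v • N (angularPart m v) := by
  have h1 := differentiableAt_comp_angularPart hθ
  have h2 := differentiableAt_comp_angularPart hN
  have h3 : pderiv 0 (graphMap θ N W) v = _ :=
    pderiv_add ((differentiableAt_coord v).smul h1) (hW.smul h2) 0
  rw [h3, pderiv_smul (differentiableAt_coord v) h1, pderiv_smul hW h2,
    pderiv_comp_angularPart_zero hθ, pderiv_comp_angularPart_zero hN, pderiv_coord_zero]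
  simp

lemma pderiv_succ_graphMap (hθ : DifferentiableAt ℝ θ (angularPart m v))
    (hN : DifferentiableAt ℝ N (angularPart m v)) (hW : DifferentiableAt ℝ W v) (i : Fin m) :
    pderiv i.succ (graphMap θ N W) v = v 0 • pderiv i θ (angularPart m v) +
      W v • pderiv i N (angularPart m v) + pderiv i.succ W v • N (angularPart m v) := by
  have h1 := differentiableAt_comp_angularPart hθ
  have h2 := differentiableAt_comp_angularPart hN
  have h3 : pderiv i.succ (graphMap θ N W) v = _ :=
    pderiv_add ((differentiableAt_coord v).smul h1) (hW.smul h2) i.succ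
  rw [h3, pderiv_smul (differentiableAt_coord v) h1, pderiv_smul hW h2,
    pderiv_comp_angularPart_succ hθ, pderiv_comp_angularPart_succ hN, pderiv_coord_succ]
  simp [add_assoc]

lemma eventually_differentiableAt_graph (hθ : ContDiffAt ℝ ∞ θ (angularPart m v))
    (hN : ContDiffAt ℝ ∞ N (angularPart m v)) (hW : ContDiffAt ℝ ∞ W v) :
    ∀ᶠ x in 𝓝 v, DifferentiableAt ℝ θ (angularPart m x) ∧
      DifferentiableAt ℝ N (angularPart m x) ∧ DifferentiableAt ℝ W x := by
  have hc : Tendsto (angularPart m) (𝓝 v) (𝓝 (angularPart m v)) :=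
    (angularPart m).continuous.tendsto v
  exact (hc.eventually hθ.eventually_differentiableAt).and
    ((hc.eventually hN.eventually_differentiableAt).and hW.eventually_differentiableAt)

lemma pderiv_zero_zero_graphMap (hθ : ContDiffAt ℝ ∞ θ (angularPart m v))
    (hN : ContDiffAt ℝ ∞ N (angularPart m v)) (hW : ContDiffAt ℝ ∞ W v) :
    pderiv 0 (pderiv 0 (graphMap θ N W)) v = pderiv 0 (pderiv 0 W) v • N (angularPart m v) := by
  have h : pderiv 0 (graphMap θ N W) =ᶠ[𝓝 v]
      fun x => θ (angularPart m x) + pderiv 0 W x • N (angularPart m x) := by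
    filter_upwards [eventually_differentiableAt_graph hθ hN hW] with x hx
    exact pderiv_zero_graphMap hx.1 hx.2.1 hx.2.2
  have dθ := hθ.differentiableAt (by simp)
  have dN := hN.differentiableAt (by simp)
  have h1 := differentiableAt_comp_angularPart dθ
  have h2 := differentiableAt_comp_angularPart dN
  have hW0 : DifferentiableAt ℝ (pderiv 0 W) v := (hW.pderiv 0).differentiableAt (by simp)
  refine (h.pderiv_eq _).trans ((pderiv_add h1 (hW0.smul h2) _).trans ?_)
  rw [pderiv_smul hW0 h2,
    pderiv_comp_angularPart_zero dθ, pderiv_comp_angularPart_zero dN]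
  simp

lemma pderiv_succ_zero_graphMap (hθ : ContDiffAt ℝ ∞ θ (angularPart m v))
    (hN : ContDiffAt ℝ ∞ N (angularPart m v)) (hW : ContDiffAt ℝ ∞ W v) (i : Fin m) :
    pderiv i.succ (pderiv 0 (graphMap θ N W)) v = pderiv i θ (angularPart m v) +
      pderiv 0 W v • pderiv i N (angularPart m v) +
        pderiv i.succ (pderiv 0 W) v • N (angularPart m v) := by
  have h : pderiv 0 (graphMap θ N W) =ᶠ[𝓝 v]
      fun x => θ (angularPart m x) + pderiv 0 W x • N (angularPart m x) := by
    filter_upwards [eventually_differentiableAt_graph hθ hN hW] with x hx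
    exact pderiv_zero_graphMap hx.1 hx.2.1 hx.2.2
  have dθ := hθ.differentiableAt (by simp)
  have dN := hN.differentiableAt (by simp)
  have h1 := differentiableAt_comp_angularPart dθ
  have h2 := differentiableAt_comp_angularPart dN
  have hW0 : DifferentiableAt ℝ (pderiv 0 W) v := (hW.pderiv 0).differentiableAt (by simp)
  refine (h.pderiv_eq _).trans ((pderiv_add h1 (hW0.smul h2) _).trans ?_)
  rw [pderiv_smul hW0 h2,
    pderiv_comp_angularPart_succ dθ, pderiv_comp_angularPart_succ dN, add_assoc]

lemma pderiv_zero_succ_graphMap (hθ : ContDiffAt ℝ ∞ θ (angularPart m v))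
    (hN : ContDiffAt ℝ ∞ N (angularPart m v)) (hW : ContDiffAt ℝ ∞ W v) (i : Fin m) :
    pderiv 0 (pderiv i.succ (graphMap θ N W)) v = pderiv i θ (angularPart m v) +
      pderiv 0 W v • pderiv i N (angularPart m v) +
        pderiv i.succ (pderiv 0 W) v • N (angularPart m v) := by
  rw [pderiv_comm (contDiffAt_graphMap hθ hN hW), pderiv_succ_zero_graphMap hθ hN hW]

lemma pderiv_succ_succ_graphMap (hθ : ContDiffAt ℝ ∞ θ (angularPart m v))
    (hN : ContDiffAt ℝ ∞ N (angularPart m v)) (hW : ContDiffAt ℝ ∞ W v) (i j : Fin m) :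
    pderiv i.succ (pderiv j.succ (graphMap θ N W)) v =
      v 0 • pderiv i (pderiv j θ) (angularPart m v) +
        pderiv i.succ W v • pderiv j N (angularPart m v) +
        W v • pderiv i (pderiv j N) (angularPart m v) +
        pderiv i.succ (pderiv j.succ W) v • N (angularPart m v) +
        pderiv j.succ W v • pderiv i N (angularPart m v) := by
  have h : pderiv j.succ (graphMap θ N W) =ᶠ[𝓝 v] fun x => (x 0 • pderiv j θ (angularPart m x) +
      W x • pderiv j N (angularPart m x)) + pderiv j.succ W x • N (angularPart m x) := by
    filter_upwards [eventually_differentiableAt_graph hθ hN hW] with x hx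
    exact pderiv_succ_graphMap hx.1 hx.2.1 hx.2.2 j
  have dθ : DifferentiableAt ℝ (pderiv j θ) (angularPart m v) :=
    (hθ.pderiv j).differentiableAt (by simp)
  have dN : DifferentiableAt ℝ (pderiv j N) (angularPart m v) :=
    (hN.pderiv j).differentiableAt (by simp)
  have dN0 := hN.differentiableAt (by simp)
  have dW := hW.differentiableAt (by simp)
  have h1 := differentiableAt_comp_angularPart dθ
  have h2 := differentiableAt_comp_angularPart dN
  have h3 := differentiableAt_comp_angularPart dN0
  have hWj : DifferentiableAt ℝ (pderiv j.succ W) v := (hW.pderiv _).differentiableAt (by simp)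
  have h4 := differentiableAt_coord v
  refine (h.pderiv_eq _).trans
    ((pderiv_add ((h4.smul h1).add (dW.smul h2)) (hWj.smul h3) _).trans ?_)
  rw [pderiv_add (h4.smul h1) (dW.smul h2), pderiv_smul h4 h1, pderiv_smul dW h2,
    pderiv_smul hWj h3, pderiv_coord_succ, pderiv_comp_angularPart_succ dθ,
    pderiv_comp_angularPart_succ dN, pderiv_comp_angularPart_succ dN0]
  module

end Graph

end Calculus

/-! ### Ends that are minimal graphs over a cone -/

/-- If the position, normal and their derivatives form an adapted frame, the coordinate vectors of
the graph are linearly independent. -/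
lemma IsAdaptedFrame.eq_zero_of_sum_eq_zero {m : ℕ} {D : ℝ} {θ N : Euc (m + 2)}
    {θ₁ N₁ : Fin m → Euc (m + 2)} {θ₂ N₂ : Fin m → Fin m → Euc (m + 2)}
    (hF : IsAdaptedFrame D θ N θ₁ N₁ θ₂ N₂) {r w p : ℝ} {w₁ : Fin m → ℝ} (hr0 : 0 < r)
    (hrD : 2 * m * D ≤ r) (hw : |w| ≤ 1) {c₀ : ℝ} {c : Fin m → ℝ}
    (h : c₀ • (θ + p • N) + ∑ i, c i • (r • θ₁ i + w • N₁ i + w₁ i • N) = 0) :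
    c₀ = 0 ∧ ∀ i, c i = 0 := by
  have hNθ : ⟪N, θ⟫ = 0 := by rw [real_inner_comm]; exact hF.inner_pos_normal
  have hθθ : ⟪θ, θ⟫ = 1 := by rw [real_inner_self_eq_norm_sq, hF.norm_pos]; norm_num
  have h0 : c₀ = 0 := by
    have h1 := congrArg (fun z => ⟪z, θ⟫) h
    simp only [inner_add_left, inner_smul_left, sum_inner, hNθ, hθθ, hF.inner_tangent_pos,
      hF.inner_shape_pos, inner_zero_left, conj_trivial] at h1
    simpa using h1
  refine ⟨h0, ?_⟩
  have hθi : ∀ i, ⟪θ, θ₁ i⟫ = 0 := fun i => by rw [real_inner_comm]; exact hF.inner_tangent_pos i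
  have hNi : ∀ i, ⟪N, θ₁ i⟫ = 0 := fun i => by rw [real_inner_comm]; exact hF.inner_tangent_normal i
  have hj : ∀ j, r * c j = -(w * ∑ i, c i * ⟪N₁ i, θ₁ j⟫) := fun j => by
    have h1 := congrArg (fun z => ⟪z, θ₁ j⟫) h
    simp only [inner_add_left, inner_smul_left, sum_inner, hNi, hθi, hF.inner_tangent,
      inner_zero_left, conj_trivial, h0] at h1
    have h2 : ∑ i, c i * (r * (1 : Matrix (Fin m) (Fin m) ℝ) i j + w * ⟪N₁ i, θ₁ j⟫ + w₁ i * 0) =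
        r * c j + w * ∑ i, c i * ⟪N₁ i, θ₁ j⟫ := by
      simp only [mul_zero, add_zero, mul_add, Finset.sum_add_distrib, Finset.mul_sum,
        Matrix.one_apply]
      congr 1
      · simp [mul_comm]
      · exact Finset.sum_congr rfl fun i _ => by ring
    rw [h2] at h1
    linarith
  set t : ℝ := ‖c‖
  have ht : ∀ i, |c i| ≤ t := fun i => norm_le_pi_norm c i
  have ht0 : 0 ≤ t := norm_nonneg _
  have hb : ∀ j, |c j| ≤ t / 2 := fun j => by
    have h2 : |∑ i, c i * ⟪N₁ i, θ₁ j⟫| ≤ m * (t * D) := by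
      refine abs_sum_mul_le ht fun k => ?_
      have := abs_real_inner_le_norm (N₁ k) (θ₁ j)
      rw [hF.norm_tangent, mul_one] at this
      exact this.trans (hF.norm_shape_le k)
    have h3 : r * |c j| = |r * c j| := by rw [abs_mul, abs_of_pos hr0]
    have h4 : r * |c j| ≤ 1 * (m * (t * D)) := by
      rw [h3, hj, abs_neg, abs_mul]
      exact mul_le_mul hw h2 (abs_nonneg _) zero_le_one
    have h5 := mul_le_mul_of_nonneg_right hrD ht0
    have h6 : r * |c j| ≤ r * (t / 2) := by linarith
    exact le_of_mul_le_mul_left h6 hr0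
  have h7 : t ≤ t / 2 := (pi_norm_le_iff_of_nonneg (by positivity)).2 hb
  intro i
  exact abs_eq_zero.1 (le_antisymm ((ht i).trans (by linarith)) (abs_nonneg _))

/-- Outside a compact set, `M` is the graph of `w` over the cone with smooth compact link `Γ` and
normal `n`; both `M` and the cone are minimal, and `w (r, ·) → 0` in `C²(Γ)`. -/
structure IsMinimalGraphEnd (m : ℕ) (M Γ : Set (Euc (m + 2))) (n ν : Euc (m + 2) → Euc (m + 2))
    (w : ℝ → Euc (m + 2) → ℝ) (R : ℝ) : Prop where
  isCompact : IsCompact Γ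
  subset_sphere : Γ ⊆ Metric.sphere 0 1
  isEmbedded : IsEmbeddedSubmanifold m Γ
  isUnitNormal : IsUnitNormal m Γ n
  inner_pos_normal : ∀ θ ∈ Γ, ⟪θ, n θ⟫ = 0
  link_minimal : HasZeroMeanCurvature m Γ n
  isUnitNormal_end : IsUnitNormal (m + 1) M ν
  end_minimal : HasZeroMeanCurvature (m + 1) M ν
  smooth : ∀ P : Patch m Γ,
    ContDiffOn ℝ ∞ (fun p : ℝ × Euc m => w p.1 (P.map p.2)) (Ioi R ×ˢ P.dom)
  tendsto_c2Norm : Tendsto (fun r => c2Norm m Γ (w r)) atTop (𝓝 0)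
  graph_subset : normalGraph Γ n w R ⊆ M

namespace IsMinimalGraphEnd

variable {m : ℕ} {M Γ : Set (Euc (m + 2))} {n ν : Euc (m + 2) → Euc (m + 2)}
  {w : ℝ → Euc (m + 2) → ℝ} {R : ℝ}

/-- The function `w` in the polar coordinates given by a patch of the link. -/
def coordExpr (w : ℝ → Euc (m + 2) → ℝ) (P : Patch m Γ) (v : Euc (m + 1)) : ℝ :=
  w (v 0) (P.map (angularPart m v))

lemma contDiffAt_coordExpr (h : IsMinimalGraphEnd m M Γ n ν w R) (P : Patch m Γ)
    {v : Euc (m + 1)} (hr : R < v 0) (hv : angularPart m v ∈ P.dom) :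
    ContDiffAt ℝ ∞ (coordExpr w P) v := by
  have h1 : ContDiffAt ℝ ∞ (fun p : ℝ × Euc m => w p.1 (P.map p.2)) (v 0, angularPart m v) :=
    (h.smooth P).contDiffAt ((isOpen_Ioi.prod P.isOpen_dom).mem_nhds ⟨hr, hv⟩)
  have h2 : ContDiffAt ℝ ∞ (fun v : Euc (m + 1) => (v 0, angularPart m v)) v := by fun_prop
  exact h1.comp v h2

lemma contDiffAt_normal (h : IsMinimalGraphEnd m M Γ n ν w R) (P : Patch m Γ) {u : Euc m}
    (hu : u ∈ P.dom) : ContDiffAt ℝ ∞ (n ∘ P.map) u :=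
  (P.contDiffOn_normal h.subset_sphere h.isUnitNormal h.inner_pos_normal).contDiffAt
    (P.isOpen_dom.mem_nhds hu)

/-- A patch as in `HasAdaptedPatch` provides an adapted frame. -/
lemma isAdaptedFrame (h : IsMinimalGraphEnd m M Γ n ν w R) {P : Patch m Γ} {D : ℝ}
    (h0 : (0 : Euc m) ∈ P.dom)
    (hg : ∀ i j, ⟪pderiv i P.map 0, pderiv j P.map 0⟫ = (1 : Matrix (Fin m) (Fin m) ℝ) i j)
    (h1 : ∀ i j, ‖pderiv i (pderiv j P.map) 0‖ ≤ D) (h2 : ∀ i, ‖pderiv i (n ∘ P.map) 0‖ ≤ D)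
    (h3 : ∀ i j, ‖pderiv i (pderiv j (n ∘ P.map)) 0‖ ≤ D) :
    IsAdaptedFrame D (P.map 0) (n (P.map 0)) (fun i => pderiv i P.map 0)
      (fun i => pderiv i (n ∘ P.map) 0) (fun i j => pderiv i (pderiv j P.map) 0)
      (fun i j => pderiv i (pderiv j (n ∘ P.map)) 0) := by
  have hmem := P.mapsTo h0
  have hdom := P.isOpen_dom.mem_nhds h0
  have dP := P.differentiableAt h0
  have dN : DifferentiableAt ℝ (n ∘ P.map) 0 :=
    (h.contDiffAt_normal P h0).differentiableAt (by simp)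
  have dP1 : ∀ i, DifferentiableAt ℝ (pderiv i P.map) 0 := fun i =>
    ((P.contDiffAt h0).pderiv i).differentiableAt (by simp)
  have htan : ∀ u ∈ P.dom, ∀ i, ⟪pderiv i P.map u, P.map u⟫ = 0 := fun u hu i =>
    P.inner_fderiv_self h.subset_sphere hu _
  refine ⟨mem_sphere_zero_iff_norm.1 (h.subset_sphere hmem), h.isUnitNormal.2.1 _ hmem,
    h.inner_pos_normal _ hmem, fun i => htan 0 h0 i, fun i => h.isUnitNormal.2.2 P 0 h0 _, hg,
    fun i => ?_, fun i => ?_, fun i j => ?_, ?_, h1, h2, h3⟩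
  · have := inner_pderiv_add_eq_zero (f := n ∘ P.map) (g := P.map) (c := 0) dN dP (by
      filter_upwards [hdom] with u hu
      rw [real_inner_comm]; exact h.inner_pos_normal _ (P.mapsTo hu)) i
    have h4 : ⟪(n ∘ P.map) 0, pderiv i P.map 0⟫ = 0 := by
      rw [real_inner_comm]; exact h.isUnitNormal.2.2 P 0 h0 _
    rw [h4, add_zero] at this
    exact this
  · have := inner_pderiv_add_eq_zero (f := n ∘ P.map) (g := n ∘ P.map) (c := 1) dN dN (by
      filter_upwards [hdom] with u hu
      rw [real_inner_self_eq_norm_sq, Function.comp_apply, h.isUnitNormal.2.1 _ (P.mapsTo hu)]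
      norm_num) i
    rw [real_inner_comm, ← two_mul] at this
    have h5 := (mul_eq_zero.1 this).resolve_left two_ne_zero
    rw [real_inner_comm]; exact h5
  · have := inner_pderiv_add_eq_zero (f := pderiv j P.map) (g := P.map) (c := 0) (dP1 j) dP (by
      filter_upwards [hdom] with u hu using htan u hu j) i
    have h4 := hg j i
    have h6 : (1 : Matrix (Fin m) (Fin m) ℝ) j i = (1 : Matrix (Fin m) (Fin m) ℝ) i j := by
      simp [Matrix.one_apply, eq_comm]
    rw [h4, h6] at this
    linarith
  · have hH := h.link_minimal P 0 h0
    have hmet : P.metric 0 = 1 := by ext i j; exact hg i j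
    rw [Patch.meanCurvature, hmet, inv_one, Matrix.one_mul] at hH
    exact hH

/-- In adapted coordinates the `C²` norm on the link controls the partial derivatives. -/
lemma coordExpr_bounds (h : IsMinimalGraphEnd m M Γ n ν w R) {P : Patch m Γ} {D ε r : ℝ}
    (h0 : (0 : Euc m) ∈ P.dom)
    (hg : ∀ i j, ⟪pderiv i P.map 0, pderiv j P.map 0⟫ = (1 : Matrix (Fin m) (Fin m) ℝ) i j)
    (h1 : ∀ i j, ‖pderiv i (pderiv j P.map) 0‖ ≤ D) (hr : R < r) (hε : 0 ≤ ε)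
    (hc : c2Norm m Γ (w r) ≤ ENNReal.ofReal ε) :
    |w r (P.map 0)| ≤ ε ∧ (∀ i : Fin m, |pderiv i.succ (coordExpr w P) (polarPoint r 0)| ≤ ε) ∧
      ∀ i j : Fin m, |pderiv i.succ (pderiv j.succ (coordExpr w P)) (polarPoint r 0)| ≤
        (1 + m * D) * ε := by
  have hmet : P.metric 0 = 1 := by ext i j; exact hg i j
  set W := coordExpr w P
  have hW : ∀ u ∈ P.dom, ContDiffAt ℝ ∞ W (polarPoint r u) := fun u hu =>
    h.contDiffAt_coordExpr P (by simpa using hr) (by simpa using hu)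
  have hf : w r ∘ P.map = fun u => W (polarPoint r u) := by
    ext u; simp [W, coordExpr]
  have hp1 : ∀ u ∈ P.dom, ∀ i, pderiv i (w r ∘ P.map) u = pderiv i.succ W (polarPoint r u) :=
    fun u hu i => by
      rw [hf]; exact pderiv_comp_polarPoint ((hW u hu).differentiableAt (by simp)) i
  have hp2 : ∀ i j, pderiv i (pderiv j (w r ∘ P.map)) 0 =
      pderiv i.succ (pderiv j.succ W) (polarPoint r 0) := fun i j => by
    have hev : pderiv j (w r ∘ P.map) =ᶠ[𝓝 0] fun u => pderiv j.succ W (polarPoint r u) := by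
      filter_upwards [P.isOpen_dom.mem_nhds h0] with u hu using hp1 u hu j
    rw [hev.pderiv_eq]
    exact pderiv_comp_polarPoint (((hW 0 h0).pderiv _).differentiableAt (by simp)) i
  have hsum : |(w r) (P.map 0)| + P.gradNorm (w r ∘ P.map) 0 + P.hessNorm (w r ∘ P.map) 0 ≤ ε := by
    rw [← ENNReal.ofReal_le_ofReal_iff hε]
    refine le_trans ?_ hc
    exact le_iSup_of_le P (le_iSup_of_le 0 (le_iSup_of_le h0 le_rfl))
  have hgn : 0 ≤ P.gradNorm (w r ∘ P.map) 0 := Real.sqrt_nonneg _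
  have hhn : 0 ≤ P.hessNorm (w r ∘ P.map) 0 := Real.sqrt_nonneg _
  have habs := abs_nonneg (w r (P.map 0))
  have hgrad : ∀ i, |pderiv i (w r ∘ P.map) 0| ≤ ε := fun i => by
    have h2 : P.gradNorm (w r ∘ P.map) 0 = √(∑ i, pderiv i (w r ∘ P.map) 0 ^ 2) := by
      rw [Patch.gradNorm, hmet, inv_one]
      congr 1
      refine Finset.sum_congr rfl fun i _ => ?_
      simp [Matrix.one_apply, sq]
    refine le_trans ?_ (show P.gradNorm (w r ∘ P.map) 0 ≤ ε by linarith)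
    rw [h2, ← Real.sqrt_sq_eq_abs]
    exact Real.sqrt_le_sqrt (Finset.single_le_sum (f := fun i => pderiv i (w r ∘ P.map) 0 ^ 2)
      (fun i _ => sq_nonneg _) (Finset.mem_univ i))
  have hcomm : ∀ i j, pderiv i (pderiv j (w r ∘ P.map)) 0 = pderiv j (pderiv i (w r ∘ P.map)) 0 :=
    fun i j => by rw [hp2, hp2, pderiv_comm (hW 0 h0)]
  have hcommP : ∀ i j, pderiv i (pderiv j P.map) 0 = pderiv j (pderiv i P.map) 0 := fun i j =>
    pderiv_comm (P.contDiffAt h0) i j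
  set H := P.hessian (w r ∘ P.map) 0 with hH
  have hHs : ∀ i j, H i j = H j i := fun i j => by
    simp only [hH, Patch.hessian, Matrix.of_apply]
    rw [hcomm i j, hcommP i j]
  have hHb : ∀ i j, |H i j| ≤ ε := fun i j => by
    have h2 : P.hessNorm (w r ∘ P.map) 0 = √(∑ i, ∑ j, H i j ^ 2) := by
      rw [Patch.hessNorm, hmet, inv_one, Matrix.one_mul, Matrix.mul_one, ← hH, Matrix.trace]
      congr 1
      refine Finset.sum_congr rfl fun i _ => ?_
      rw [Matrix.diag_apply, Matrix.mul_apply]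
      exact Finset.sum_congr rfl fun j _ => by rw [hHs j i]; ring
    refine le_trans ?_ (show P.hessNorm (w r ∘ P.map) 0 ≤ ε by linarith)
    rw [h2, ← Real.sqrt_sq_eq_abs]
    refine Real.sqrt_le_sqrt ?_
    exact (Finset.single_le_sum (f := fun j => H i j ^ 2)
      (fun i _ => sq_nonneg _) (Finset.mem_univ j)).trans
        (Finset.single_le_sum (f := fun i => ∑ j, H i j ^ 2)
          (fun i _ => Finset.sum_nonneg fun j _ => sq_nonneg _) (Finset.mem_univ i))
  refine ⟨by linarith, fun i => by rw [← hp1 0 h0]; exact hgrad i, fun i j => ?_⟩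
  rw [← hp2]
  have h3 : pderiv i (pderiv j (w r ∘ P.map)) 0 = H i j +
      ∑ k, ⟪pderiv i (pderiv j P.map) 0, pderiv k P.map 0⟫ * pderiv k (w r ∘ P.map) 0 := by
    simp only [hH, Patch.hessian, Matrix.of_apply, hmet, inv_one, Matrix.one_apply]
    simp
  have h4 : |∑ k, ⟪pderiv i (pderiv j P.map) 0, pderiv k P.map 0⟫ * pderiv k (w r ∘ P.map) 0| ≤
      m * (D * ε) := by
    refine abs_sum_mul_le (fun k => ?_) hgrad
    have h5 : ‖pderiv k P.map 0‖ = 1 := by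
      have h6 := hg k k
      rw [real_inner_self_eq_norm_sq, Matrix.one_apply_eq] at h6
      exact (pow_eq_one_iff_of_nonneg (norm_nonneg _) two_ne_zero).1 h6
    have := abs_real_inner_le_norm (pderiv i (pderiv j P.map) 0) (pderiv k P.map 0)
    rw [h5, mul_one] at this
    exact this.trans (h1 i j)
  rw [h3]
  refine (abs_add_le _ _).trans ((add_le_add (hHb i j) h4).trans (le_of_eq (by ring)))

/-- The polar coordinates of the graph form a patch of `M` around the points where they are
immersive. -/
lemma exists_graph_patch (h : IsMinimalGraphEnd m M Γ n ν w R) (P : Patch m Γ) {v : Euc (m + 1)}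
    (hr : R < v 0) (hv : angularPart m v ∈ P.dom)
    (hinj : Function.Injective (fderiv ℝ (graphMap P.map (n ∘ P.map) (coordExpr w P)) v)) :
    ∃ Q : Patch (m + 1) M, v ∈ Q.dom ∧ Q.map = graphMap P.map (n ∘ P.map) (coordExpr w P) := by
  set X := graphMap P.map (n ∘ P.map) (coordExpr w P)
  let U : Set (Euc (m + 1)) := {v | R < v 0} ∩ angularPart m ⁻¹' P.dom
  have hU : IsOpen U := (isOpen_lt continuous_const (by fun_prop)).inter
    (P.isOpen_dom.preimage (angularPart m).continuous)
  have hX : ∀ v ∈ U, ContDiffAt ℝ ∞ X v := fun v hv =>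
    contDiffAt_graphMap (P.contDiffAt hv.2) (h.contDiffAt_normal P hv.2)
      (h.contDiffAt_coordExpr P hv.1 hv.2)
  have hcont : ContinuousOn (fderiv ℝ X) U := fun v hv =>
    ((hX v hv).fderiv_right (m := ∞) (by simp)).continuousAt.continuousWithinAt
  have hopen : IsOpen (U ∩ fderiv ℝ X ⁻¹' {L | Function.Injective L}) :=
    hcont.isOpen_inter_preimage hU ContinuousLinearMap.isOpen_injective
  refine ⟨⟨_, X, hopen, fun v hv => (hX v hv.1).contDiffWithinAt, fun v hv => hv.2,
    fun v hv => h.graph_subset ?_⟩, ⟨⟨hr, hv⟩, hinj⟩, rfl⟩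
  exact ⟨P.map (angularPart m v), P.mapsTo hv.1.2, v 0, hv.1.1, rfl⟩

lemma fderiv_apply_eq_sum {k : ℕ} {F : Type*} [NormedAddCommGroup F] [NormedSpace ℝ F]
    (f : Euc (k + 1) → F) (v z : Euc (k + 1)) :
    fderiv ℝ f v z = z 0 • pderiv 0 f v + ∑ i : Fin k, z i.succ • pderiv i.succ f v := by
  have hz : z = ∑ i, z i • EuclideanSpace.single i (1 : ℝ) := by
    ext j
    simp [Finset.sum_apply, Pi.single_apply]
  rw [← Fin.sum_univ_succ (f := fun i => z i • pderiv i f v)]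
  nth_rw 1 [hz]
  rw [map_sum]
  simp only [map_smul]
  rfl

/-- Around each point of the cone far from the vertex there are adapted coordinates in which the
graph is a patch of `M`. -/
lemma exists_patches (h : IsMinimalGraphEnd m M Γ n ν w R) :
    ∃ D r₀ : ℝ, 1 ≤ D ∧ 1 ≤ r₀ ∧ R < r₀ ∧ 2 * m * D ≤ r₀ ∧ ∀ θ ∈ Γ, ∃ P : Patch m Γ,
      (0 : Euc m) ∈ P.dom ∧ P.map 0 = θ ∧
      IsAdaptedFrame D θ (n θ) (fun i => pderiv i P.map 0)
        (fun i => pderiv i (n ∘ P.map) 0) (fun i j => pderiv i (pderiv j P.map) 0)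
        (fun i j => pderiv i (pderiv j (n ∘ P.map)) 0) ∧
      ∀ r ε : ℝ, r₀ ≤ r → 0 ≤ ε → ε ≤ 1 → c2Norm m Γ (w r) ≤ ENNReal.ofReal ε →
        |w r θ| ≤ ε ∧ (∀ i : Fin m, |pderiv i.succ (coordExpr w P) (polarPoint r 0)| ≤ ε) ∧
        (∀ i j : Fin m, |pderiv i.succ (pderiv j.succ (coordExpr w P)) (polarPoint r 0)| ≤
          (1 + m * D) * ε) ∧
        ∃ Q : Patch (m + 1) M, polarPoint r 0 ∈ Q.dom ∧
          Q.map = graphMap P.map (n ∘ P.map) (coordExpr w P) := by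
  obtain ⟨D, hD, hDP⟩ := exists_hasAdaptedPatch h.isCompact h.subset_sphere h.isEmbedded
    h.isUnitNormal h.inner_pos_normal
  refine ⟨D, max (max 1 (R + 1)) (2 * m * D), hD, (le_max_left _ _).trans (le_max_left _ _),
    (lt_add_one R).trans_le ((le_max_right _ _).trans (le_max_left _ _)), le_max_right _ _,
    fun θ hθ => ?_⟩
  obtain ⟨P, h0, rfl, hg, h1, h2, h3⟩ := hDP θ hθ
  have hF := h.isAdaptedFrame h0 hg h1 h2 h3
  refine ⟨P, h0, rfl, hF, fun r ε hr hε hε1 hc => ?_⟩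
  have hr1 : 1 ≤ r := ((le_max_left _ _).trans (le_max_left _ _)).trans hr
  have hrR : R < r := (lt_add_one R).trans_le
    (((le_max_right _ _).trans (le_max_left _ _)).trans hr)
  have hrD : 2 * m * D ≤ r := (le_max_right _ _).trans hr
  obtain ⟨hb0, hb1, hb2⟩ := h.coordExpr_bounds h0 hg h1 hrR hε hc
  refine ⟨hb0, hb1, hb2, h.exists_graph_patch P (by simpa using hrR) (by simpa using h0) ?_⟩
  rw [injective_iff_map_eq_zero]
  intro z hz
  have hv0 : angularPart m (polarPoint r 0) = 0 := angularPart_polarPoint r 0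
  have dP : DifferentiableAt ℝ P.map (angularPart m (polarPoint r 0)) := by
    rw [hv0]; exact P.differentiableAt h0
  have dN : DifferentiableAt ℝ (n ∘ P.map) (angularPart m (polarPoint r 0)) := by
    rw [hv0]; exact (h.contDiffAt_normal P h0).differentiableAt (by simp)
  have dW : DifferentiableAt ℝ (coordExpr w P) (polarPoint r 0) :=
    (h.contDiffAt_coordExpr P (by simpa using hrR) (by simpa using h0)).differentiableAt (by simp)
  rw [fderiv_apply_eq_sum, pderiv_zero_graphMap dP dN dW] at hz
  simp only [pderiv_succ_graphMap dP dN dW, hv0, polarPoint_zero_apply] at hz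
  have hw : coordExpr w P (polarPoint r 0) = w r (P.map 0) := by simp [coordExpr]
  rw [hw] at hz
  obtain ⟨hz0, hz1⟩ := hF.eq_zero_of_sum_eq_zero (by linarith) hrD
    (hb0.trans hε1) hz
  ext i
  refine Fin.cases ?_ (fun j => ?_) i
  · exact hz0
  · exact hz1 j

/-- The radial derivative `∂ᵣw`. -/
def radialDeriv (w : ℝ → Euc (m + 2) → ℝ) (r : ℝ) (θ : Euc (m + 2)) : ℝ :=
  deriv (fun s => w s θ) r

lemma pderiv_zero_coordExpr (h : IsMinimalGraphEnd m M Γ n ν w R) (P : Patch m Γ) {r : ℝ}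
    {u : Euc m} (hr : R < r) (hu : u ∈ P.dom) :
    pderiv 0 (coordExpr w P) (polarPoint r u) = radialDeriv w r (P.map u) := by
  have hd : DifferentiableAt ℝ (coordExpr w P) (polarPoint r u) :=
    (h.contDiffAt_coordExpr P (by simpa using hr) (by simpa using hu)).differentiableAt (by simp)
  have h1 := (deriv_comp_polarPoint hd).deriv
  rw [← h1, radialDeriv]
  simp [coordExpr]

/-- The radial second derivative of `w` at points where the angular gradients of `∂ᵣw` and `w` are
parallel, by minimality of `M`. -/
lemma exists_pderiv_zero_zero_bound (h : IsMinimalGraphEnd m M Γ n ν w R) :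
    ∃ C r₀ : ℝ, 0 < C ∧ 1 ≤ r₀ ∧ R < r₀ ∧ ∀ θ ∈ Γ, ∃ P : Patch m Γ, (0 : Euc m) ∈ P.dom ∧
      P.map 0 = θ ∧ ∀ r ε τ : ℝ, r₀ ≤ r → 0 ≤ ε → ε ≤ 1 →
        c2Norm m Γ (w r) ≤ ENNReal.ofReal ε →
        (∀ i : Fin m, pderiv i.succ (pderiv 0 (coordExpr w P)) (polarPoint r 0) =
          τ * pderiv i.succ (coordExpr w P) (polarPoint r 0)) →
        |r ^ 2 * pderiv 0 (pderiv 0 (coordExpr w P)) (polarPoint r 0)| ≤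
          C * ((1 + radialDeriv w r θ ^ 2) * (ε + r * |radialDeriv w r θ|) +
            |radialDeriv w r θ| * |τ| * ε ^ 2) := by
  obtain ⟨D, r₁, hD, hr₁, hRr₁, hmD, hP⟩ := h.exists_patches
  obtain ⟨C, r₂, hC, hr₂, hbound⟩ := IsAdaptedFrame.exists_radial_hessian_bound m D hD
  refine ⟨C, max r₁ r₂, hC, hr₁.trans (le_max_left _ _), hRr₁.trans_le (le_max_left _ _),
    fun θ hθ => ?_⟩
  obtain ⟨P, h0, rfl, hF, hPr⟩ := hP θ hθ
  refine ⟨P, h0, rfl, fun r ε τ hr hε hε1 hc hτ => ?_⟩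
  have hrr₁ : r₁ ≤ r := (le_max_left _ _).trans hr
  have hrR : R < r := hRr₁.trans_le hrr₁
  obtain ⟨hb0, hb1, hb2, Q, hQ, hQmap⟩ := hPr r ε hrr₁ hε hε1 hc
  have hv0 : angularPart m (polarPoint r 0) = 0 := angularPart_polarPoint r 0
  have sP : ContDiffAt ℝ ∞ P.map (angularPart m (polarPoint r 0)) := by
    rw [hv0]; exact P.contDiffAt h0
  have sN : ContDiffAt ℝ ∞ (n ∘ P.map) (angularPart m (polarPoint r 0)) := by
    rw [hv0]; exact h.contDiffAt_normal P h0
  have sW : ContDiffAt ℝ ∞ (coordExpr w P) (polarPoint r 0) :=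
    h.contDiffAt_coordExpr P (by simpa using hrR) (by simpa using h0)
  have dP := sP.differentiableAt (by simp)
  have dN := sN.differentiableAt (by simp)
  have dW := sW.differentiableAt (by simp)
  have hw : coordExpr w P (polarPoint r 0) = w r (P.map 0) := by simp [coordExpr]
  have hp := h.pderiv_zero_coordExpr P hrR h0
  have hmean := h.end_minimal Q _ hQ
  refine hbound hF r (w r (P.map 0)) (radialDeriv w r (P.map 0)) _ τ ε
    (fun i => pderiv i.succ (coordExpr w P) (polarPoint r 0))
    (fun i j => pderiv i.succ (pderiv j.succ (coordExpr w P)) (polarPoint r 0))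
    (ν (Q.map (polarPoint r 0))) (fun a => pderiv a Q.map (polarPoint r 0))
    (fun a b => pderiv a (pderiv b Q.map) (polarPoint r 0)) ((le_max_right _ _).trans hr) hε1 hb0
    hb1 hb2 (h.isUnitNormal_end.2.1 _ (Q.mapsTo hQ)) (fun a => h.isUnitNormal_end.2.2 Q _ hQ _)
    ?_ (fun i => ?_) ?_ (fun i => ?_) (fun i => ?_) (fun i j => ?_) hmean
  · simp only [hQmap]; rw [pderiv_zero_graphMap dP dN dW, hv0, hp]; rfl
  · simp only [hQmap]; rw [pderiv_succ_graphMap dP dN dW, hv0, hw, polarPoint_zero_apply]; rfl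
  · simp only [hQmap]; rw [pderiv_zero_zero_graphMap sP sN sW, hv0]; rfl
  · simp only [hQmap]; rw [pderiv_zero_succ_graphMap sP sN sW, hv0, hp, hτ]; rfl
  · simp only [hQmap]; rw [pderiv_succ_zero_graphMap sP sN sW, hv0, hp, hτ]; rfl
  · simp only [hQmap]
    rw [pderiv_succ_succ_graphMap sP sN sW, hv0, hw, polarPoint_zero_apply]; rfl

/-- The unit normal of `M` at the point of the graph over `r θ`. -/
lemma exists_normal_eq (h : IsMinimalGraphEnd m M Γ n ν w R) :
    ∃ r₀ : ℝ, 1 ≤ r₀ ∧ R < r₀ ∧ ∀ θ ∈ Γ, ∀ r ε : ℝ, r₀ ≤ r → 0 ≤ ε → ε ≤ 1 →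
      c2Norm m Γ (w r) ≤ ENNReal.ofReal ε → |w r θ| ≤ ε ∧
      ∃ (a : ℝ) (t : Euc (m + 2)), a ≠ 0 ∧ ‖t‖ ≤ 2 * m * ε / r ∧ ⟪θ, t⟫ = 0 ∧ ⟪n θ, t⟫ = 0 ∧
        ν (r • θ + w r θ • n θ) = a • (n θ - radialDeriv w r θ • θ + t) := by
  obtain ⟨D, r₁, hD, hr₁, hRr₁, hmD, hP⟩ := h.exists_patches
  refine ⟨r₁, hr₁, hRr₁, fun θ hθ r ε hr hε hε1 hc => ?_⟩
  obtain ⟨P, h0, rfl, hF, hPr⟩ := hP θ hθ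
  have hrR : R < r := hRr₁.trans_le hr
  obtain ⟨hb0, hb1, hb2, Q, hQ, hQmap⟩ := hPr r ε hr hε hε1 hc
  refine ⟨hb0, ?_⟩
  have hv0 : angularPart m (polarPoint r 0) = 0 := angularPart_polarPoint r 0
  have dP : DifferentiableAt ℝ P.map (angularPart m (polarPoint r 0)) := by
    rw [hv0]; exact P.differentiableAt h0
  have dN : DifferentiableAt ℝ (n ∘ P.map) (angularPart m (polarPoint r 0)) := by
    rw [hv0]; exact (h.contDiffAt_normal P h0).differentiableAt (by simp)
  have dW : DifferentiableAt ℝ (coordExpr w P) (polarPoint r 0) :=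
    (h.contDiffAt_coordExpr P (by simpa using hrR) (by simpa using h0)).differentiableAt (by simp)
  have hw : coordExpr w P (polarPoint r 0) = w r (P.map 0) := by simp [coordExpr]
  have hp := h.pderiv_zero_coordExpr P hrR h0
  have hQv : Q.map (polarPoint r 0) = r • P.map 0 + w r (P.map 0) • n (P.map 0) := by
    rw [hQmap, graphMap, hv0, hw, polarPoint_zero_apply]; rfl
  have horth : ∀ a, ⟪pderiv a Q.map (polarPoint r 0), ν (Q.map (polarPoint r 0))⟫ = 0 := fun a =>
    h.isUnitNormal_end.2.2 Q _ hQ _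
  obtain ⟨a, T, -, ha, hT, hν⟩ := hF.exists_normal_eq (r := r) (w := w r (P.map 0))
    (p := radialDeriv w r (P.map 0)) (ε := ε)
    (w₁ := fun i => pderiv i.succ (coordExpr w P) (polarPoint r 0))
    (ν := ν (Q.map (polarPoint r 0))) (hr₁.trans hr) (hmD.trans hr) hD hε1 hb0 hb1
    (h.isUnitNormal_end.2.1 _ (Q.mapsTo hQ))
    (by
      have := horth 0
      rw [hQmap, pderiv_zero_graphMap dP dN dW, hv0, hp, ← hQmap] at this
      exact this)
    (fun i => by
      have := horth i.succ
      rw [hQmap, pderiv_succ_graphMap dP dN dW, hv0, hw, polarPoint_zero_apply, ← hQmap] at this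
      exact this)
  rw [hQv] at hν
  refine ⟨a, _, ha, (hF.norm_tangential_le hT).trans (le_of_eq (by ring)), ?_, ?_, hν⟩
  · rw [inner_sum]
    refine Finset.sum_eq_zero fun i _ => ?_
    rw [inner_smul_right, real_inner_comm, hF.inner_tangent_pos, mul_zero]
  · rw [inner_sum]
    refine Finset.sum_eq_zero fun i _ => ?_
    rw [inner_smul_right, real_inner_comm, hF.inner_tangent_normal, mul_zero]

end IsMinimalGraphEnd

/-! ### Decay of the radial derivative -/

namespace IsMinimalGraphEnd

variable {m : ℕ} {M Γ : Set (Euc (m + 2))} {n ν : Euc (m + 2) → Euc (m + 2)}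
  {w : ℝ → Euc (m + 2) → ℝ} {R : ℝ}

/-- A function on the cone that is continuous in the polar coordinates of every patch is
continuous. -/
lemma continuousOn_of_coord (hemb : IsEmbeddedSubmanifold m Γ) {f : ℝ → Euc (m + 2) → ℝ}
    (hf : ∀ P : Patch m Γ, ∃ g : Euc (m + 1) → ℝ, ∀ r, R < r → ∀ u ∈ P.dom,
      ContinuousAt g (polarPoint r u) ∧ g (polarPoint r u) = f r (P.map u)) :
    ContinuousOn (fun q : ℝ × Euc (m + 2) => f q.1 q.2) (Ioi R ×ˢ Γ) := by
  rintro ⟨r, θ⟩ ⟨hr, hθ⟩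
  obtain ⟨P, V, Q, hV, hyV, himg, hQ, hleft⟩ := hemb θ hθ
  obtain ⟨g, hg⟩ := hf P
  have hQdom : ∀ z ∈ Γ ∩ V, Q z ∈ P.dom ∧ P.map (Q z) = z := fun z hz => by
    obtain ⟨x, hx, rfl⟩ : z ∈ P.map '' P.dom := himg ▸ hz
    rw [hleft hx]; exact ⟨hx, rfl⟩
  have hnhds : 𝓝[Ioi R ×ˢ (Γ ∩ V)] (r, θ) = 𝓝[Ioi R ×ˢ Γ] (r, θ) := by
    rw [nhdsWithin_prod_eq, nhdsWithin_prod_eq,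
      nhdsWithin_inter_of_mem' (mem_nhdsWithin_of_mem_nhds (hV.mem_nhds hyV))]
  rw [ContinuousWithinAt, ← hnhds]
  change ContinuousWithinAt _ _ _
  have h1 : ContinuousWithinAt (fun q : ℝ × Euc (m + 2) => polarPoint q.1 (Q q.2))
      (Ioi R ×ˢ (Γ ∩ V)) (r, θ) := by
    have h2 : ContinuousWithinAt (fun q : ℝ × Euc (m + 2) => Q q.2)
        (Ioi R ×ˢ (Γ ∩ V)) (r, θ) :=
      ContinuousWithinAt.comp (g := Q) (f := Prod.snd) (t := Γ ∩ V) (hQ θ ⟨hθ, hyV⟩)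
        continuousWithinAt_snd fun q hq => hq.2
    exact (continuousWithinAt_fst.smul continuousWithinAt_const).add
      ((angularInclusion m).continuous.continuousAt.comp_continuousWithinAt h2)
  have h3 := (hg r hr (Q θ) (hQdom θ ⟨hθ, hyV⟩).1).1
  have h5 : ContinuousWithinAt (fun q : ℝ × Euc (m + 2) => g (polarPoint q.1 (Q q.2)))
      (Ioi R ×ˢ (Γ ∩ V)) (r, θ) :=
    ContinuousAt.comp_continuousWithinAt (g := g) h3 h1
  have heq : ∀ q ∈ Ioi R ×ˢ (Γ ∩ V), f q.1 q.2 = g (polarPoint q.1 (Q q.2)) := fun q hq => by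
    obtain ⟨h6, h7⟩ := hQdom q.2 hq.2
    rw [(hg q.1 hq.1 (Q q.2) h6).2, h7]
  exact h5.congr heq (heq (r, θ) ⟨hr, hθ, hyV⟩)

lemma continuousOn_radialDeriv (h : IsMinimalGraphEnd m M Γ n ν w R) :
    ContinuousOn (fun q : ℝ × Euc (m + 2) => radialDeriv w q.1 q.2) (Ioi R ×ˢ Γ) :=
  continuousOn_of_coord h.isEmbedded fun P => ⟨pderiv 0 (coordExpr w P), fun r hr u hu =>
    ⟨((h.contDiffAt_coordExpr P (by simpa using hr) (by simpa using hu)).pderiv 0).continuousAt,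
      h.pderiv_zero_coordExpr P hr hu⟩⟩

lemma continuousOn_uncurry (h : IsMinimalGraphEnd m M Γ n ν w R) :
    ContinuousOn (fun q : ℝ × Euc (m + 2) => w q.1 q.2) (Ioi R ×ˢ Γ) :=
  continuousOn_of_coord h.isEmbedded fun P => ⟨coordExpr w P, fun r hr u hu =>
    ⟨(h.contDiffAt_coordExpr P (by simpa using hr) (by simpa using hu)).continuousAt,
      by simp [coordExpr]⟩⟩

lemma abs_le_of_c2Norm_le (h : IsMinimalGraphEnd m M Γ n ν w R) {r ε : ℝ} (hε : 0 ≤ ε)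
    (hc : c2Norm m Γ (w r) ≤ ENNReal.ofReal ε) {θ : Euc (m + 2)} (hθ : θ ∈ Γ) : |w r θ| ≤ ε := by
  obtain ⟨P, V, Q, hV, hyV, himg, -, -⟩ := h.isEmbedded θ hθ
  obtain ⟨u, hu, rfl⟩ : θ ∈ P.map '' P.dom := himg ▸ ⟨hθ, hyV⟩
  have h1 : |(w r) (P.map u)| + P.gradNorm (w r ∘ P.map) u + P.hessNorm (w r ∘ P.map) u ≤ ε := by
    rw [← ENNReal.ofReal_le_ofReal_iff hε]
    refine le_trans ?_ hc
    exact le_iSup_of_le P (le_iSup_of_le u (le_iSup_of_le hu le_rfl))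
  have h2 : 0 ≤ P.gradNorm (w r ∘ P.map) u := Real.sqrt_nonneg _
  have h3 : 0 ≤ P.hessNorm (w r ∘ P.map) u := Real.sqrt_nonneg _
  linarith

lemma abs_arctan_le (x : ℝ) : |Real.arctan x| ≤ |x| := by
  have h1 : LipschitzWith 1 Real.arctan := by
    refine lipschitzWith_of_nnnorm_deriv_le Real.differentiable_arctan fun x => ?_
    rw [← NNReal.coe_le_coe, coe_nnnorm, Real.deriv_arctan, Real.norm_eq_abs,
      abs_of_nonneg (by positivity), NNReal.coe_one, div_le_one (by positivity)]
    nlinarith [sq_nonneg x]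
  have := h1.dist_le_mul x 0
  simpa [Real.dist_eq] using this

lemma abs_le_two_mul_abs_arctan {x : ℝ} (hx : |Real.arctan x| ≤ 1) : |x| ≤ 2 * |Real.arctan x| := by
  set y := Real.arctan x
  have h1 : Real.tan y = x := Real.tan_arctan x
  have hcos : 1 / 2 ≤ Real.cos y := by
    have h2 := Real.one_sub_sq_div_two_le_cos (x := y)
    have h3 : y ^ 2 ≤ 1 := by
      rw [← sq_abs]; nlinarith [abs_nonneg y]
    linarith
  have hsin : |Real.sin y| ≤ |y| := Real.abs_sin_le_abs
  have h2 : |x| * Real.cos y = |Real.sin y| := by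
    rw [← h1, Real.tan_eq_sin_div_cos, abs_div, abs_of_pos (by linarith : 0 < Real.cos y),
      div_mul_cancel₀ _ (by linarith)]
  nlinarith [abs_nonneg x]

/-- First order conditions at an interior maximum of
`s (r arctan (∂ᵣw) - μ w) - κ ((r / ρ)² + ρ / r)`. -/
lemma first_order_conditions (h : IsMinimalGraphEnd m M Γ n ν w R) {P : Patch m Γ}
    (h0 : (0 : Euc m) ∈ P.dom) {r s μ κ ρ a b : ℝ} (hr0 : 0 < r) (hrR : R < r) (ha : a < r)
    (hb : r < b) (haR : R < a)
    (hmax : ∀ t ∈ Icc a b, ∀ θ ∈ Γ,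
      s * (t * Real.arctan (radialDeriv w t θ) - μ * w t θ) - κ * ((t / ρ) ^ 2 + ρ / t) ≤
      s * (r * Real.arctan (radialDeriv w r (P.map 0)) - μ * w r (P.map 0)) -
        κ * ((r / ρ) ^ 2 + ρ / r)) :
    (∀ i : Fin m, s * (r * (pderiv i.succ (pderiv 0 (coordExpr w P)) (polarPoint r 0) /
        (1 + radialDeriv w r (P.map 0) ^ 2)) -
          μ * pderiv i.succ (coordExpr w P) (polarPoint r 0)) = 0) ∧
      s * (Real.arctan (radialDeriv w r (P.map 0)) +
        r * (pderiv 0 (pderiv 0 (coordExpr w P)) (polarPoint r 0) /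
          (1 + radialDeriv w r (P.map 0) ^ 2)) - μ * radialDeriv w r (P.map 0)) =
        κ * (2 * r / ρ ^ 2 - ρ / r ^ 2) := by
  set W := coordExpr w P with hW
  set v := polarPoint r (0 : Euc m) with hv
  have hv0 : v 0 = r := polarPoint_zero_apply r 0
  have hva : angularPart m v = 0 := angularPart_polarPoint r 0
  have sW : ContDiffAt ℝ ∞ W v :=
    h.contDiffAt_coordExpr P (by rw [hv0]; exact hrR) (by rw [hva]; exact h0)
  have dW : HasFDerivAt W (fderiv ℝ W v) v := (sW.differentiableAt (by simp)).hasFDerivAt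
  have dW0 : HasFDerivAt (pderiv 0 W) (fderiv ℝ (pderiv 0 W) v) v :=
    ((sW.pderiv 0).differentiableAt (by simp)).hasFDerivAt
  have hp : pderiv 0 W v = radialDeriv w r (P.map 0) := h.pderiv_zero_coordExpr P hrR h0
  have dpr : HasFDerivAt (fun x : Euc (m + 1) => x 0) (EuclideanSpace.proj (𝕜 := ℝ) 0) v :=
    (EuclideanSpace.proj (𝕜 := ℝ) (0 : Fin (m + 1))).hasFDerivAt
  have dβ : HasDerivAt (fun t : ℝ => (t / ρ) ^ 2 + ρ / t) (2 * r / ρ ^ 2 - ρ / r ^ 2) (v 0) := by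
    rw [hv0]
    have h1 := (((hasDerivAt_id r).div_const ρ).pow 2).add ((hasDerivAt_inv hr0.ne').const_mul ρ)
    have h2 : HasDerivAt (fun t : ℝ => (t / ρ) ^ 2 + ρ / t) _ r := h1
    refine h2.congr_deriv ?_
    simp only [id]
    ring
  have dΨ := (((dpr.mul dW0.arctan).sub (dW.const_mul μ)).const_mul s).sub
    ((dβ.comp_hasFDerivAt v dpr).const_mul κ)
  have hloc : IsLocalMax (fun x : Euc (m + 1) => s * (x 0 * Real.arctan (pderiv 0 W x) - μ * W x) -
      κ * ((x 0 / ρ) ^ 2 + ρ / x 0)) v := by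
    have hopen : IsOpen ((fun x : Euc (m + 1) => x 0) ⁻¹' Ioo a b ∩ angularPart m ⁻¹' P.dom) :=
      (isOpen_Ioo.preimage (by fun_prop)).inter (P.isOpen_dom.preimage (angularPart m).continuous)
    have hmem : v ∈ (fun x : Euc (m + 1) => x 0) ⁻¹' Ioo a b ∩ angularPart m ⁻¹' P.dom :=
      ⟨by change v 0 ∈ Ioo a b; rw [hv0]; exact ⟨ha, hb⟩, by
        change angularPart m v ∈ P.dom; rw [hva]; exact h0⟩
    filter_upwards [hopen.mem_nhds hmem] with x hx
    have h1 := h.pderiv_zero_coordExpr P (haR.trans hx.1.1) hx.2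
    rw [polarPoint_self] at h1
    have h2 := hmax (x 0) ⟨hx.1.1.le, hx.1.2.le⟩ _ (P.mapsTo hx.2)
    have h3 : W v = w r (P.map 0) := by rw [hW, coordExpr, hv0, hva]
    rw [h1, hp, h3, hv0]
    exact h2
  have hzero := hloc.hasFDerivAt_eq_zero dΨ
  have hpi : ∀ j, EuclideanSpace.proj (𝕜 := ℝ) (0 : Fin (m + 1))
      (EuclideanSpace.single j (1 : ℝ)) = if 0 = j then 1 else 0 := fun j => by
    simp [PiLp.single_apply]
  refine ⟨fun i => ?_, ?_⟩
  · have h1 := congrArg (fun A => A (EuclideanSpace.single i.succ (1 : ℝ))) hzero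
    simp only [sub_apply, smul_apply, add_apply, zero_apply, smul_eq_mul, hpi,
      hv0, hp] at h1
    rw [if_neg (Fin.succ_ne_zero i).symm] at h1
    simp only [pderiv] at h1 ⊢
    rw [← h1]
    ring
  · have h1 := congrArg (fun A => A (EuclideanSpace.single (0 : Fin (m + 1)) (1 : ℝ))) hzero
    simp only [sub_apply, smul_apply, add_apply, zero_apply, smul_eq_mul, hpi,
      hv0, hp, if_true] at h1
    rw [← hp] at h1 ⊢
    simp only [pderiv] at h1 ⊢
    rw [← sub_eq_zero, ← h1]
    ring

/-- The maximum principle. The penalised function `σ (r arctan (∂ᵣw) - l w) - κ ((r / ρ)² + ρ / r)`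
attains its maximum over `r ≥ R₁`; at an interior maximum the first order conditions and minimality
bound `r |∂ᵣw|`, and evaluating the penalised function at `r = ρ` gives the estimate. -/
lemma exists_radialDeriv_estimate (h : IsMinimalGraphEnd m M Γ n ν w R) :
    ∃ C r₀ : ℝ, 0 < C ∧ 1 ≤ r₀ ∧ R < r₀ ∧ ∀ l R₁ Q ε σ : ℝ, 2 * (1 + 2 * C) ≤ l → r₀ ≤ R₁ →
      l ≤ R₁ → 0 < Q → 0 ≤ ε → ε ≤ 1 → (σ = 1 ∨ σ = -1) →
      (∀ r, R₁ ≤ r → c2Norm m Γ (w r) ≤ ENNReal.ofReal ε) →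
      (∀ θ ∈ Γ, σ * (R₁ * Real.arctan (radialDeriv w R₁ θ)) ≤ Q) →
      ∀ ρ, R₁ ≤ ρ → ∀ θ ∈ Γ, σ * (ρ * Real.arctan (radialDeriv w ρ θ)) ≤
        2 * l * ε + 2 * Q * R₁ / ρ + 2 / l * (C * ε + Q) := by
  obtain ⟨C, r₀, hC, hr₀, hRr₀, hKI⟩ := h.exists_pderiv_zero_zero_bound
  refine ⟨C, r₀, hC, hr₀, hRr₀, fun l R₁ Q ε σ hl hrR₁ hlR₁ hQ hε hε1 hσ hc hQb ρ hρ θ hθ => ?_⟩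
  have hl0 : 0 < l := by linarith
  have hR₁ : 1 ≤ R₁ := hr₀.trans hrR₁
  have hR₁0 : 0 < R₁ := by linarith
  have hρ0 : 0 < ρ := by linarith
  have hRR₁ : R < R₁ := hRr₀.trans_le hrR₁
  have hσs : ∀ x, σ * x ≤ |x| := fun x => by
    rcases hσ with rfl | rfl
    · simpa using le_abs_self x
    · simpa using neg_le_abs x
  have hσ0 : σ ≠ 0 := by rcases hσ with rfl | rfl <;> norm_num
  set κ : ℝ := Q * R₁ / ρ with hκ
  have hκ0 : 0 < κ := by positivity
  have hκρ : κ * ρ = Q * R₁ := div_mul_cancel₀ _ hρ0.ne'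
  -- at `r = T` and beyond, the quadratic penalty exceeds `r π / 2`
  set T : ℝ := ρ + 2 * ρ ^ 2 / κ with hT
  have hTρ : ρ < T := by
    have : 0 < 2 * ρ ^ 2 / κ := by positivity
    linarith
  have hT0 : 0 < T := by linarith
  set Φ : ℝ × Euc (m + 2) → ℝ := fun q =>
    σ * (q.1 * Real.arctan (radialDeriv w q.1 q.2) - l * w q.1 q.2) -
      κ * ((q.1 / ρ) ^ 2 + ρ / q.1) with hΦ
  have hsub : Icc R₁ T ×ˢ Γ ⊆ Ioi R ×ˢ Γ :=
    prod_mono (fun t ht => hRR₁.trans_le ht.1) le_rfl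
  have hcont : ContinuousOn Φ (Icc R₁ T ×ˢ Γ) := by
    have h1 := (Real.continuous_arctan.comp_continuousOn (h.continuousOn_radialDeriv.mono hsub))
    have h2 := h.continuousOn_uncurry.mono hsub
    have h3 : ContinuousOn (fun q : ℝ × Euc (m + 2) => ρ / q.1) (Icc R₁ T ×ˢ Γ) :=
      continuousOn_const.div continuousOn_fst fun q hq => (hR₁0.trans_le hq.1.1).ne'
    have h4 : ContinuousOn (fun q : ℝ × Euc (m + 2) => (q.1 / ρ) ^ 2) (Icc R₁ T ×ˢ Γ) := by fun_prop
    exact (continuousOn_const.mul ((continuousOn_fst.mul h1).sub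
      (continuousOn_const.mul h2))).sub (continuousOn_const.mul (h4.add h3))
  obtain ⟨⟨r, θ₁⟩, ⟨hr, hθ₁⟩, hmax⟩ := (isCompact_Icc.prod h.isCompact).exists_isMaxOn
    ⟨(ρ, θ), ⟨hρ, hTρ.le⟩, hθ⟩ hcont
  change r ∈ Icc R₁ T at hr
  change θ₁ ∈ Γ at hθ₁
  have hwb : ∀ t, R₁ ≤ t → ∀ θ ∈ Γ, |w t θ| ≤ ε := fun t ht θ hθ =>
    h.abs_le_of_c2Norm_le hε (hc t ht) hθ
  have hσw : ∀ t, R₁ ≤ t → ∀ θ ∈ Γ, -(l * ε) ≤ σ * (l * w t θ) ∧ σ * (l * w t θ) ≤ l * ε :=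
    fun t ht θ hθ => by
      have h1 : |σ * (l * w t θ)| ≤ l * ε := by
        have : |σ| = 1 := by rcases hσ with rfl | rfl <;> simp
        rw [abs_mul, this, one_mul, abs_mul, abs_of_pos hl0]
        exact mul_le_mul_of_nonneg_left (hwb t ht θ hθ) hl0.le
      exact abs_le.1 h1
  have hr0 : 0 < r := hR₁0.trans_le hr.1
  set p := radialDeriv w r θ₁ with hp
  have hpen : 0 ≤ κ * ((r / ρ) ^ 2 + ρ / r) := by positivity
  obtain ⟨hw1, hw2⟩ := hσw r hr.1 θ₁ hθ₁
  have hE : 0 ≤ 2 / l * (C * ε + Q) := by positivity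
  have hbound : Φ (r, θ₁) ≤ l * ε + 2 / l * (C * ε + Q) := by
    have hΦv : Φ (r, θ₁) = σ * (r * Real.arctan p) - σ * (l * w r θ₁) -
        κ * ((r / ρ) ^ 2 + ρ / r) := by simp only [hΦ]; ring
    rw [hΦv]
    rcases hr.1.eq_or_lt with hr1 | hr1
    -- at `r = R₁` the penalty `κ ρ / r = Q` compensates the boundary value
    · have h1 := hQb θ₁ hθ₁
      rw [hr1] at h1
      have h2 : κ * (ρ / r) = Q := by
        rw [← mul_div_assoc, hκρ, hr1, mul_div_cancel_right₀ _ hr0.ne']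
      have h3 : 0 ≤ κ * (r / ρ) ^ 2 := by positivity
      rw [mul_add, h2]
      linarith
    rcases hr.2.eq_or_lt with hr2 | hr2
    · have h1 : σ * (r * Real.arctan p) ≤ r * 2 := by
        refine (hσs _).trans ?_
        rw [abs_mul, abs_of_pos hr0]
        refine mul_le_mul_of_nonneg_left ?_ hr0.le
        rw [abs_le]
        have h2 := Real.neg_pi_div_two_lt_arctan p
        have h3 := Real.arctan_lt_pi_div_two p
        have h4 := Real.pi_le_four
        constructor <;> linarith
      have h5 : r * 2 ≤ κ * (r / ρ) ^ 2 := by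
        have h6 : 2 * ρ ^ 2 / κ ≤ r := by rw [hr2, hT]; linarith
        have h7 : κ * (r / ρ) ^ 2 = r * (r * (κ / ρ ^ 2)) := by field_simp
        rw [h7]
        refine mul_le_mul_of_nonneg_left ?_ hr0.le
        calc 2 = 2 * ρ ^ 2 / κ * (κ / ρ ^ 2) := by field_simp
          _ ≤ r * (κ / ρ ^ 2) := mul_le_mul_of_nonneg_right h6 (by positivity)
      have h8 : 0 ≤ κ * (ρ / r) := by positivity
      rw [mul_add]
      linarith
    -- at an interior maximum only the case `σ ∂ᵣw > 0` needs minimality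
    have hmain : σ * (r * Real.arctan p) ≤ 2 / l * (C * ε + Q) := by
      rcases le_or_gt (σ * p) 0 with hsp | hsp
      · refine le_trans ?_ hE
        have h1 : σ * Real.arctan p ≤ 0 := by
          rcases hσ with rfl | rfl
          · rw [one_mul] at hsp ⊢
            rw [← Real.arctan_zero]
            exact Real.arctan_strictMono.monotone hsp
          · have h2 : 0 ≤ p := by linarith
            have h3 := Real.arctan_strictMono.monotone h2
            rw [Real.arctan_zero] at h3
            linarith
        have h2 := mul_nonpos_of_nonneg_of_nonpos hr0.le h1
        linarith
      obtain ⟨P, h0, hPθ, hPb⟩ := hKI θ₁ hθ₁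
      have hfirst := h.first_order_conditions h0 hr0 (hRR₁.trans hr1) hr1 hr2 hRR₁ (s := σ) (μ := l)
        (κ := κ) (ρ := ρ) fun t ht θ hθ => by
          rw [hPθ]; exact hmax (show ((t, θ) : ℝ × Euc (m + 2)) ∈ Icc R₁ T ×ˢ Γ from ⟨ht, hθ⟩)
      rw [hPθ, ← hp] at hfirst
      obtain ⟨hf1, hf2⟩ := hfirst
      have hpp : 0 < 1 + p ^ 2 := by positivity
      have hKIr := hPb r ε (l * (1 + p ^ 2) / r) (hrR₁.trans hr.1) hε hε1 (hc r hr.1) fun i => by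
        have h1 := (mul_eq_zero.1 (hf1 i)).resolve_left hσ0
        field_simp at h1 ⊢
        linarith
      rw [← hp] at hKIr
      set q := pderiv 0 (pderiv 0 (coordExpr w P)) (polarPoint r 0) with hq
      have hrp : 0 ≤ r * |p| := by positivity
      have h2 : |r ^ 2 * (q / (1 + p ^ 2))| ≤ C * ε + 2 * C * (r * |p|) := by
        have h3 : |l * (1 + p ^ 2) / r| = l * (1 + p ^ 2) / r := abs_of_pos (by positivity)
        rw [h3] at hKIr
        have h4 : |r ^ 2 * (q / (1 + p ^ 2))| = |r ^ 2 * q| / (1 + p ^ 2) := by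
          rw [← mul_div_assoc, abs_div, abs_of_pos hpp]
        have h5 : |p| * (l / r) * ε ^ 2 ≤ r * |p| := by
          have h6 : l / r ≤ 1 := (div_le_one hr0).2 (hlR₁.trans hr.1)
          have h7 : ε ^ 2 ≤ 1 := pow_le_one₀ hε hε1
          have h8 : |p| * (l / r) * ε ^ 2 ≤ |p| * 1 * 1 := by gcongr
          have h9 : 1 * |p| ≤ r * |p| :=
            mul_le_mul_of_nonneg_right (hR₁.trans hr.1) (abs_nonneg p)
          linarith
        rw [h4, div_le_iff₀ hpp]
        refine hKIr.trans ?_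
        have h10 : |p| * (l * (1 + p ^ 2) / r) * ε ^ 2 =
            |p| * (l / r) * ε ^ 2 * (1 + p ^ 2) := by ring
        rw [h10]
        have h11 := mul_le_mul_of_nonneg_right h5 (mul_pos hC hpp).le
        linarith
      have hσp : σ * (r * p) = r * |p| := by
        rcases hσ with rfl | rfl
        · rw [abs_of_pos (by linarith)]; ring
        · rw [abs_of_neg (by linarith)]; ring
      have hat : σ * (r * Real.arctan p) ≤ r * |p| := by
        refine (hσs _).trans ?_
        rw [abs_mul, abs_of_pos hr0]
        exact mul_le_mul_of_nonneg_left (abs_arctan_le p) hr0.le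
      -- the radial first order condition, multiplied by `r`
      have h12 : l * (r * |p|) = σ * (r * Real.arctan p) + σ * (r ^ 2 * (q / (1 + p ^ 2))) -
          κ * (2 * (r / ρ) ^ 2) + κ * (ρ / r) := by
        rw [← hσp]
        have h13 := congrArg (fun x => r * x) hf2
        have h14 : r * (κ * (2 * r / ρ ^ 2 - ρ / r ^ 2)) =
            κ * (2 * (r / ρ) ^ 2) - κ * (ρ / r) := by
          field_simp
        simp only [h14] at h13
        linarith
      have h15 : κ * (ρ / r) ≤ Q := by
        rw [← mul_div_assoc, hκρ, div_le_iff₀ hr0]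
        exact mul_le_mul_of_nonneg_left hr.1 hQ.le
      have h16 : 0 ≤ κ * (2 * (r / ρ) ^ 2) := by positivity
      have h17 := hσs (r ^ 2 * (q / (1 + p ^ 2)))
      have h18 := mul_le_mul_of_nonneg_right hl hrp
      have h19 : l * (r * |p|) ≤ 2 * (C * ε + Q) := by linarith
      calc σ * (r * Real.arctan p) ≤ r * |p| := hat
        _ ≤ 2 * (C * ε + Q) / l := (le_div_iff₀' hl0).2 h19
        _ = 2 / l * (C * ε + Q) := by ring
    linarith
  have hρmax := hmax (show ((ρ, θ) : ℝ × Euc (m + 2)) ∈ Icc R₁ T ×ˢ Γ from ⟨⟨hρ, hTρ.le⟩, hθ⟩)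
  have hΦρ : Φ (ρ, θ) = σ * (ρ * Real.arctan (radialDeriv w ρ θ)) - σ * (l * w ρ θ) - 2 * κ := by
    simp only [hΦ, div_self hρ0.ne']; ring
  have hρw := (hσw ρ hρ θ hθ).2
  have h20 : 2 * Q * R₁ / ρ = 2 * κ := by rw [hκ]; ring
  have h21 : Φ (ρ, θ) ≤ Φ (r, θ₁) := hρmax
  rw [h20]
  linarith

/-- The `C²` norm on the link is eventually below any positive number. -/
lemma exists_c2Norm_le (h : IsMinimalGraphEnd m M Γ n ν w R) {ε : ℝ} (hε : 0 < ε) :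
    ∃ r₁, ∀ r, r₁ ≤ r → c2Norm m Γ (w r) ≤ ENNReal.ofReal ε :=
  eventually_atTop.1 (h.tendsto_c2Norm.eventually (eventually_le_nhds (ENNReal.ofReal_pos.2 hε)))

/-- `r ∂ᵣw → 0` uniformly on the link. -/
theorem tendsto_mul_radialDeriv (h : IsMinimalGraphEnd m M Γ n ν w R) {η : ℝ} (hη : 0 < η) :
    ∃ r₁, ∀ r, r₁ ≤ r → ∀ θ ∈ Γ, r * |radialDeriv w r θ| ≤ η := by
  obtain ⟨C, r₀, hC, hr₀, hRr₀, hest⟩ := h.exists_radialDeriv_estimate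
  have hsign : ∀ x y : ℝ, (∀ σ : ℝ, (σ = 1 ∨ σ = -1) → σ * x ≤ y) → |x| ≤ y := fun x y hxy =>
    abs_le'.2 ⟨by simpa using hxy 1 (Or.inl rfl), by simpa using hxy (-1) (Or.inr rfl)⟩
  have hle : ∀ σ : ℝ, (σ = 1 ∨ σ = -1) → ∀ x, σ * x ≤ |x| := fun σ hσ x => by
    rcases hσ with rfl | rfl
    · simpa using le_abs_self x
    · simpa using neg_le_abs x
  -- a first application, with crude data, bounds `r arctan (∂ᵣw)`
  obtain ⟨B, R₁, hB, hBb⟩ : ∃ B R₁ : ℝ, 0 < B ∧ ∀ r, R₁ ≤ r → ∀ θ ∈ Γ,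
      |r * Real.arctan (radialDeriv w r θ)| ≤ B := by
    obtain ⟨r₁, hr₁⟩ := h.exists_c2Norm_le one_pos
    set l := 2 * (1 + 2 * C) with hl
    have hl0 : 0 < l := by positivity
    set R₁ := max (max r₀ l) r₁
    have hR₁r₀ : r₀ ≤ R₁ := (le_max_left _ _).trans (le_max_left _ _)
    have hR₁0 : 0 < R₁ := by linarith
    refine ⟨2 * l * 1 + 2 * (R₁ * 2) * 1 + 2 / l * (C * 1 + R₁ * 2), R₁, by positivity,
      fun r hr θ hθ => hsign _ _ fun σ hσ => ?_⟩
    refine (hest l R₁ (R₁ * 2) 1 σ le_rfl hR₁r₀ ((le_max_right _ _).trans (le_max_left _ _))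
      (by positivity) zero_le_one le_rfl hσ (fun t ht => hr₁ t ((le_max_right _ _).trans ht))
      (fun θ hθ => (hle σ hσ _).trans ?_) r hr θ hθ).trans ?_
    · rw [abs_mul, abs_of_pos hR₁0]
      refine mul_le_mul_of_nonneg_left ?_ hR₁0.le
      rw [abs_le]
      have h2 := Real.neg_pi_div_two_lt_arctan (radialDeriv w R₁ θ)
      have h3 := Real.arctan_lt_pi_div_two (radialDeriv w R₁ θ)
      have h4 := Real.pi_le_four
      constructor <;> linarith
    · have h5 : R₁ / r ≤ 1 := (div_le_one (hR₁0.trans_le hr)).2 hr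
      rw [mul_div_assoc]
      gcongr
  -- a second one, with large `l`, small `ε` and `r` much larger than `R₂`, makes it small
  set δ := min η 1 / 2 with hδ
  have hδ0 : 0 < δ := by positivity
  set l := max (2 * (1 + 2 * C)) (6 * (C + B) / δ) with hl
  have hlC : 2 * (1 + 2 * C) ≤ l := le_max_left _ _
  have hl0 : 0 < l := by linarith
  have hlB : 2 / l * (C * 1 + B) ≤ δ / 3 := by
    have h1 : 6 * (C + B) / δ ≤ l := le_max_right _ _
    rw [div_le_iff₀ hδ0] at h1
    rw [div_mul_eq_mul_div, div_le_iff₀ hl0]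
    linarith
  set ε := min 1 (δ / (6 * l)) with hε
  have hε0 : 0 < ε := by positivity
  have hε1 : ε ≤ 1 := min_le_left _ _
  have hεl : 2 * l * ε ≤ δ / 3 := by
    have h1 : ε ≤ δ / (6 * l) := min_le_right _ _
    rw [le_div_iff₀ (by positivity)] at h1
    linarith
  obtain ⟨r₁, hr₁⟩ := h.exists_c2Norm_le hε0
  set R₂ := max (max r₀ l) (max r₁ R₁)
  have hR₂r₀ : r₀ ≤ R₂ := (le_max_left _ _).trans (le_max_left _ _)
  have hR₂0 : 0 < R₂ := by linarith
  refine ⟨max R₂ (6 * B * R₂ / δ), fun r hr θ hθ => ?_⟩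
  have hrR₂ : R₂ ≤ r := (le_max_left _ _).trans hr
  have hr0 : 0 < r := by linarith
  have h1 : |r * Real.arctan (radialDeriv w r θ)| ≤ δ := hsign _ _ fun σ hσ => by
    refine (hest l R₂ B ε σ hlC hR₂r₀ ((le_max_right _ _).trans (le_max_left _ _)) hB hε0.le hε1 hσ
      (fun t ht => hr₁ t (((le_max_left _ _).trans (le_max_right _ _)).trans ht))
      (fun θ hθ => (hle σ hσ _).trans
        (hBb R₂ ((le_max_right _ _).trans (le_max_right _ _)) θ hθ)) r hrR₂ θ hθ).trans ?_
    have h2 : 2 * B * R₂ / r ≤ δ / 3 := by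
      have h3 : 6 * B * R₂ / δ ≤ r := (le_max_right _ _).trans hr
      rw [div_le_iff₀ hδ0] at h3
      rw [div_le_iff₀ hr0]
      linarith
    have h4 : 2 / l * (C * ε + B) ≤ 2 / l * (C * 1 + B) := by gcongr
    linarith
  rw [abs_mul, abs_of_pos hr0] at h1
  have h2 : |Real.arctan (radialDeriv w r θ)| ≤ 1 := by
    have h3 : 1 * |Real.arctan (radialDeriv w r θ)| ≤ r * |Real.arctan (radialDeriv w r θ)| :=
      mul_le_mul_of_nonneg_right (by linarith) (abs_nonneg _)
    have h4 : min η 1 ≤ 1 := min_le_right _ _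
    linarith
  have h5 := mul_le_mul_of_nonneg_left (abs_le_two_mul_abs_arctan h2) hr0.le
  have h6 : min η 1 ≤ η := min_le_left _ _
  linarith

end IsMinimalGraphEnd

/-! ### Geometric Jacobi fields at infinity -/

section Flow

/-- If the forward flow of a linear vector field preserves `M`, the field is tangent to `M`. -/
lemma IsEmbeddedSubmanifold.inner_eq_zero_of_exp_smul_mem {k l : ℕ} {M : Set (Euc l)}
    {ν : Euc l → Euc l} (hM : IsEmbeddedSubmanifold k M) (hν : IsUnitNormal k M ν)
    {A : Euc l →L[ℝ] Euc l} (hA : ∀ t : ℝ, 0 ≤ t → ∀ y ∈ M, NormedSpace.exp (t • A) y ∈ M)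
    {y : Euc l} (hy : y ∈ M) : ⟪A y, ν y⟫ = 0 := by
  set Y : ℝ → Euc l := fun s : ℝ => NormedSpace.exp (s • A) y with hY
  have h0 : (0 : ℝ) • A = 0 := zero_smul ℝ A
  have hY0 : Y 0 = y := by
    change NormedSpace.exp ((0 : ℝ) • A) y = y
    rw [h0, NormedSpace.exp_zero]; rfl
  have hder : HasDerivAt Y (A y) 0 :=
    (hasDerivAt_exp_smul_const' A (0 : ℝ)).clm_apply (hasDerivAt_const 0 y) |>.congr_deriv (by
      rw [map_zero, add_zero, h0, NormedSpace.exp_zero, mul_one])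
  have h1 := hM.inner_sub_isLittleO hy (a := ν y) fun P u hu huy v => by
    rw [← huy]; exact hν.2.2 P u hu v
  have h2 : Tendsto Y (𝓝[Ici 0] 0) (𝓝[M] y) := by
    refine tendsto_nhdsWithin_iff.2 ⟨?_, ?_⟩
    · have := hder.continuousAt.continuousWithinAt (s := Ici (0 : ℝ)) |>.tendsto
      rwa [hY0] at this
    · filter_upwards [self_mem_nhdsWithin] with t ht using hA t ht y hy
  have h3 : (fun t => Y t - y) =O[𝓝[Ici 0] 0] fun t : ℝ => t - 0 := by
    have := (hder.hasDerivWithinAt (s := Ici (0 : ℝ))).isBigO_sub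
    rw [prod_pure, Asymptotics.isBigO_map] at this
    rw [← hY0]
    exact this
  have h4 : HasDerivWithinAt (fun t => ⟪ν y, Y t⟫) 0 (Ici 0) 0 := by
    rw [hasDerivWithinAt_iff_isLittleO]
    refine ((h1.comp_tendsto h2).trans_isBigO h3).congr_left fun t => ?_
    simp [hY0, inner_sub_right]
  have h5 : HasDerivWithinAt (fun t => ⟪ν y, Y t⟫) ⟪ν y, A y⟫ (Ici 0) 0 := by
    have := ((hasDerivAt_const (0 : ℝ) (ν y)).inner ℝ hder).hasDerivWithinAt (s := Ici (0 : ℝ))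
    simpa using this
  rw [real_inner_comm]
  exact (uniqueDiffOn_Ici (0 : ℝ) 0 self_mem_Ici).eq_deriv _ h5 h4

/-- The exponential of a skew-adjoint operator is orthogonal. -/
lemma exists_linearIsometryEquiv_exp_smul {l : ℕ} {A : Euc l →L[ℝ] Euc l}
    (hA : A ∈ skewAdjoint (Euc l →L[ℝ] Euc l)) (t : ℝ) :
    ∃ ρ : Euc l ≃ₗᵢ[ℝ] Euc l, ∀ x, ρ x = NormedSpace.exp (t • A) x := by
  let _ : NormedAlgebra ℚ (Euc l →L[ℝ] Euc l) := NormedAlgebra.restrictScalars ℚ ℝ _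
  have h1 : t • A ∈ skewAdjoint (Euc l →L[ℝ] Euc l) := skewAdjoint.smul_mem t hA
  exact ⟨Unitary.linearIsometryEquiv ⟨_, NormedSpace.exp_mem_unitary_of_mem_skewAdjoint h1⟩,
    fun x => rfl⟩

lemma toEuclideanCLM_mem_skewAdjoint {l : ℕ} {B : Matrix (Fin l) (Fin l) ℝ}
    (hB : B = -B.transpose) :
    Matrix.toEuclideanCLM (𝕜 := ℝ) B ∈ skewAdjoint (Euc l →L[ℝ] Euc l) := by
  rw [skewAdjoint.mem_iff, ← map_star, ← map_neg]
  congr 1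
  rw [Matrix.star_eq_conjTranspose, Matrix.conjTranspose_eq_transpose_of_trivial]
  nth_rw 2 [hB]
  rw [neg_neg]

lemma inner_self_eq_zero_of_mem_skewAdjoint {l : ℕ} {A : Euc l →L[ℝ] Euc l}
    (hA : A ∈ skewAdjoint (Euc l →L[ℝ] Euc l)) (x : Euc l) : ⟪A x, x⟫ = 0 := by
  have h1 := ContinuousLinearMap.adjoint_inner_left A x x
  rw [← ContinuousLinearMap.star_eq_adjoint, skewAdjoint.mem_iff.1 hA] at h1
  rw [neg_apply, inner_neg_left, real_inner_comm] at h1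
  rw [real_inner_comm]
  linarith

end Flow

lemma eventually_atInfinity {N : ℕ} {M : Set (Euc (N + 1))} {p : M → Prop} :
    (∀ᶠ y in atInfinity M, p y) ↔ ∃ t : ℝ, ∀ y : M, t ≤ ‖(y : Euc (N + 1))‖ → p y := by
  rw [atInfinity, eventually_comap, eventually_atTop]
  exact ⟨fun ⟨t, ht⟩ => ⟨t, fun y hy => ht _ hy y rfl⟩,
    fun ⟨t, ht⟩ => ⟨t, fun s hs y hy => ht y (hy ▸ hs)⟩⟩

lemma frequently_atInfinity {N : ℕ} {M : Set (Euc (N + 1))} {p : M → Prop} :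
    (∃ᶠ y in atInfinity M, p y) ↔ ∀ t : ℝ, ∃ y : M, t ≤ ‖(y : Euc (N + 1))‖ ∧ p y := by
  rw [Filter.Frequently, eventually_atInfinity]
  push Not
  rfl

lemma limsup_ofReal_eq_zero {N : ℕ} {M : Set (Euc (N + 1))} {f : M → ℝ}
    (h : Tendsto f (atInfinity M) (𝓝 0)) :
    limsup (fun y => ENNReal.ofReal (f y)) (atInfinity M) = 0 := by
  rcases (atInfinity M).eq_or_neBot with h0 | h0
  · rw [h0, limsup_bot]; rfl
  · have := ENNReal.tendsto_ofReal h
    rw [ENNReal.ofReal_zero] at this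
    exact this.limsup_eq

namespace IsMinimalGraphEnd

variable {m : ℕ} {M Γ : Set (Euc (m + 2))} {n ν : Euc (m + 2) → Euc (m + 2)}
  {w : ℝ → Euc (m + 2) → ℝ} {R : ℝ}

lemma norm_pos (h : IsMinimalGraphEnd m M Γ n ν w R) {θ : Euc (m + 2)} (hθ : θ ∈ Γ) : ‖θ‖ = 1 :=
  mem_sphere_zero_iff_norm.1 (h.subset_sphere hθ)

lemma norm_graph_sq (h : IsMinimalGraphEnd m M Γ n ν w R) {θ : Euc (m + 2)} (hθ : θ ∈ Γ)
    (r s : ℝ) : ‖r • θ + s • n θ‖ ^ 2 = r ^ 2 + s ^ 2 := by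
  rw [norm_add_sq_real, inner_smul_left, inner_smul_right, h.inner_pos_normal θ hθ, norm_smul,
    norm_smul, h.norm_pos hθ, h.isUnitNormal.2.1 θ hθ, Real.norm_eq_abs, Real.norm_eq_abs, mul_one,
    mul_one, sq_abs, sq_abs]
  simp

lemma le_norm_graph (h : IsMinimalGraphEnd m M Γ n ν w R) {θ : Euc (m + 2)} (hθ : θ ∈ Γ)
    (r s : ℝ) : r ≤ ‖r • θ + s • n θ‖ := by
  refine le_of_abs_le (abs_le_of_sq_le_sq ?_ (norm_nonneg _))
  rw [h.norm_graph_sq hθ]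
  nlinarith [sq_nonneg s]

lemma norm_graph_le (h : IsMinimalGraphEnd m M Γ n ν w R) {θ : Euc (m + 2)} (hθ : θ ∈ Γ)
    {r : ℝ} (hr : 0 ≤ r) (s : ℝ) : ‖r • θ + s • n θ‖ ≤ r + |s| := by
  refine (norm_add_le _ _).trans (le_of_eq ?_)
  rw [norm_smul, norm_smul, h.norm_pos hθ, h.isUnitNormal.2.1 θ hθ, Real.norm_eq_abs,
    Real.norm_eq_abs, mul_one, mul_one, abs_of_nonneg hr]

/-- Far out, `M` is `C¹`-close to the cone, and `y · ν(y)` is small; the latter uses the decay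
of `r ∂ᵣw`, as `y · ν(y)` is comparable to `w - r ∂ᵣw`. -/
lemma exists_normal_close (h : IsMinimalGraphEnd m M Γ n ν w R) {η : ℝ} (hη : 0 < η) :
    ∃ r₁ : ℝ, 1 ≤ r₁ ∧ R < r₁ ∧ ∀ r, r₁ ≤ r → ∀ θ ∈ Γ, |w r θ| ≤ η ∧
      |⟪r • θ + w r θ • n θ, ν (r • θ + w r θ • n θ)⟫| ≤ η ∧
      ∃ s : ℝ, |s| = 1 ∧ ‖ν (r • θ + w r θ • n θ) - s • n θ‖ ≤ η := by
  obtain ⟨r₀, hr₀, hRr₀, hν⟩ := h.exists_normal_eq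
  obtain ⟨r₂, hr₂⟩ := h.tendsto_mul_radialDeriv (η := η / 4) (by positivity)
  set ε := min (min 1 (η / 2)) (η / (8 * (m + 1))) with hε
  have hε0 : 0 < ε := by positivity
  have hε1 : ε ≤ 1 := (min_le_left _ _).trans (min_le_left _ _)
  have hεη : ε ≤ η / 2 := (min_le_left _ _).trans (min_le_right _ _)
  have hεm : 2 * m * ε ≤ η / 4 := by
    have h1 : ε ≤ η / (8 * (m + 1)) := min_le_right _ _
    rw [le_div_iff₀ (by positivity)] at h1
    linarith
  obtain ⟨r₃, hr₃⟩ := h.exists_c2Norm_le hε0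
  refine ⟨max (max r₀ r₂) r₃, hr₀.trans ((le_max_left _ _).trans (le_max_left _ _)),
    hRr₀.trans_le ((le_max_left _ _).trans (le_max_left _ _)), fun r hr θ hθ => ?_⟩
  have hrr₀ : r₀ ≤ r := ((le_max_left _ _).trans (le_max_left _ _)).trans hr
  have hr1 : 1 ≤ r := hr₀.trans hrr₀
  have hrp := hr₂ r (((le_max_right _ _).trans (le_max_left _ _)).trans hr) θ hθ
  obtain ⟨hw, a, t, ha, ht, hθt, hnt, hνa⟩ := hν θ hθ r ε hrr₀ hε0.le hε1
    (hr₃ r ((le_max_right _ _).trans hr))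
  have hmem : r • θ + w r θ • n θ ∈ M := h.graph_subset ⟨θ, hθ, r, hRr₀.trans_le hrr₀, rfl⟩
  have hν1 := h.isUnitNormal_end.2.1 _ hmem
  set y := r • θ + w r θ • n θ with hy
  set p := radialDeriv w r θ
  have hnθ := h.isUnitNormal.2.1 θ hθ
  have hnn : ⟪n θ, n θ⟫ = 1 := by rw [real_inner_self_eq_norm_sq, hnθ, one_pow]
  have hθθ : ⟪θ, θ⟫ = 1 := by rw [real_inner_self_eq_norm_sq, h.norm_pos hθ, one_pow]
  have hθn := h.inner_pos_normal θ hθ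
  have hnθ' : ⟪n θ, θ⟫ = 0 := by rw [real_inner_comm]; exact hθn
  have ha1 : |a| ≤ 1 := by
    have h1 : ⟪n θ, ν y⟫ = a := by
      rw [hνa, inner_smul_right, inner_add_right, inner_sub_right, inner_smul_right, hnn, hnθ', hnt]
      ring
    rw [← h1]
    refine (abs_real_inner_le_norm _ _).trans (le_of_eq ?_)
    rw [hnθ, hν1, mul_one]
  have hp : |p| ≤ η / 4 := by
    have := mul_le_mul_of_nonneg_right hr1 (abs_nonneg p)
    linarith
  have ht4 : ‖t‖ ≤ η / 4 := by
    refine ht.trans ((div_le_self (by positivity) hr1).trans hεm)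
  have hyν : ⟪y, ν y⟫ = a * (w r θ - r * p) := by
    rw [hνa, hy]
    simp only [inner_smul_right, inner_add_right, inner_sub_right, inner_add_left, inner_smul_left,
      hnn, hθθ, hθn, hnθ', hθt, hnt, conj_trivial]
    ring
  refine ⟨by linarith, ?_, ?_⟩
  · rw [hyν, abs_mul]
    have h1 : |w r θ - r * p| ≤ η := by
      refine (abs_sub _ _).trans ?_
      rw [abs_mul, abs_of_pos (by linarith : 0 < r)]
      linarith
    calc |a| * |w r θ - r * p| ≤ 1 * η := mul_le_mul ha1 h1 (abs_nonneg _) zero_le_one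
      _ = η := one_mul η
  · set e : Euc (m + 2) := t - p • θ with he
    have he1 : ‖e‖ ≤ η / 2 := by
      refine (norm_sub_le _ _).trans ?_
      rw [norm_smul, h.norm_pos hθ, mul_one, Real.norm_eq_abs]
      linarith
    have hνe : ν y = a • (n θ + e) := by rw [hνa, he]; congr 1; abel
    have ha2 : 1 - |a| ≤ η / 2 := by
      have h1 : 1 ≤ |a| * (1 + ‖e‖) := by
        calc (1 : ℝ) = ‖ν y‖ := hν1.symm
          _ = |a| * ‖n θ + e‖ := by rw [hνe, norm_smul, Real.norm_eq_abs]
          _ ≤ |a| * (1 + ‖e‖) := by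
            refine mul_le_mul_of_nonneg_left ((norm_add_le _ _).trans ?_) (abs_nonneg _)
            rw [hnθ]
      have h2 := mul_le_mul_of_nonneg_right ha1 (norm_nonneg e)
      linarith
    have haa : |a| ≠ 0 := abs_ne_zero.2 ha
    refine ⟨a / |a|, by rw [abs_div, abs_abs, div_self haa], ?_⟩
    have h1 : ν y - (a / |a|) • n θ = (a / |a| * (|a| - 1)) • n θ + a • e := by
      rw [hνe, mul_sub, div_mul_cancel₀ _ haa, mul_one, sub_smul, smul_add]; abel
    rw [h1]
    refine (norm_add_le _ _).trans ?_
    rw [norm_smul, norm_smul, hnθ, mul_one, Real.norm_eq_abs, Real.norm_eq_abs, abs_mul, abs_div,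
      abs_abs, div_self haa, one_mul, abs_sub_comm, abs_of_nonneg (by linarith)]
    have h2 : |a| * ‖e‖ ≤ 1 * ‖e‖ := mul_le_mul_of_nonneg_right ha1 (norm_nonneg e)
    linarith

/-- The points of `M` far from the origin lie on the graph, over points of the cone far from the
vertex. -/
lemma exists_eq_graph_of_le_norm (h : IsMinimalGraphEnd m M Γ n ν w R) (hR : 0 < R) {K : ℝ}
    (hK : ∀ r, R < r → ∀ θ ∈ Γ, |w r θ| ≤ K) (hcpt : IsCompact (M \ normalGraph Γ n w R)) (r₁ : ℝ) :
    ∃ t : ℝ, ∀ y ∈ M, t ≤ ‖y‖ → ∃ θ ∈ Γ, ∃ r, r₁ ≤ r ∧ y = r • θ + w r θ • n θ := by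
  obtain ⟨L, hL⟩ := hcpt.isBounded.exists_norm_le
  refine ⟨max (L + 1) (r₁ + K), fun y hy ht => ?_⟩
  by_cases hyg : y ∈ normalGraph Γ n w R
  · obtain ⟨θ, hθ, r, hr, rfl⟩ := hyg
    refine ⟨θ, hθ, r, ?_, rfl⟩
    have h1 := h.norm_graph_le hθ (hR.trans hr).le (w r θ)
    have h2 := hK r hr θ hθ
    have h3 := (le_max_right _ _).trans ht
    linarith
  · have h1 := hL y ⟨hy, hyg⟩
    have h2 := (le_max_left _ _).trans ht
    linarith

/-- `y · ν(y) → 0` at infinity. -/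
lemma tendsto_dilationField (h : IsMinimalGraphEnd m M Γ n ν w R) (hR : 0 < R) {K : ℝ}
    (hK : ∀ r, R < r → ∀ θ ∈ Γ, |w r θ| ≤ K) (hcpt : IsCompact (M \ normalGraph Γ n w R)) :
    Tendsto (dilationField (N := m + 1) M ν) (atInfinity (N := m + 1) M) (𝓝 0) := by
  rw [Metric.tendsto_nhds]
  intro η hη
  obtain ⟨r₁, -, -, hr₁⟩ := h.exists_normal_close (half_pos hη)
  obtain ⟨t, ht⟩ := h.exists_eq_graph_of_le_norm hR hK hcpt r₁
  refine eventually_atInfinity.2 ⟨t, fun y hy => ?_⟩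
  obtain ⟨θ, hθ, r, hr, hyr⟩ := ht y y.2 hy
  have h1 := (hr₁ r hr θ hθ).2.1
  rw [← hyr] at h1
  rw [Real.dist_eq, sub_zero]
  exact h1.trans_lt (half_lt_self hη)

/-- Translations move the cone in a normal direction somewhere, hence also `M`, far out. -/
lemma limsup_translationField_pos (h : IsMinimalGraphEnd m M Γ n ν w R) (hne : Γ.Nonempty)
    (htriv : ¬ IsTrivialCone (m + 1) Γ) {b : Euc (m + 2)} (hb : b ≠ 0) :
    0 < limsup (fun y : M => ENNReal.ofReal |translationField (N := m + 1) M ν b y|)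
      (atInfinity (N := m + 1) M) := by
  obtain ⟨θ, hθ, hbθ⟩ := exists_inner_normal_ne_zero h.isCompact h.subset_sphere h.isEmbedded
    h.isUnitNormal h.inner_pos_normal hne htriv hb
  have hb0 : 0 < ‖b‖ := norm_pos_iff.2 hb
  have hc : 0 < |⟪b, n θ⟫| := abs_pos.2 hbθ
  obtain ⟨r₁, -, hRr₁, hr₁⟩ := h.exists_normal_close
    (η := |⟪b, n θ⟫| / (2 * ‖b‖)) (by positivity)
  refine lt_of_lt_of_le (ENNReal.ofReal_pos.2 (half_pos hc))
    (le_limsup_of_frequently_le (frequently_atInfinity.2 fun t => ?_))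
  set r := max r₁ t
  have hrr₁ : r₁ ≤ r := le_max_left _ _
  refine ⟨⟨_, h.graph_subset ⟨θ, hθ, r, hRr₁.trans_le hrr₁, rfl⟩⟩,
    (le_max_right r₁ t).trans (h.le_norm_graph hθ r _), ENNReal.ofReal_le_ofReal ?_⟩
  obtain ⟨-, -, s, hs, hsn⟩ := hr₁ r hrr₁ θ hθ
  change _ ≤ |⟪b, ν (r • θ + w r θ • n θ)⟫|
  set ν₁ := ν (r • θ + w r θ • n θ)
  have h1 : |⟪b, ν₁ - s • n θ⟫| ≤ |⟪b, n θ⟫| / 2 := by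
    refine (abs_real_inner_le_norm _ _).trans ((mul_le_mul_of_nonneg_left hsn hb0.le).trans
      (le_of_eq ?_))
    field_simp
  have h2 : |s * ⟪b, n θ⟫| = |⟪b, n θ⟫| := by rw [abs_mul, hs, one_mul]
  rw [inner_sub_right, inner_smul_right] at h1
  have h3 := abs_sub_abs_le_abs_sub (s * ⟪b, n θ⟫) ⟪b, ν₁⟫
  rw [abs_sub_comm, h2] at h3
  linarith

/-- A linear vector field that is not tangent to the cone has a normal component along `M` that
grows linearly. -/
lemma hasLinearGrowth (h : IsMinimalGraphEnd m M Γ n ν w R) {A : Euc (m + 2) →L[ℝ] Euc (m + 2)}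
    {θ : Euc (m + 2)} (hθ : θ ∈ Γ) (hAθ : ⟪A θ, n θ⟫ ≠ 0) :
    HasLinearGrowth (N := m + 1) M fun y => ⟪A y, ν y⟫ := by
  have hc : 0 < |⟪A θ, n θ⟫| := abs_pos.2 hAθ
  set c := |⟪A θ, n θ⟫| with hcdef
  have hA0 : 0 ≤ ‖A‖ := norm_nonneg A
  set η := min 1 (c / (4 * (‖A‖ + 1))) with hη
  have hη0 : 0 < η := by positivity
  have hη1 : η ≤ 1 := min_le_left _ _
  have hηA : ‖A‖ * η ≤ c / 4 := by
    have h1 : η ≤ c / (4 * (‖A‖ + 1)) := min_le_right _ _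
    rw [le_div_iff₀ (by positivity)] at h1
    linarith
  obtain ⟨r₁, h1r₁, hRr₁, hr₁⟩ := h.exists_normal_close hη0
  set Y : ℝ → Euc (m + 2) := fun r => r • θ + w r θ • n θ with hY
  have hYM : ∀ r, r₁ ≤ r → Y r ∈ M := fun r hr =>
    h.graph_subset ⟨θ, hθ, r, hRr₁.trans_le hr, rfl⟩
  have hwc : ContinuousOn (fun r => w r θ) (Ici r₁) := by
    have := h.continuousOn_uncurry.comp (f := fun r : ℝ => (r, θ)) (s := Ici r₁)
      (by fun_prop) fun r hr => ⟨hRr₁.trans_le hr, hθ⟩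
    exact this
  have hYc : ContinuousOn Y (Ici r₁) :=
    (continuousOn_id.smul continuousOn_const).add (hwc.smul continuousOn_const)
  have hlow : ∀ r, r₁ ≤ r → c / 4 * ‖Y r‖ ≤ |⟪A (Y r), ν (Y r)⟫| := fun r hr => by
    obtain ⟨hw, -, s, hs, hsn⟩ := hr₁ r hr θ hθ
    have hr1 : 1 ≤ r := h1r₁.trans hr
    change ‖ν (Y r) - s • n θ‖ ≤ η at hsn
    have hν1 := h.isUnitNormal_end.2.1 _ (hYM r hr)
    set ν₁ := ν (Y r)
    have e1 : ⟪A (Y r), ν₁⟫ = r * (s * ⟪A θ, n θ⟫) + (r * ⟪A θ, ν₁ - s • n θ⟫ +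
        w r θ * ⟪A (n θ), ν₁⟫) := by
      simp only [hY, map_add, map_smul, inner_add_left, inner_smul_left, inner_sub_right,
        inner_smul_right, conj_trivial]
      ring
    have e2 : |r * (s * ⟪A θ, n θ⟫)| = r * c := by
      rw [abs_mul, abs_mul, hs, one_mul, abs_of_pos (by linarith)]
    have e3 : |⟪A θ, ν₁ - s • n θ⟫| ≤ c / 4 := by
      refine (abs_real_inner_le_norm _ _).trans (le_trans ?_ hηA)
      have := A.le_opNorm θ
      rw [h.norm_pos hθ, mul_one] at this
      exact mul_le_mul this hsn (norm_nonneg _) hA0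
    have e4 : |⟪A (n θ), ν₁⟫| ≤ ‖A‖ := by
      refine (abs_real_inner_le_norm _ _).trans ?_
      rw [hν1, mul_one]
      have := A.le_opNorm (n θ)
      rwa [h.isUnitNormal.2.1 θ hθ, mul_one] at this
    have e5 : |r * ⟪A θ, ν₁ - s • n θ⟫ + w r θ * ⟪A (n θ), ν₁⟫| ≤ r * (c / 2) := by
      refine (abs_add_le _ _).trans ?_
      rw [abs_mul, abs_mul, abs_of_pos (by linarith : 0 < r)]
      have e6 := mul_le_mul_of_nonneg_left e3 (by linarith : 0 ≤ r)
      have e7 : |w r θ| * |⟪A (n θ), ν₁⟫| ≤ η * ‖A‖ :=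
        mul_le_mul hw e4 (abs_nonneg _) hη0.le
      have e8 : c / 4 * 1 ≤ c / 4 * r := mul_le_mul_of_nonneg_left hr1 (by positivity)
      linarith
    have e9 : r * (c / 2) ≤ |⟪A (Y r), ν₁⟫| := by
      have := abs_sub_abs_le_abs_sub (r * (s * ⟪A θ, n θ⟫))
        (-(r * ⟪A θ, ν₁ - s • n θ⟫ + w r θ * ⟪A (n θ), ν₁⟫))
      rw [sub_neg_eq_add, ← e1, abs_neg, e2] at this
      linarith
    have e10 : ‖Y r‖ ≤ 2 * r := by
      have := h.norm_graph_le hθ (by linarith : 0 ≤ r) (w r θ)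
      change ‖Y r‖ ≤ _ at this
      linarith
    have := mul_le_mul_of_nonneg_left e10 (by positivity : 0 ≤ c / 4)
    linarith
  refine ⟨c / 4, ‖A‖, ‖Y r₁‖, by positivity, fun t ht => ⟨?_, fun y hy => ?_⟩⟩
  · obtain ⟨r, hr, hrt⟩ := intermediate_value_Icc (le_max_left r₁ t)
      (hYc.norm.mono Icc_subset_Ici_self)
      ⟨ht, (le_max_right r₁ t).trans (h.le_norm_graph hθ (max r₁ t) (w (max r₁ t) θ))⟩
    refine ⟨⟨Y r, hYM r hr.1⟩, hrt, ?_⟩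
    have := hlow r hr.1
    change ‖Y r‖ = t at hrt
    rwa [hrt] at this
  · refine (abs_real_inner_le_norm _ _).trans ?_
    rw [h.isUnitNormal_end.2.1 y y.2, mul_one, ← hy]
    exact A.le_opNorm _

end IsMinimalGraphEnd

section GeometricFields

variable {N : ℕ} {M : Set (Euc (N + 1))} {ν : Euc (N + 1) → Euc (N + 1)}

lemma exists_eq_of_mem_geometricFields {φ : M → ℝ} (hφ : φ ∈ geometricFields M ν) :
    ∃ (c : ℝ) (b : Euc (N + 1)) (B : Matrix (Fin (N + 1)) (Fin (N + 1)) ℝ), B = -B.transpose ∧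
      φ = c • dilationField M ν + translationField M ν b + rotationField M ν B := by
  refine Submodule.span_induction ?_ ?_ ?_ ?_ hφ
  · rintro _ ((rfl | ⟨j, rfl⟩) | ⟨B, hB, rfl⟩)
    · exact ⟨1, 0, 0, by simp, by ext y; simp [translationField, rotationField]⟩
    · exact ⟨0, EuclideanSpace.single j 1, 0, by simp, by ext y; simp [rotationField]⟩
    · exact ⟨0, 0, B, hB, by ext y; simp [translationField]⟩
  · exact ⟨0, 0, 0, by simp, by ext y; simp [translationField, rotationField]⟩
  · rintro _ _ - - ⟨c, b, B, hB, rfl⟩ ⟨c', b', B', hB', rfl⟩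
    refine ⟨c + c', b + b', B + B', ?_, ?_⟩
    · nth_rw 1 [hB, hB', Matrix.transpose_add]; abel
    · ext y
      simp only [Pi.add_apply, Pi.smul_apply, smul_eq_mul, translationField, rotationField,
        map_add, LinearMap.add_apply, inner_add_left]
      ring
  · rintro a _ - ⟨c, b, B, hB, rfl⟩
    refine ⟨a * c, a • b, a • B, ?_, ?_⟩
    · nth_rw 1 [hB]; rw [Matrix.transpose_smul, smul_neg]
    · ext y
      simp only [Pi.add_apply, Pi.smul_apply, smul_eq_mul, translationField, rotationField,
        map_smul, LinearMap.smul_apply, inner_smul_left, conj_trivial]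
      ring

lemma zero_mem_decayingFields (μ : ℝ) : (0 : M → ℝ) ∈ decayingFields M ν μ := by
  have h0 : ∀ P : Patch N M, P.pullback (0 : M → ℝ) = fun _ => 0 := fun P => by
    funext u
    simp only [Patch.pullback, Function.extend]
    split_ifs <;> rfl
  refine ⟨fun P => by rw [h0]; exact contDiffOn_const, fun P u hu => ?_, 0, fun y => by simp⟩
  rw [h0]
  simp [Patch.laplaceBeltrami, pderiv]

/-- A decay rate of a nonzero multiple of `y · ν(y)` bounds `dilationRate`. -/
lemma dilationRate_le {μ μ' c K : ℝ} (hμ : μ < 0) (hμ' : μ < μ') (hc : c ≠ 0)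
    (hK : ∀ y : M, |c * dilationField M ν y * (1 + ‖(y : Euc (N + 1))‖) ^ (-μ)| ≤ K) :
    dilationRate M ν ≤ μ' := by
  refine sInf_le ⟨μ', ?_, rfl⟩
  refine limsup_ofReal_eq_zero ?_
  have h1 : Tendsto (fun y : M => K / |c| * ‖(y : Euc (N + 1))‖ ^ (-(μ' - μ))) (atInfinity M)
      (𝓝 0) := by
    have := ((tendsto_rpow_neg_atTop (sub_pos.2 hμ')).comp
      (tendsto_comap (f := fun y : M => ‖(y : Euc (N + 1))‖))).const_mul (K / |c|)
    rwa [mul_zero] at this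
  refine squeeze_zero' (Eventually.of_forall fun y => by positivity) ?_ h1
  refine eventually_atInfinity.2 ⟨1, fun y hy => ?_⟩
  have hy0 : 0 < ‖(y : Euc (N + 1))‖ := by linarith
  have hc0 : 0 < |c| := abs_pos.2 hc
  have h2 := hK y
  have h3 : 0 < (1 + ‖(y : Euc (N + 1))‖) ^ (-μ) := by positivity
  have h4 : ‖(y : Euc (N + 1))‖ ^ (-μ) ≤ (1 + ‖(y : Euc (N + 1))‖) ^ (-μ) :=
    Real.rpow_le_rpow hy0.le (by linarith) (by linarith)
  rw [abs_mul, abs_mul, abs_of_pos h3] at h2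
  have h5 : |dilationField M ν y| * ‖(y : Euc (N + 1))‖ ^ (-μ) ≤ K / |c| := by
    rw [le_div_iff₀ hc0]
    have := mul_le_mul_of_nonneg_left h4 (mul_nonneg hc0.le (abs_nonneg (dilationField M ν y)))
    linarith
  have h6 : ‖(y : Euc (N + 1))‖ ^ (-μ') =
      ‖(y : Euc (N + 1))‖ ^ (-μ) * ‖(y : Euc (N + 1))‖ ^ (-(μ' - μ)) := by
    rw [← Real.rpow_add hy0]; congr 1; ring
  rw [h6]
  have h7 : 0 < ‖(y : Euc (N + 1))‖ ^ (-(μ' - μ)) := by positivity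
  have := mul_le_mul_of_nonneg_right h5 h7.le
  linarith

lemma dilationRate_nonpos (h : Tendsto (dilationField M ν) (atInfinity M) (𝓝 0)) :
    dilationRate M ν ≤ 0 := by
  refine sInf_le ⟨0, ?_, rfl⟩
  refine limsup_ofReal_eq_zero ?_
  simpa using h.abs

lemma abs_translationField_le (hν : IsUnitNormal N M ν) (b : Euc (N + 1)) (y : M) :
    |translationField M ν b y| ≤ ‖b‖ := by
  refine (abs_real_inner_le_norm _ _).trans ?_
  rw [hν.2.1 y y.2, mul_one]

/-- Elements of `D_μ(M)` with `μ < 0` tend to zero at infinity. -/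
lemma tendsto_of_mem_decayingFields {φ : M → ℝ} {μ : ℝ} (hμ : μ < 0)
    (hφ : φ ∈ decayingFields M ν μ) : Tendsto φ (atInfinity M) (𝓝 0) := by
  obtain ⟨-, -, K, hK⟩ := hφ
  have h1 : Tendsto (fun y : M => K * (1 + ‖(y : Euc (N + 1))‖) ^ (-(-μ))) (atInfinity M)
      (𝓝 0) := by
    have := ((tendsto_rpow_neg_atTop (neg_pos.2 hμ)).comp (tendsto_atTop_add_const_left _ 1
      (tendsto_comap (f := fun y : M => ‖(y : Euc (N + 1))‖)))).const_mul K
    rwa [mul_zero] at this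
  refine squeeze_zero_norm (fun y => ?_) h1
  have hy : 0 < 1 + ‖(y : Euc (N + 1))‖ := by positivity
  have h2 := hK y
  have h3 : 0 < (1 + ‖(y : Euc (N + 1))‖) ^ (-μ) := by positivity
  rw [abs_mul, abs_of_pos h3] at h2
  rw [Real.norm_eq_abs, Real.rpow_neg hy.le, ← div_eq_mul_inv, le_div_iff₀ h3]
  exact h2

end GeometricFields

/-- The rotation fields either vanish or grow linearly: a rotation whose field is tangent to the
cone generates symmetries of the cone, hence of `M`. -/
lemma IsMinimalGraphEnd.rotationField_eq_zero_or_hasLinearGrowth {m : ℕ} {M Γ : Set (Euc (m + 2))}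
    {n ν : Euc (m + 2) → Euc (m + 2)} {w : ℝ → Euc (m + 2) → ℝ} {R : ℝ}
    (h : IsMinimalGraphEnd m M Γ n ν w R) (hM : IsEmbeddedSubmanifold (m + 1) M)
    (hsymm : ∀ ρ : Euc (m + 2) ≃ₗᵢ[ℝ] Euc (m + 2), ρ '' coneOver Γ ⊆ coneOver Γ → ρ '' M ⊆ M)
    {B : Matrix (Fin (m + 2)) (Fin (m + 2)) ℝ} (hB : B = -B.transpose) :
    rotationField (N := m + 1) M ν B = 0 ∨
      HasLinearGrowth (N := m + 1) M (rotationField (N := m + 1) M ν B) := by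
  have hA := toEuclideanCLM_mem_skewAdjoint hB
  have hrot : rotationField (N := m + 1) M ν B =
      fun y : M => ⟪Matrix.toEuclideanCLM (𝕜 := ℝ) B (y : Euc (m + 2)), ν y⟫ := rfl
  rw [hrot]
  generalize Matrix.toEuclideanCLM (𝕜 := ℝ) B = A at hA
  by_cases hAn : ∀ θ ∈ Γ, ⟪A θ, n θ⟫ = 0
  · left
    ext y
    refine hM.inner_eq_zero_of_exp_smul_mem h.isUnitNormal_end (A := A) (fun t ht z hz => ?_) y.2
    obtain ⟨ρ, hρ⟩ := exists_linearIsometryEquiv_exp_smul hA t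
    have hρM := hsymm ρ (by
      rintro _ ⟨_, ⟨r, hr, θ, hθ, rfl⟩, rfl⟩
      refine ⟨r, hr, ρ θ, ?_, map_smul ρ r θ⟩
      rw [hρ]
      exact exp_smul_mem_of_tangent h.isCompact h.subset_sphere h.isEmbedded h.isUnitNormal
        h.inner_pos_normal (inner_self_eq_zero_of_mem_skewAdjoint hA) hAn hθ ht)
    rw [← hρ]
    exact hρM ⟨z, hz, rfl⟩
  · right
    push Not at hAn
    obtain ⟨θ, hθ, hAθ⟩ := hAn
    exact h.hasLinearGrowth hθ hAθ

theorem mainTheorem2 (N : ℕ) (hN : 3 ≤ N)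
    (S : Subgroup (Euc (N + 1) ≃ₗᵢ[ℝ] Euc (N + 1)))
    (Γ M : Set (Euc (N + 1))) (νC ν : Euc (N + 1) → Euc (N + 1))
    (hΓ : IsMinimalInSphere N Γ νC) (hM : IsMinimalHypersurface N M ν)
    (H1 : ¬ IsTrivialCone N Γ ∧ IsGroupInvariant S (coneOver Γ))
    (H2 : IsGroupInvariant S M)
    (H3 : IsAsymptoticToCone N M Γ νC)
    (H4 : ∀ ρ : Euc (N + 1) ≃ₗᵢ[ℝ] Euc (N + 1), ρ '' coneOver Γ ⊆ coneOver Γ → ρ ∈ S) :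
    (∀ μ : ℝ, (μ : EReal) < dilationRate M ν →
      (geometricFields M ν : Set (M → ℝ)) ∩ decayingFields M ν μ = {0}) ∧
    (∀ b : Euc (N + 1), translationField M ν b ≠ 0 →
      0 < limsup (fun y : M => ENNReal.ofReal |translationField M ν b y|) (atInfinity M)) ∧
    (∀ B : Matrix (Fin (N + 1)) (Fin (N + 1)) ℝ, B = -B.transpose →
      rotationField M ν B = 0 ∨ HasLinearGrowth M (rotationField M ν B)) ∧
    Tendsto (dilationField M ν) (atInfinity M) (𝓝 0) := by
  obtain ⟨m, rfl⟩ : ∃ m, N = m + 1 := ⟨N - 1, by omega⟩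
  obtain ⟨hc, hs, hemb, hn, hθn, hmin⟩ := hΓ
  obtain ⟨hMemb, hν, hMmin⟩ := hM
  obtain ⟨R, hR, w, hw, ⟨K, hK⟩, hlim, hsub, hcpt⟩ := H3
  have h : IsMinimalGraphEnd m M Γ νC ν w R :=
    ⟨hc, hs, hemb, hn, hθn, hmin, hν, hMmin, hw, hlim, hsub⟩
  have hne : Γ.Nonempty := by
    by_contra hΓ0
    refine H1.1 ?_
    have : Fact (Module.finrank ℝ (Euc (m + 1 + 1)) = m + 1 + 1) := ⟨by simp⟩
    exact ⟨(ℝ ∙ (EuclideanSpace.single 0 1 : Euc (m + 1 + 1)))ᗮ,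
      Submodule.finrank_orthogonal_span_singleton (by simp),
      by rw [not_nonempty_iff_eq_empty.1 hΓ0]; exact empty_subset _⟩
  have h4 := h.tendsto_dilationField hR hK hcpt
  have h2 : ∀ b : Euc (m + 1 + 1), translationField M ν b ≠ 0 →
      0 < limsup (fun y : M => ENNReal.ofReal |translationField M ν b y|) (atInfinity M) :=
    fun b hb => h.limsup_translationField_pos hne H1.1 fun hb0 => hb (by
      ext y; simp [translationField, hb0])
  have h3 : ∀ B : Matrix (Fin (m + 1 + 1)) (Fin (m + 1 + 1)) ℝ, B = -B.transpose →
      rotationField M ν B = 0 ∨ HasLinearGrowth M (rotationField M ν B) := fun B hB =>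
    h.rotationField_eq_zero_or_hasLinearGrowth hMemb (fun ρ hρ => H2 ρ (H4 ρ hρ)) hB
  refine ⟨fun μ hμ => Subset.antisymm ?_ ?_, h2, h3, h4⟩
  · rintro φ ⟨hφG, hφ⟩
    obtain ⟨c, b, B, hB, rfl⟩ := exists_eq_of_mem_geometricFields hφG
    have hμ0 : μ < 0 := by exact_mod_cast hμ.trans_le (dilationRate_nonpos h4)
    have hφ0 := tendsto_of_mem_decayingFields hμ0 hφ
    have hrest := hφ0.sub (h4.const_smul c)
    rw [smul_zero, sub_zero] at hrest
    -- `ζ_B` is bounded, as `φ`, `ζ₀` and `ζ_b` are, which excludes linear growth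
    have hrot : rotationField M ν B = 0 := by
      refine (h3 B hB).resolve_right ?_
      rintro ⟨k, L, t₀, hk, hgrow⟩
      obtain ⟨t₁, ht₁⟩ := eventually_atInfinity.1
        (hrest.eventually (Metric.ball_mem_nhds (0 : ℝ) one_pos))
      set t := max (max t₀ t₁) ((‖b‖ + 2) / k)
      obtain ⟨y, hy, hky⟩ := (hgrow t ((le_max_left _ _).trans (le_max_left _ _))).1
      have e1 := ht₁ y (((le_max_right _ _).trans (le_max_left _ _)).trans_eq hy.symm)
      have e2 := abs_translationField_le hν b y
      have e3 : ‖b‖ + 2 ≤ k * t := (div_le_iff₀' hk).1 (le_max_right _ _)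
      rw [dist_zero_right, Real.norm_eq_abs] at e1
      simp only [Pi.add_apply, Pi.smul_apply] at e1
      have e4 : rotationField M ν B y = c • dilationField M ν y + translationField M ν b y +
        rotationField M ν B y - c • dilationField M ν y - translationField M ν b y := by abel
      have e5 := abs_sub (c • dilationField M ν y + translationField M ν b y +
        rotationField M ν B y - c • dilationField M ν y) (translationField M ν b y)
      rw [← e4] at e5
      linarith
    rw [hrot, add_zero] at hφ hrest
    have htrans : translationField M ν b = 0 := by
      by_contra hb
      have e1 : Tendsto (translationField M ν b) (atInfinity M) (𝓝 0) :=
        hrest.congr fun y => by simp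
      have e2 := limsup_ofReal_eq_zero (f := fun y => |translationField M ν b y|)
        (by simpa using e1.abs)
      exact (h2 b hb).ne' e2
    rw [htrans, add_zero] at hφ
    rw [hrot, htrans, add_zero, add_zero, mem_singleton_iff]
    by_contra hne0
    have hc0 : c ≠ 0 := fun hc0 => hne0 (by rw [hc0, zero_smul])
    obtain ⟨-, -, L, hL⟩ := hφ
    obtain ⟨μ', hμμ', hμ'⟩ := EReal.lt_iff_exists_real_btwn.1 hμ
    exact hμ'.not_ge (dilationRate_le hμ0 (EReal.coe_lt_coe_iff.1 hμμ') hc0 hL)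
  · rintro _ rfl
    exact ⟨Submodule.zero_mem _, zero_mem_decayingFields μ⟩

end
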